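/- Let $S^1=\mathbb R/2\pi\mathbb Z$ and let $\phi:\mathbb R\times S^1\to\mathbb R$ be smooth. Assume that $\phi$ is constant in $x$ for large $|x|$, i.e. there is $R>0$ such that $\phi(x,y)=\phi(R,y)$ for $x\ge R$ and $\phi(x,y)=\phi(-R,y)$ for $x\le -R$. Let $\Omega'$ be one of $$\Omega_+=\{(x,y)\in\mathbb R\times S^1: x>0\},\quad \Omega_-=\{(x,y)\in\mathbb R\times S^1: x<0\},\quad \Omega=\{(x,y)\in\mathbb R\times S^1: x\ne 0\},$$ with the Riemannian metric $g=\mathrm{diag}(1,x^{-2}e^{-2\phi(x,y)})$, Riemannian area $\omega$, Gaussian curvature $K$ and Laplace–Beltrami operator $\Delta=\mathrm{div}_\omega\circ\mathrm{grad}_g$. Let $c\in(0,1/2)$ and let $A=-\Delta+cK$ with domain $C_0^\infty(\Omega')$, acting on the complex Hilbert space $L^2(\Omega',\omega)$. Then $A$ is densely defined and symmetric (so it is closable and $\overline A\subset A^*$), and $$\dim \mathcal D(A^*)/\mathcal D(\overline A)=\infty .$$ Moreover, $A$ has infinite deficiency indices: $\ker(A^*-\mathrm i)$ and $\ker(A^*+\mathrm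 i)$ are both infinite-dimensional. More precisely, for every $\epsilon>0$ there are functions $h_{+},h_{-}\in L^2(\Omega',\omega)\cap C^\infty(\Omega')$, vanishing where $|x|\ge\epsilon$, such that $h_{\pm}e^{\mathrm iky}\in\mathcal D(A^*)$ for all $k\in\mathbb Z$, and the classes of the functions $h_{+}e^{\mathrm iky}$, $h_{-}e^{\mathrm iky}$ ($k\in\mathbb Z$) in $\mathcal D(A^*)/\mathcal D(\overline A)$ are linearly independent. -/

import Mathlib

noncomputable section

namespace Grushin

open scoped ContDiff

instance fact_two_pi_pos : Fact (0 < 2 * Real.pi) := ⟨Real.two_pi_pos⟩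

/-- The cylinder `ℝ × S¹`, where `S¹ = ℝ / 2πℤ`. -/
abbrev Cyl : Type := ℝ × AddCircle (2 * Real.pi)

/-- The universal covering map `ℝ² → ℝ × S¹`. -/
def cover (q : ℝ × ℝ) : Cyl := (q.1, (q.2 : AddCircle (2 * Real.pi)))

variable {E : Type*} [NormedAddCommGroup E] [NormedSpace ℝ E]

/-- A function on the cylinder is smooth on the (open) set `D` if its lift to the universal
cover `ℝ²` is smooth on the preimage of `D`. -/
def SmoothOn (u : Cyl → E) (D : Set Cyl) : Prop :=
  ContDiffOn ℝ ∞ (u ∘ cover) (cover ⁻¹' D)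

/-- The coordinate directions: index `0` is `x`, index `1` is `y`. -/
def dir : Fin 2 → ℝ × ℝ := ![(1, 0), (0, 1)]

/-- The coordinate derivatives `∂_x` (index `0`) and `∂_y` (index `1`) on the cylinder. -/
def pd (i : Fin 2) (u : Cyl → E) (p : Cyl) : E :=
  deriv (fun t : ℝ => u (p + cover (t • dir i))) 0

/-! ### Calculus of smooth functions on the cylinder -/

theorem cover_add (a b : ℝ × ℝ) : cover (a + b) = cover a + cover b := by
  simp [cover]

theorem isOpenQuotientMap_cover : IsOpenQuotientMap cover :=
  IsOpenQuotientMap.id.prodMap QuotientAddGroup.isOpenQuotientMap_mk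

theorem isOpen_preimage {D : Set Cyl} (hD : IsOpen D) : IsOpen (cover ⁻¹' D) :=
  hD.preimage isOpenQuotientMap_cover.continuous

theorem SmoothOn.mono {u : Cyl → E} {D D' : Set Cyl} (hu : SmoothOn u D) (h : D' ⊆ D) :
    SmoothOn u D' :=
  ContDiffOn.mono hu (Set.preimage_mono h)

theorem SmoothOn.differentiableAt {u : Cyl → E} {D : Set Cyl} (hD : IsOpen D)
    (hu : SmoothOn u D) {q : ℝ × ℝ} (hq : cover q ∈ D) :
    DifferentiableAt ℝ (u ∘ cover) q :=
  (ContDiffOn.contDiffAt hu ((isOpen_preimage hD).mem_nhds hq)).differentiableAt (by simp)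

theorem pd_cover {u : Cyl → E} {q : ℝ × ℝ} (i : Fin 2)
    (h : DifferentiableAt ℝ (u ∘ cover) q) :
    pd i u (cover q) = fderiv ℝ (u ∘ cover) q (dir i) := by
  rw [← h.lineDeriv_eq_fderiv]
  simp only [pd, lineDeriv, Function.comp_apply, cover_add]

theorem SmoothOn.pd {u : Cyl → E} {D : Set Cyl} (hD : IsOpen D) (hu : SmoothOn u D)
    (i : Fin 2) : SmoothOn (pd i u) D := by
  have h1 : ContDiffOn ℝ ∞ (fderiv ℝ (u ∘ cover)) (cover ⁻¹' D) :=
    ContDiffOn.fderiv_of_isOpen hu (isOpen_preimage hD) (by simp)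
  have h2 : ContDiffOn ℝ ∞ (fun q => fderiv ℝ (u ∘ cover) q (dir i)) (cover ⁻¹' D) :=
    h1.clm_apply contDiffOn_const
  exact h2.congr fun q hq => pd_cover i (hu.differentiableAt hD hq)

theorem SmoothOn.continuousOn {u : Cyl → E} {D : Set Cyl} (hD : IsOpen D)
    (hu : SmoothOn u D) : ContinuousOn u D := by
  intro p hp
  obtain ⟨q, rfl⟩ := isOpenQuotientMap_cover.surjective p
  exact (isOpenQuotientMap_cover.continuousAt_comp_iff.1
    (hu.differentiableAt hD hp).continuousAt).continuousWithinAt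

theorem SmoothOn.add {u v : Cyl → E} {D : Set Cyl} (hu : SmoothOn u D) (hv : SmoothOn v D) :
    SmoothOn (fun p => u p + v p) D := ContDiffOn.add hu hv

theorem SmoothOn.sub {u v : Cyl → E} {D : Set Cyl} (hu : SmoothOn u D) (hv : SmoothOn v D) :
    SmoothOn (fun p => u p - v p) D := ContDiffOn.sub hu hv

theorem SmoothOn.neg {u : Cyl → E} {D : Set Cyl} (hu : SmoothOn u D) :
    SmoothOn (fun p => -u p) D := ContDiffOn.neg hu

theorem SmoothOn.smul {a : Cyl → ℝ} {u : Cyl → E} {D : Set Cyl} (ha : SmoothOn a D)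
    (hu : SmoothOn u D) : SmoothOn (fun p => a p • u p) D := ContDiffOn.smul ha hu

theorem SmoothOn.mul {a b : Cyl → ℝ} {D : Set Cyl} (ha : SmoothOn a D)
    (hb : SmoothOn b D) : SmoothOn (fun p => a p * b p) D := ContDiffOn.mul ha hb

theorem SmoothOn.const {D : Set Cyl} (e : E) : SmoothOn (fun _ : Cyl => e) D := contDiffOn_const

theorem SmoothOn.inv {a : Cyl → ℝ} {D : Set Cyl} (ha : SmoothOn a D) (h : ∀ p ∈ D, a p ≠ 0) :
    SmoothOn (fun p => (a p)⁻¹) D := ContDiffOn.inv ha fun _ hq => h _ hq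

theorem SmoothOn.sqrt {a : Cyl → ℝ} {D : Set Cyl} (ha : SmoothOn a D) (h : ∀ p ∈ D, a p ≠ 0) :
    SmoothOn (fun p => Real.sqrt (a p)) D := ContDiffOn.sqrt ha fun _ hq => h _ hq

theorem SmoothOn.sum {ι : Type*} {s : Finset ι} {u : ι → Cyl → E} {D : Set Cyl}
    (hu : ∀ i ∈ s, SmoothOn (u i) D) : SmoothOn (fun p => ∑ i ∈ s, u i p) D := by
  have h : ContDiffOn ℝ ∞ (fun q => ∑ i ∈ s, (u i ∘ cover) q) (cover ⁻¹' D) :=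
    ContDiffOn.sum hu
  exact h

/-! `pd` at a point of an open set depends only on the function on that set. -/

theorem pd_congr {u v : Cyl → E} {O : Set Cyl} (hO : IsOpen O) (h : Set.EqOn u v O)
    (i : Fin 2) : Set.EqOn (pd i u) (pd i v) O := by
  intro p hp
  apply Filter.EventuallyEq.deriv_eq
  have hc : Continuous fun t : ℝ => p + cover (t • dir i) :=
    continuous_const.add (isOpenQuotientMap_cover.continuous.comp (by fun_prop))
  have h0 : (fun t : ℝ => p + cover (t • dir i)) 0 ∈ O := by
    have : cover (0 : ℝ × ℝ) = 0 := rfl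
    simpa [this] using hp
  filter_upwards [(hO.preimage hc).mem_nhds h0] with t ht using h ht

theorem pd_add {u v : Cyl → E} {D : Set Cyl} (hD : IsOpen D) (hu : SmoothOn u D)
    (hv : SmoothOn v D) (i : Fin 2) :
    Set.EqOn (pd i (fun p => u p + v p)) (fun p => pd i u p + pd i v p) D := by
  intro p hp
  obtain ⟨q, rfl⟩ := isOpenQuotientMap_cover.surjective p
  have h1 := hu.differentiableAt hD hp
  have h2 := hv.differentiableAt hD hp
  have e : (fun p => u p + v p) ∘ cover = (u ∘ cover) + (v ∘ cover) := rfl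
  simp only [pd_cover i h1, pd_cover i h2]
  rw [pd_cover i (by rw [e]; exact h1.add h2), e, fderiv_add h1 h2]
  rfl

theorem pd_smul {u : Cyl → ℂ} {D : Set Cyl} (hD : IsOpen D) (hu : SmoothOn u D) (z : ℂ)
    (i : Fin 2) : Set.EqOn (pd i (fun p => z * u p)) (fun p => z * pd i u p) D := by
  intro p hp
  obtain ⟨q, rfl⟩ := isOpenQuotientMap_cover.surjective p
  have h1 := hu.differentiableAt hD hp
  have e : (fun p => z * u p) ∘ cover = fun q => z • (u ∘ cover) q := rfl
  simp only [pd_cover i h1]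
  rw [pd_cover i (by rw [e]; exact h1.const_smul z), e, fderiv_fun_const_smul h1]
  rfl

/-! ### Riemannian geometry in the coordinates `(x, y)` -/

/-- A Riemannian metric `g = ∑ g_ij dx^i dx^j` on an open subset `D` of the cylinder. (The values
of `coeff` outside `D` are irrelevant.) -/
structure RiemMetric (D : TopologicalSpace.Opens Cyl) where
  /-- the matrix `(g_ij)` -/
  coeff : Cyl → Matrix (Fin 2) (Fin 2) ℝ
  smooth : ∀ i j, SmoothOn (fun p => coeff p i j) D
  posDef : ∀ p ∈ D, (coeff p).PosDef

section Geometry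

variable (g : Cyl → Matrix (Fin 2) (Fin 2) ℝ)

/-- The Christoffel symbol `Γ^k_ij = ½ ∑_l g^{kl} (∂_i g_jl + ∂_j g_il - ∂_l g_ij)`. -/
def christoffel (k i j : Fin 2) (p : Cyl) : ℝ :=
  (1 / 2) * ∑ l, (g p)⁻¹ k l *
    (pd i (fun q => g q j l) p + pd j (fun q => g q i l) p - pd l (fun q => g q i j) p)

/-- The component `R^l` of `R(∂_i, ∂_j) ∂_k = ∇_i ∇_j ∂_k - ∇_j ∇_i ∂_k = ∑_l R^l ∂_l`. -/
def riemann (l k i j : Fin 2) (p : Cyl) : ℝ :=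
  pd i (christoffel g l j k) p - pd j (christoffel g l i k) p +
    ∑ m, (christoffel g l i m p * christoffel g m j k p -
      christoffel g l j m p * christoffel g m i k p)

/-- The Gaussian curvature `K = g(R(∂_x, ∂_y) ∂_y, ∂_x) / det g`. -/
def gaussCurvature (p : Cyl) : ℝ :=
  (∑ l, g p 0 l * riemann g l 1 0 1 p) / (g p).det

/-- The density `√(det g)` of the Riemannian area `ω` with respect to `dx dy`. -/
def areaDensity (p : Cyl) : ℝ := Real.sqrt (g p).det

/-- The Riemannian gradient `(grad_g u)^i = ∑_j g^{ij} ∂_j u`. -/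
def grad (u : Cyl → ℂ) (i : Fin 2) (p : Cyl) : ℂ := ∑ j, (g p)⁻¹ i j • pd j u p

/-- The divergence with respect to `ω`: `div_ω X = (det g)^{-1/2} ∑_i ∂_i ((det g)^{1/2} X^i)`. -/
def divergence (X : Fin 2 → Cyl → ℂ) (p : Cyl) : ℂ :=
  (areaDensity g p)⁻¹ • ∑ i, pd i (fun q => areaDensity g q • X i q) p

/-- The Laplace-Beltrami operator `Δ = div_ω ∘ grad_g`. -/
def laplaceBeltrami (u : Cyl → ℂ) : Cyl → ℂ := divergence g (grad g u)

/-- The differential expression `-Δ + c K`. -/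
def curvatureLaplaceExpr (c : ℝ) (u : Cyl → ℂ) (p : Cyl) : ℂ :=
  -laplaceBeltrami g u p + (c * gaussCurvature g p) • u p

/-- The Riemannian area `ω` on `D`, as a measure on the cylinder that lives on `D`. -/
def area (D : Set Cyl) : MeasureTheory.Measure Cyl :=
  (MeasureTheory.volume.withDensity fun p => ENNReal.ofReal (areaDensity g p)).restrict D

end Geometry

/-- The space `C₀^∞(D)` of smooth complex functions with compact support in `D`, extended by zero
to the whole cylinder. -/
def testFunctions (D : TopologicalSpace.Opens Cyl) : Submodule ℂ (Cyl → ℂ) where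
  carrier := {u | SmoothOn u Set.univ ∧ HasCompactSupport u ∧ tsupport u ⊆ D}
  add_mem' := by
    rintro u v ⟨hu, hu', hu''⟩ ⟨hv, hv', hv''⟩
    exact ⟨hu.add hv, hu'.add hv', (tsupport_add u v).trans (Set.union_subset hu'' hv'')⟩
  zero_mem' := by
    refine ⟨SmoothOn.const 0, HasCompactSupport.zero, ?_⟩
    simp [tsupport]
  smul_mem' := by
    rintro z u ⟨hu, hu', hu''⟩
    refine ⟨ContDiffOn.const_smul z hu, hu'.mono (Function.support_const_smul_subset z u),
      (closure_mono (Function.support_const_smul_subset z u)).trans hu''⟩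

/-! ### Regularity of the geometric quantities -/

section Regularity

variable {D : TopologicalSpace.Opens Cyl} (g : RiemMetric D)

theorem det_pos {p : Cyl} (hp : p ∈ D) : 0 < (g.coeff p).det := (g.posDef p hp).det_pos

theorem areaDensity_pos {p : Cyl} (hp : p ∈ D) : 0 < areaDensity g.coeff p :=
  Real.sqrt_pos.2 (det_pos g hp)

theorem smooth_det : SmoothOn (fun p => (g.coeff p).det) D := by
  simp only [Matrix.det_fin_two]
  exact ((g.smooth 0 0).mul (g.smooth 1 1)).sub ((g.smooth 0 1).mul (g.smooth 1 0))

theorem smooth_areaDensity : SmoothOn (areaDensity g.coeff) D :=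
  (smooth_det g).sqrt fun _ hp => (det_pos g hp).ne'

theorem smooth_inv (i j : Fin 2) : SmoothOn (fun p => (g.coeff p)⁻¹ i j) D := by
  have h : ∀ i j, SmoothOn (fun p => (g.coeff p).adjugate i j) D := by
    intro i j
    simp only [Matrix.adjugate_fin_two]
    fin_cases i <;> fin_cases j
    · exact g.smooth 1 1
    · exact (g.smooth 0 1).neg
    · exact (g.smooth 1 0).neg
    · exact g.smooth 0 0
  simp only [Matrix.inv_def, Ring.inverse_eq_inv', Matrix.smul_apply, smul_eq_mul]
  exact ((smooth_det g).inv fun _ hp => (det_pos g hp).ne').mul (h i j)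

theorem smooth_christoffel (k i j : Fin 2) : SmoothOn (christoffel g.coeff k i j) D := by
  refine (SmoothOn.const _).mul (SmoothOn.sum fun l _ => (smooth_inv g k l).mul ?_)
  exact (((g.smooth j l).pd D.isOpen i).add ((g.smooth i l).pd D.isOpen j)).sub
    ((g.smooth i j).pd D.isOpen l)

theorem smooth_riemann (l k i j : Fin 2) : SmoothOn (riemann g.coeff l k i j) D := by
  refine (((smooth_christoffel g l j k).pd D.isOpen i).sub
    ((smooth_christoffel g l i k).pd D.isOpen j)).add (SmoothOn.sum fun m _ => ?_)
  exact ((smooth_christoffel g _ _ _).mul (smooth_christoffel g _ _ _)).sub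
    ((smooth_christoffel g _ _ _).mul (smooth_christoffel g _ _ _))

theorem smooth_gaussCurvature : SmoothOn (gaussCurvature g.coeff) D := by
  have h : SmoothOn (fun p => (∑ l, g.coeff p 0 l * riemann g.coeff l 1 0 1 p) *
      ((g.coeff p).det)⁻¹) D :=
    (SmoothOn.sum fun l _ => (g.smooth 0 l).mul (smooth_riemann g l 1 0 1)).mul
      ((smooth_det g).inv fun _ hp => (det_pos g hp).ne')
  exact h

theorem smooth_grad {u : Cyl → ℂ} (hu : SmoothOn u D) (i : Fin 2) :
    SmoothOn (grad g.coeff u i) D :=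
  SmoothOn.sum fun j _ => (smooth_inv g i j).smul (hu.pd D.isOpen j)

theorem smooth_laplaceBeltrami {u : Cyl → ℂ} (hu : SmoothOn u D) :
    SmoothOn (laplaceBeltrami g.coeff u) D :=
  ((smooth_areaDensity g).inv fun _ hp => (areaDensity_pos g hp).ne').smul
    (SmoothOn.sum fun i _ => ((smooth_areaDensity g).smul (smooth_grad g hu i)).pd D.isOpen i)

theorem smooth_expr (c : ℝ) {u : Cyl → ℂ} (hu : SmoothOn u D) :
    SmoothOn (curvatureLaplaceExpr g.coeff c u) D :=
  (smooth_laplaceBeltrami g hu).neg.add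
    (((SmoothOn.const c).mul (smooth_gaussCurvature g)).smul hu)

theorem expr_add (c : ℝ) {u v : Cyl → ℂ} (hu : SmoothOn u D) (hv : SmoothOn v D) :
    Set.EqOn (curvatureLaplaceExpr g.coeff c (u + v))
      (curvatureLaplaceExpr g.coeff c u + curvatureLaplaceExpr g.coeff c v) D := by
  have hgr : ∀ i, Set.EqOn (fun q => areaDensity g.coeff q • grad g.coeff (u + v) i q)
      (fun q => areaDensity g.coeff q • grad g.coeff u i q +
        areaDensity g.coeff q • grad g.coeff v i q) D := by
    intro i q hq
    have : ∀ j, pd j (u + v) q = pd j u q + pd j v q := fun j => pd_add D.isOpen hu hv j hq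
    simp only [grad, this, smul_add, Finset.sum_add_distrib]
  intro p hp
  have h2 : ∀ i, pd i (fun q => areaDensity g.coeff q • grad g.coeff (u + v) i q) p =
      pd i (fun q => areaDensity g.coeff q • grad g.coeff u i q) p +
      pd i (fun q => areaDensity g.coeff q • grad g.coeff v i q) p := fun i =>
    (pd_congr D.isOpen (hgr i) i hp).trans
      (pd_add D.isOpen ((smooth_areaDensity g).smul (smooth_grad g hu i))
        ((smooth_areaDensity g).smul (smooth_grad g hv i)) i hp)
  simp only [curvatureLaplaceExpr, laplaceBeltrami, divergence, h2, Pi.add_apply, smul_add,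
    Finset.sum_add_distrib]
  abel

theorem expr_smul (c : ℝ) (z : ℂ) {u : Cyl → ℂ} (hu : SmoothOn u D) :
    Set.EqOn (curvatureLaplaceExpr g.coeff c (z • u))
      (z • curvatureLaplaceExpr g.coeff c u) D := by
  have hgr : ∀ i, Set.EqOn (fun q => areaDensity g.coeff q • grad g.coeff (z • u) i q)
      (fun q => z * (areaDensity g.coeff q • grad g.coeff u i q)) D := by
    intro i q hq
    have : ∀ j, pd j (z • u) q = z * pd j u q := fun j => pd_smul D.isOpen hu z j hq
    simp only [grad, this, Complex.real_smul, Finset.mul_sum]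
    exact Finset.sum_congr rfl fun j _ => by ring
  intro p hp
  have h2 : ∀ i, pd i (fun q => areaDensity g.coeff q • grad g.coeff (z • u) i q) p =
      z * pd i (fun q => areaDensity g.coeff q • grad g.coeff u i q) p := fun i =>
    (pd_congr D.isOpen (hgr i) i hp).trans
      (pd_smul D.isOpen ((smooth_areaDensity g).smul (smooth_grad g hu i)) z i hp)
  simp only [curvatureLaplaceExpr, laplaceBeltrami, divergence, Finset.sum_congr rfl fun i _ => h2 i,
    ← Finset.mul_sum]
  simp only [Pi.smul_apply, curvatureLaplaceExpr, laplaceBeltrami, divergence, smul_eq_mul]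
  rw [mul_add, mul_neg, mul_smul_comm, mul_smul_comm]

theorem expr_zero (c : ℝ) {u : Cyl → ℂ} {O : Set Cyl} (hO : IsOpen O)
    (hu : Set.EqOn u 0 O) : Set.EqOn (curvatureLaplaceExpr g.coeff c u) 0 O := by
  have hz : ∀ (i : Fin 2) (p : Cyl), pd i (0 : Cyl → ℂ) p = 0 := fun i p => by
    simp [Grushin.pd]
  have hgr : ∀ i, Set.EqOn (fun q => areaDensity g.coeff q • grad g.coeff u i q) 0 O := by
    intro i q hq
    have : ∀ j, pd j u q = 0 := fun j => (pd_congr hO hu j hq).trans (hz j q)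
    simp [grad, this]
  intro p hp
  have h2 : ∀ i, pd i (fun q => areaDensity g.coeff q • grad g.coeff u i q) p = 0 :=
    fun i => (pd_congr hO (hgr i) i hp).trans (hz i p)
  simp only [curvatureLaplaceExpr, laplaceBeltrami, divergence, h2, hu hp]
  simp

theorem memLp_of_continuousOn {v : Cyl → ℂ} {K : Set Cyl} (hK : IsCompact K)
    (hKD : K ⊆ D) (hv : ContinuousOn v D) (hz : ∀ p ∈ D, p ∉ K → v p = 0) :
    MeasureTheory.MemLp v 2 (area g.coeff D) := by
  have hm : MeasureTheory.AEStronglyMeasurable v (area g.coeff D) :=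
    hv.aestronglyMeasurable D.isOpen.measurableSet
  obtain ⟨C, hC⟩ := hK.exists_bound_of_continuousOn (hv.mono hKD)
  obtain ⟨B, hB⟩ := hK.exists_bound_of_continuousOn
    (((smooth_areaDensity g).continuousOn D.isOpen).mono hKD)
  have hfin : area g.coeff D K < ⊤ := by
    refine lt_of_le_of_lt (MeasureTheory.Measure.restrict_apply_le _ _) ?_
    rw [MeasureTheory.withDensity_apply _ hK.measurableSet]
    refine lt_of_le_of_lt (MeasureTheory.setLIntegral_mono' (g := fun _ => ENNReal.ofReal B)
      hK.measurableSet fun p hp => ENNReal.ofReal_le_ofReal ((le_abs_self _).trans (hB p hp))) ?_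
    rw [MeasureTheory.setLIntegral_const]
    exact ENNReal.mul_lt_top ENNReal.ofReal_lt_top hK.measure_lt_top
  have hfin' : MeasureTheory.IsFiniteMeasure ((area g.coeff D).restrict K) :=
    ⟨by rwa [MeasureTheory.Measure.restrict_apply_univ]⟩
  have h1 : MeasureTheory.MemLp v 2 ((area g.coeff D).restrict K) := by
    refine MeasureTheory.MemLp.of_bound hm.restrict C ?_
    exact (MeasureTheory.ae_restrict_iff' hK.measurableSet).2 (.of_forall hC)
  refine MeasureTheory.MemLp.ae_eq ?_ ((MeasureTheory.memLp_indicator_iff_restrict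
    hK.measurableSet).2 h1)
  refine (MeasureTheory.ae_restrict_iff' D.isOpen.measurableSet).2 (.of_forall fun p hp => ?_)
  by_cases h : p ∈ K
  · simp [h]
  · simp [h, hz p hp h]

theorem memLp_test (u : testFunctions D) :
    MeasureTheory.MemLp (u : Cyl → ℂ) 2 (area g.coeff D) :=
  memLp_of_continuousOn g u.2.2.1 u.2.2.2
    ((u.2.1.mono (Set.subset_univ _)).continuousOn D.isOpen)
    fun _ _ h => image_eq_zero_of_notMem_tsupport h

theorem memLp_expr (c : ℝ) (u : testFunctions D) :
    MeasureTheory.MemLp (curvatureLaplaceExpr g.coeff c (u : Cyl → ℂ)) 2 (area g.coeff D) :=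
  memLp_of_continuousOn g u.2.2.1 u.2.2.2
    ((smooth_expr g c (u.2.1.mono (Set.subset_univ _))).continuousOn D.isOpen)
    fun _ _ h => expr_zero g c (isClosed_tsupport _).isOpen_compl
      (fun _ hq => image_eq_zero_of_notMem_tsupport hq) h

theorem ae_eq_of_eqOn {v w : Cyl → ℂ} (h : Set.EqOn v w D) : v =ᵐ[area g.coeff D] w :=
  (MeasureTheory.ae_restrict_iff' D.isOpen.measurableSet).2 (.of_forall h)

end Regularity

/-! ### The operator `-Δ + c K` on `L²(D, ω)` -/

section Operator

variable {D : TopologicalSpace.Opens Cyl} (g : RiemMetric D)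

/-- The Hilbert space `L²(D, ω)` of complex-valued functions. -/
abbrev L2 : Type := MeasureTheory.Lp ℂ 2 (area g.coeff D)

/-- The inclusion `C₀^∞(D) → L²(D, ω)`. -/
def testToL2 : testFunctions D →ₗ[ℂ] L2 g where
  toFun u := (memLp_test g u).toLp _
  map_add' _ _ := rfl
  map_smul' _ _ := rfl

/-- The map `u ↦ (-Δ + c K) u` from `C₀^∞(D)` to `L²(D, ω)`. -/
def exprToL2 (c : ℝ) : testFunctions D →ₗ[ℂ] L2 g where
  toFun u := (memLp_expr g c u).toLp _
  map_add' u v := by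
    rw [← MeasureTheory.MemLp.toLp_add]
    exact MeasureTheory.MemLp.toLp_congr _ _ (ae_eq_of_eqOn g
      (expr_add g c (u.2.1.mono (Set.subset_univ _)) (v.2.1.mono (Set.subset_univ _))))
  map_smul' z u := by
    rw [RingHom.id_apply, ← MeasureTheory.MemLp.toLp_const_smul]
    exact MeasureTheory.MemLp.toLp_congr _ _ (ae_eq_of_eqOn g
      (expr_smul g c z (u.2.1.mono (Set.subset_univ _))))

theorem testToL2_injective : Function.Injective (testToL2 g) := by
  rw [injective_iff_map_eq_zero]
  intro u hu
  have hcont : ContinuousOn (u : Cyl → ℂ) D :=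
    (u.2.1.mono (Set.subset_univ _)).continuousOn D.isOpen
  have h1 : (u : Cyl → ℂ) =ᵐ[area g.coeff D] 0 :=
    (MeasureTheory.MemLp.toLp_eq_toLp_iff (memLp_test g u) MeasureTheory.MemLp.zero).1 hu
  have h2 : (u : Cyl → ℂ) =ᵐ[MeasureTheory.volume.restrict (D : Set Cyl)] 0 := by
    refine MeasureTheory.Measure.AbsolutelyContinuous.ae_le ?_ h1
    rw [area, MeasureTheory.restrict_withDensity D.isOpen.measurableSet]
    refine MeasureTheory.withDensity_absolutelyContinuous' ?_ ?_
    · exact (((smooth_areaDensity g).continuousOn D.isOpen).aemeasurable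
        D.isOpen.measurableSet).ennreal_ofReal
    · refine (MeasureTheory.ae_restrict_iff' D.isOpen.measurableSet).2 (.of_forall fun p hp => ?_)
      simpa using areaDensity_pos g hp
  have h3 : Set.EqOn (u : Cyl → ℂ) 0 D :=
    MeasureTheory.Measure.eqOn_open_of_ae_eq h2 D.isOpen hcont continuousOn_const
  ext p
  by_cases hp : p ∈ tsupport (u : Cyl → ℂ)
  · exact h3 (u.2.2.2 hp)
  · exact image_eq_zero_of_notMem_tsupport hp

/-- The curvature Laplacian `-Δ + c K` with domain `C₀^∞(D)`, as an unbounded operator on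
`L²(D, ω)`. -/
def curvatureLaplacian (c : ℝ) : L2 g →ₗ.[ℂ] L2 g where
  domain := LinearMap.range (testToL2 g)
  toFun := (exprToL2 g c).comp
    (LinearEquiv.ofInjective (testToL2 g) (testToL2_injective g)).symm.toLinearMap

end Operator

/-! ### Abstract notions for an unbounded operator -/

section Abstract

variable {H : Type*} [NormedAddCommGroup H] [InnerProductSpace ℂ H] [CompleteSpace H]

/-- The subspace `D(closure of A) ∩ D(A*)` of `D(A*)`; it is `D(closure of A)` when `A` is
symmetric. -/
def closureDomain (A : H →ₗ.[ℂ] H) : Submodule ℂ A.adjoint.domain :=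
  A.closure.domain.comap A.adjoint.domain.subtype

/-- The quotient space `D(A*) / D(closure of A)`. -/
abbrev AdjointModClosure (A : H →ₗ.[ℂ] H) : Type _ := A.adjoint.domain ⧸ closureDomain A

/-- The space `ker(A* - z)`. The deficiency indices of `A` are the dimensions of these spaces for
`z = i` and `z = -i`. -/
def deficiencySpace (A : H →ₗ.[ℂ] H) (z : ℂ) : Submodule ℂ A.adjoint.domain :=
  LinearMap.ker (A.adjoint.toFun - z • A.adjoint.domain.subtype)

end Abstract

/-! ### The Grushin zone -/

/-- The three manifolds `Ω₊ = {x > 0}`, `Ω₋ = {x < 0}` and `Ω = {x ≠ 0}`. -/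
inductive Zone
  | plus
  | minus
  | both

/-- The open subset of the cylinder belonging to a zone. -/
def Zone.region : Zone → TopologicalSpace.Opens Cyl
  | .plus => ⟨{p | 0 < p.1}, isOpen_lt continuous_const continuous_fst⟩
  | .minus => ⟨{p | p.1 < 0}, isOpen_lt continuous_fst continuous_const⟩
  | .both => ⟨{p | p.1 ≠ 0}, isOpen_ne_fun continuous_fst continuous_const⟩

theorem Zone.fst_ne_zero (s : Zone) {p : Cyl} (hp : p ∈ s.region) : p.1 ≠ 0 := by
  cases s
  · exact ne_of_gt hp
  · exact ne_of_lt hp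
  · exact hp

/-- The Riemannian metric `g = diag(1, x⁻² e^{-2φ(x,y)})`. -/
def grushinMetric (φ : Cyl → ℝ) (hφ : SmoothOn φ Set.univ) (s : Zone) : RiemMetric s.region where
  coeff p := Matrix.diagonal ![1, (p.1 ^ 2)⁻¹ * Real.exp (-2 * φ p)]
  smooth i j := by
    have h1 : SmoothOn (fun p : Cyl => (p.1 ^ 2)⁻¹ * Real.exp (-2 * φ p)) s.region := by
      refine SmoothOn.mul (SmoothOn.inv ?_ fun p hp => pow_ne_zero 2 (s.fst_ne_zero hp)) ?_
      · exact (contDiff_fst.pow 2).contDiffOn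
      · exact ContDiffOn.exp ((SmoothOn.const (-2)).mul (hφ.mono (Set.subset_univ _)))
    fin_cases i <;> fin_cases j
    · simpa using SmoothOn.const (1 : ℝ)
    · simpa using SmoothOn.const (0 : ℝ)
    · simpa using SmoothOn.const (0 : ℝ)
    · simpa using h1
  posDef p hp := by
    refine Matrix.PosDef.diagonal fun i => ?_
    have := s.fst_ne_zero hp
    fin_cases i
    · simp
    · simp only [Fin.mk_one, Matrix.cons_val_one, Matrix.cons_val_fin_one]
      positivity

end Grushin

end

/-! Near `x = 0` put `t = |x|`. The area is `e^{-φ} dt dy / t`, and since `K = -2/x² - 2φ_x/x +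
O(1)`, the leading part of `-Δ + cK` is the Euler operator `-u'' + u'/t - 2c u/t²`. The
`y`-derivatives carry a factor `x²` and are harmless. Powers `t^a` solve the model equation when `a²
- 2a + 2c = 0`, so `a = 1 ± √(1 - 2c)`. With the weight `dt/t` a power is square integrable at `0`
exactly when `a > 0`. For `0 < c < 1/2` both roots are positive and distinct: this is the limit
circle case, and each Fourier mode in `y` contributes its own two-dimensional boundary space, which
gives infinitely many dimensions in all.

To make this rigorous for variable `φ`, the functions `t^a e^{iky}` are turned into elements of
`D(A*)`. The terms in `φ_x/x` produce an error of order `t^{a-1}`, which need not be square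
integrable for the smaller root; a `Corrector` removes it to leading order (`nonempty_corrector`,
`exists_expr_freeMode_bound`). The amplitude `e^{φ(0,y)/2}` cancels the factor `e^{-φ}` of the area
at `x = 0`. After a cutoff in `x`, both the mode and its image under the differential expression lie
in `L²`, and Green's formula with test functions puts the mode in `D(A*)`.

The classes are separated by the boundary form `⟪A* u, v⟫ - ⟪u, A* v⟫`, which vanishes as soon as
`u` lies in the domain of the closure. The divergence theorem reduces it to the limit of a flux
through small circles, that is, to a weighted Wronskian times `∫ e^{i(k-k')y} dy`
(`boundary_form_mode`). It is nonzero exactly for opposite roots and equal frequencies, so the modes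
form a biorthogonal system up to nonzero factors (`linearIndependent_of_pairing`,
`exists_independent_modes`).

Finally, von Neumann's formula `D(A*) = D(closure) + ker(A* - i) + ker(A* + i)` shows that the two
deficiency spaces cannot both be finite-dimensional. The coefficients of `A` are real, so complex
conjugation exchanges these spaces, and both are infinite-dimensional. -/

noncomputable section

namespace Grushin

/-! ### Symmetric operators: closure, adjoint and deficiency spaces. -/

section AbstractOperators

variable {H : Type*} [NormedAddCommGroup H] [InnerProductSpace ℂ H] [CompleteSpace H]
  {A : H →ₗ.[ℂ] H}

theorem isClosable_of_isFormalAdjoint (hA : Dense (A.domain : Set H)) (hs : A.IsFormalAdjoint A) :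
    A.IsClosable :=
  (LinearPMap.adjoint_isClosed hA).isClosable.leIsClosable (hs.le_adjoint hA)

theorem closure_le_adjoint (hA : Dense (A.domain : Set H)) (hs : A.IsFormalAdjoint A) :
    A.closure ≤ A.adjoint := by
  have hc := (LinearPMap.adjoint_isClosed hA)
  refine LinearPMap.le_of_le_graph ?_
  rw [← (isClosable_of_isFormalAdjoint hA hs).graph_closure_eq_closure_graph]
  exact Submodule.topologicalClosure_minimal _
    (LinearPMap.le_graph_of_le (hs.le_adjoint hA)) hc

/-- For fixed `w` the identity is a closed condition on the pair `p`, and on the graph of `A` it is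
the definition of the adjoint. -/
theorem inner_closure_graph (hA : Dense (A.domain : Set H)) (hs : A.IsFormalAdjoint A)
    {p : H × H} (hp : p ∈ A.closure.graph) (w : A.adjoint.domain) :
    inner ℂ p.2 (w : H) = inner ℂ p.1 (A.adjoint w) := by
  rw [← (isClosable_of_isFormalAdjoint hA hs).graph_closure_eq_closure_graph] at hp
  have hcl : IsClosed {q : H × H | inner ℂ q.2 (w : H) = inner ℂ q.1 (A.adjoint w)} :=
    isClosed_eq (by fun_prop) (by fun_prop)
  refine closure_minimal ?_ hcl hp
  rintro ⟨a, b⟩ hab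
  obtain ⟨x, rfl, rfl⟩ := LinearPMap.mem_graph_iff _ |>.1 hab
  exact (LinearPMap.adjoint_isFormalAdjoint hA).symm x w

/-- The boundary form of `A` vanishes when one argument lies in the domain of the closure. -/
theorem inner_adjoint_of_mem_closureDomain (hA : Dense (A.domain : Set H))
    (hs : A.IsFormalAdjoint A) {x : A.adjoint.domain} (hx : x ∈ closureDomain A)
    (w : A.adjoint.domain) :
    inner ℂ (A.adjoint x) (w : H) = inner ℂ (x : H) (A.adjoint w) := by
  have hx' : (x : H) ∈ A.closure.domain := hx
  have h1 := inner_closure_graph hA hs (A.closure.mem_graph ⟨x, hx'⟩) w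
  rwa [(closure_le_adjoint hA hs).2 (x := ⟨x, hx'⟩) (y := x) rfl] at h1

theorem mem_deficiencySpace {z : ℂ} {x : A.adjoint.domain} :
    x ∈ deficiencySpace A z ↔ A.adjoint x = z • (x : H) := by
  simp [deficiencySpace, LinearMap.mem_ker, sub_eq_zero]

/-- The first formula of von Neumann. -/
theorem exists_add_deficiency (hA : Dense (A.domain : Set H)) (hs : A.IsFormalAdjoint A)
    (x : A.adjoint.domain) :
    ∃ v ∈ closureDomain A, ∃ p ∈ deficiencySpace A Complex.I,
      ∃ q ∈ deficiencySpace A (-Complex.I), x = v + p + q := by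
  have hcl := isClosable_of_isFormalAdjoint hA hs
  have hle := closure_le_adjoint hA hs
  have hG : IsClosed (A.closure.graph : Set (H × H)) := hcl.closure_isClosed
  -- `T` is the closure of `A` minus `i`, viewed on its graph, which is complete because it is
  -- closed.
  let T : A.closure.graph →L[ℂ] H :=
    (ContinuousLinearMap.snd ℂ H H - Complex.I • ContinuousLinearMap.fst ℂ H H).comp
      A.closure.graph.subtypeL
  have hT : ∀ p : A.closure.graph, T p = (p : H × H).2 - Complex.I • (p : H × H).1 :=
    fun p => rfl
  have hsym : ∀ p ∈ A.closure.graph, inner ℂ p.2 p.1 = inner ℂ p.1 p.2 := by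
    rintro ⟨a, b⟩ hab
    obtain ⟨y, rfl, rfl⟩ := LinearPMap.mem_graph_iff _ |>.1 hab
    have h1 := inner_closure_graph hA hs hab ⟨y, hle.1 y.2⟩
    rwa [← hle.2 (x := y) (y := ⟨y, hle.1 y.2⟩) rfl] at h1
  -- Symmetry makes `⟪Av, v⟫` real, so `‖(A - i)v‖² = ‖Av‖² + ‖v‖²`. Hence `T` is bounded below and
  -- has closed range.
  have hnorm : ∀ p : A.closure.graph, ‖p‖ ≤ ‖T p‖ := by
    intro p
    have h1 := hsym p p.2
    have h2 : ‖T p‖ ^ 2 = ‖(p : H × H).2‖ ^ 2 + ‖(p : H × H).1‖ ^ 2 := by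
      have h3 : RCLike.re (inner ℂ (p : H × H).2 (Complex.I • (p : H × H).1)) = 0 := by
        have him : (inner ℂ (p : H × H).2 (p : H × H).1).im = 0 := by
          have := inner_conj_symm (𝕜 := ℂ) (p : H × H).2 (p : H × H).1
          rw [← h1] at this
          exact Complex.conj_eq_iff_im.1 this
        simp [him]
      rw [hT, @norm_sub_sq ℂ, h3, norm_smul]
      simp
    rw [Submodule.coe_norm, Prod.norm_def]
    refine max_le ?_ ?_ <;> refine le_of_sq_le_sq ?_ (norm_nonneg _) <;> rw [h2] <;> simp
  have hanti : AntilipschitzWith 1 T := by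
    refine T.antilipschitz_of_bound fun p => ?_
    simpa using hnorm p
  have : CompleteSpace A.closure.graph := hG.completeSpace_coe
  have hrange : IsClosed (T.range : Set H) := by
    exact hanti.isClosed_range T.uniformContinuous
  have : CompleteSpace T.range := hrange.completeSpace_coe
  -- Split `(A* - i)x` along the range of `T` and its orthogonal complement. The first component
  -- comes from the closure; the second yields an element of `ker(A* + i)`.
  obtain ⟨y, ⟨v, hv⟩, z, hz, hyz⟩ := Submodule.exists_add_mem_mem_orthogonal (K := T.range)
    (A.adjoint x - Complex.I • (x : H))
  have hz' : ∀ u : A.domain, inner ℂ (-Complex.I • z) (u : H) = inner ℂ z (A u) := by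
    intro u
    have hu : ((u : H), A u) ∈ A.closure.graph :=
      LinearPMap.le_graph_of_le A.le_closure (A.mem_graph u)
    have h1 := (Submodule.mem_orthogonal' _ _).1 hz _ ⟨⟨_, hu⟩, rfl⟩
    have h2 : inner ℂ z (A u - Complex.I • (u : H)) = 0 := h1
    rw [inner_sub_right, sub_eq_zero, inner_smul_right] at h2
    rw [h2, inner_smul_left]
    simp
  have hzdom : z ∈ A.adjoint.domain := LinearPMap.mem_adjoint_domain_of_exists _ ⟨_, hz'⟩
  have hzA : A.adjoint ⟨z, hzdom⟩ = -Complex.I • z := LinearPMap.adjoint_apply_eq hA _ hz'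
  obtain ⟨v', hv'1, hv'2⟩ := LinearPMap.mem_graph_iff _ |>.1 v.2
  let V : A.adjoint.domain := ⟨v', hle.1 v'.2⟩
  have hV : A.adjoint V = A.closure v' := (hle.2 rfl).symm
  -- Since `A* z = -iz`, one has `(A* - i)z = -2iz`; the factor `i/2` gives `(A* - i)q = z`. Then `x
  -- - V - q` is annihilated by `A* - i`.
  let q : A.adjoint.domain := (Complex.I / 2) • ⟨z, hzdom⟩
  have hq : q ∈ deficiencySpace A (-Complex.I) := by
    rw [mem_deficiencySpace]
    simp only [q, LinearPMap.map_smul, hzA, Submodule.coe_smul, smul_smul]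
    congr 1
    ring
  refine ⟨V, v'.2, x - V - q, ?_, q, hq, by abel⟩
  have hq' := mem_deficiencySpace.1 hq
  rw [mem_deficiencySpace, LinearPMap.map_sub, LinearPMap.map_sub, hq', hV]
  have e1 : A.closure v' - Complex.I • (v' : H) = y := by
    rw [← hv, ContinuousLinearMap.coe_coe, hT, ← hv'1, ← hv'2]
  have e2 : A.adjoint x = Complex.I • (x : H) + (A.closure v' - Complex.I • (v' : H) + z) := by
    rw [e1, ← hyz]; abel
  rw [e2]
  have e3 : (q : H) = (Complex.I / 2) • z := rfl
  have e4 : (V : H) = v' := rfl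
  simp only [Submodule.coe_sub, e3, e4, smul_sub, smul_smul]
  have e5 : -Complex.I * (Complex.I / 2) = 1 / 2 := by
    have := Complex.I_mul_I
    linear_combination (-1 / 2) * this
  have e6 : Complex.I * (Complex.I / 2) = -(1 / 2) := by
    have := Complex.I_mul_I
    linear_combination (1 / 2) * this
  rw [e5, e6]
  module

/-- By von Neumann's formula the two deficiency spaces together span the quotient. -/
theorem finiteDimensional_adjointModClosure (hA : Dense (A.domain : Set H))
    (hs : A.IsFormalAdjoint A) (h1 : FiniteDimensional ℂ (deficiencySpace A Complex.I))
    (h2 : FiniteDimensional ℂ (deficiencySpace A (-Complex.I))) :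
    FiniteDimensional ℂ (AdjointModClosure A) := by
  let f : (deficiencySpace A Complex.I × deficiencySpace A (-Complex.I)) →ₗ[ℂ]
      AdjointModClosure A :=
    (closureDomain A).mkQ.comp
      ((deficiencySpace A Complex.I).subtype.coprod (deficiencySpace A (-Complex.I)).subtype)
  refine Module.Finite.of_surjective f fun y => ?_
  obtain ⟨x, rfl⟩ := (closureDomain A).mkQ_surjective y
  obtain ⟨v, hv, p, hp, q, hq, rfl⟩ := exists_add_deficiency hA hs x
  refine ⟨(⟨p, hp⟩, ⟨q, hq⟩), ?_⟩
  have hv0 : (closureDomain A).mkQ v = 0 := by simpa using hv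
  simp only [f, LinearMap.comp_apply, LinearMap.coprod_apply, Submodule.subtype_apply, map_add,
    hv0, zero_add]

/-- A conjugation that commutes with `A` maps `ker(A* - z)` onto `ker(A* - conj z)`. -/
theorem finiteDimensional_deficiencySpace_conj (hA : Dense (A.domain : Set H))
    (J : H →ₗ⋆[ℂ] H) (hJ : ∀ x, J (J x) = x) (hJi : ∀ x y, inner ℂ (J x) (J y) = inner ℂ y x)
    (hJA : ∀ x : A.domain, ∃ x' : A.domain, (x' : H) = J x ∧ A x' = J (A x)) (z : ℂ)
    (h : FiniteDimensional ℂ (deficiencySpace A z)) :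
    FiniteDimensional ℂ (deficiencySpace A (starRingEnd ℂ z)) := by
  have hJi' : ∀ x y, inner ℂ (J x) y = inner ℂ (J y) x := fun x y => by
    conv_lhs => rw [← hJ y]
    rw [hJi]
  -- An antiunitary involution that commutes with `A` also preserves `D(A*)` and commutes with `A*`.
  have key : ∀ y : A.adjoint.domain, ∀ x : A.domain,
      inner ℂ (J (A.adjoint y)) (x : H) = inner ℂ (J y) (A x) := by
    intro y x
    obtain ⟨x', h1, h2⟩ := hJA x
    rw [hJi', ← h1, hJi' (y : H), ← h2]
    exact ((LinearPMap.adjoint_isFormalAdjoint hA).symm x' y).symm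
  have hdom : ∀ y : A.adjoint.domain, J y ∈ A.adjoint.domain := fun y =>
    LinearPMap.mem_adjoint_domain_of_exists _ ⟨_, key y⟩
  have hval : ∀ y : A.adjoint.domain, A.adjoint ⟨J y, hdom y⟩ = J (A.adjoint y) := fun y =>
    LinearPMap.adjoint_apply_eq hA _ (key y)
  have hmem : ∀ (w : ℂ) (y : A.adjoint.domain), y ∈ deficiencySpace A w →
      (⟨J y, hdom y⟩ : A.adjoint.domain) ∈ deficiencySpace A (starRingEnd ℂ w) := by
    intro w y hy
    rw [mem_deficiencySpace] at hy ⊢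
    rw [hval, hy, map_smulₛₗ]
  let f : deficiencySpace A z →ₗ⋆[ℂ] deficiencySpace A (starRingEnd ℂ z) :=
    { toFun := fun y => ⟨⟨J (y : A.adjoint.domain), hdom y⟩, hmem z y y.2⟩
      map_add' := fun a b => by ext; simp
      map_smul' := fun r a => by ext; simp }
  -- The preimage of `y` under `J` is `J y`, as `J` is an involution.
  refine Module.Finite.of_surjective f fun y => ?_
  have h1 := hmem _ _ y.2
  rw [Complex.conj_conj] at h1
  refine ⟨⟨_, h1⟩, ?_⟩
  ext
  simp [f, hJ]

end AbstractOperators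

end Grushin

end


noncomputable section

namespace Grushin

open scoped ContDiff ComplexConjugate
open MeasureTheory

/-! ### Coordinate derivatives and the divergence theorem on the cylinder. -/

section Calculus

variable {E : Type*} [NormedAddCommGroup E] [NormedSpace ℝ E]

theorem pd_zero_apply (u : Cyl → E) (x : ℝ) (θ : AddCircle (2 * Real.pi)) :
    pd 0 u (x, θ) = deriv (fun s => u (s, θ)) x := by
  have h : (fun t : ℝ => u ((x, θ) + cover (t • dir 0))) = fun t => (fun s => u (s, θ)) (x + t) := by
    ext t
    simp [cover, dir]
  exact (congrArg (fun f => deriv f 0) h).trans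
    ((deriv_comp_const_add (fun s => u (s, θ)) x 0).trans (by rw [add_zero]))

theorem pd_one_apply (u : Cyl → E) (x y : ℝ) :
    pd 1 u (x, (y : AddCircle (2 * Real.pi))) =
      deriv (fun s : ℝ => u (x, (s : AddCircle (2 * Real.pi)))) y := by
  have h : (fun t : ℝ => u ((x, (y : AddCircle (2 * Real.pi))) + cover (t • dir 1))) =
      fun t => (fun s : ℝ => u (x, (s : AddCircle (2 * Real.pi)))) (y + t) := by
    ext t
    simp [cover, dir]
  exact (congrArg (fun f => deriv f 0) h).trans
    ((deriv_comp_const_add (fun s : ℝ => u (x, (s : AddCircle (2 * Real.pi)))) y 0).trans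
      (by rw [add_zero]))

theorem SmoothOn.cmul {u v : Cyl → ℂ} {D : Set Cyl} (hu : SmoothOn u D) (hv : SmoothOn v D) :
    SmoothOn (fun p => u p * v p) D := ContDiffOn.mul hu hv

theorem SmoothOn.conj {u : Cyl → ℂ} {D : Set Cyl} (hu : SmoothOn u D) :
    SmoothOn (fun p => conj (u p)) D :=
  Complex.conjCLE.contDiff.comp_contDiffOn hu

theorem SmoothOn.ofReal {u : Cyl → ℝ} {D : Set Cyl} (hu : SmoothOn u D) :
    SmoothOn (fun p => (u p : ℂ)) D :=
  Complex.ofRealCLM.contDiff.comp_contDiffOn hu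

theorem SmoothOn.congr {u v : Cyl → E} {D : Set Cyl} (hu : SmoothOn u D)
    (h : Set.EqOn v u D) : SmoothOn v D :=
  ContDiffOn.congr hu fun _ hq => h hq

theorem SmoothOn.union {u : Cyl → E} {D D' : Set Cyl} (hD : IsOpen D) (hD' : IsOpen D')
    (hu : SmoothOn u D) (hu' : SmoothOn u D') : SmoothOn u (D ∪ D') :=
  ContDiffOn.union_of_isOpen hu hu' (isOpen_preimage hD) (isOpen_preimage hD')

theorem pd_conj (u : Cyl → ℂ) (i : Fin 2) (p : Cyl) :
    pd i (fun q => conj (u q)) p = conj (pd i u p) :=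
  deriv.star

theorem pd_cmul {u v : Cyl → ℂ} {D : Set Cyl} (hD : IsOpen D) (hu : SmoothOn u D)
    (hv : SmoothOn v D) (i : Fin 2) :
    Set.EqOn (pd i (fun p => u p * v p)) (fun p => pd i u p * v p + u p * pd i v p) D := by
  intro p hp
  obtain ⟨q, rfl⟩ := isOpenQuotientMap_cover.surjective p
  have h1 := hu.differentiableAt hD hp
  have h2 := hv.differentiableAt hD hp
  have e : (fun p => u p * v p) ∘ cover = (u ∘ cover) * (v ∘ cover) := rfl
  simp only [pd_cover i h1, pd_cover i h2]
  rw [pd_cover i (by rw [e]; exact h1.mul h2), e, fderiv_mul h1 h2]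
  simp [mul_comm, add_comm]

theorem pd_sub {u v : Cyl → E} {D : Set Cyl} (hD : IsOpen D) (hu : SmoothOn u D)
    (hv : SmoothOn v D) (i : Fin 2) :
    Set.EqOn (pd i (fun p => u p - v p)) (fun p => pd i u p - pd i v p) D := by
  intro p hp
  obtain ⟨q, rfl⟩ := isOpenQuotientMap_cover.surjective p
  have h1 := hu.differentiableAt hD hp
  have h2 := hv.differentiableAt hD hp
  have e : (fun p => u p - v p) ∘ cover = (u ∘ cover) - (v ∘ cover) := rfl
  simp only [pd_cover i h1, pd_cover i h2]
  rw [pd_cover i (by rw [e]; exact h1.sub h2), e, fderiv_sub h1 h2]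
  rfl

/-- The divergence theorem on the strip `[a, b] × S¹`. -/
theorem integral_pd_strip {F Q : Cyl → ℂ} {D : Set Cyl} (hD : IsOpen D) (hF : SmoothOn F D)
    (hQ : SmoothOn Q D) {a b : ℝ} (hab : a ≤ b) (h : ∀ x ∈ Set.Icc a b, ∀ θ, (x, θ) ∈ D) :
    ∫ x in a..b, ∫ θ : AddCircle (2 * Real.pi), pd 0 F (x, θ) + pd 1 Q (x, θ) =
      (∫ θ : AddCircle (2 * Real.pi), F (b, θ)) - ∫ θ : AddCircle (2 * Real.pi), F (a, θ) := by
  have hmem : ∀ q ∈ Set.uIcc a b ×ˢ Set.uIcc 0 (2 * Real.pi), cover q ∈ D := by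
    rintro ⟨x, y⟩ ⟨hx, -⟩
    rw [Set.uIcc_of_le hab] at hx
    exact h x hx _
  have hdF := fun q hq => (hF.differentiableAt hD (hmem q hq))
  have hdQ := fun q hq => (hQ.differentiableAt hD (hmem q hq))
  have hIoo : Set.Ioo (min a b) (max a b) ×ˢ Set.Ioo (min 0 (2 * Real.pi)) (max 0 (2 * Real.pi)) ⊆
      Set.uIcc a b ×ˢ Set.uIcc 0 (2 * Real.pi) :=
    Set.prod_mono Set.Ioo_subset_Icc_self Set.Ioo_subset_Icc_self
  have hcont : ContinuousOn (fun q => fderiv ℝ (F ∘ cover) q (1, 0) +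
      fderiv ℝ (Q ∘ cover) q (0, 1)) (Set.uIcc a b ×ˢ Set.uIcc 0 (2 * Real.pi)) := by
    have h1 : ∀ G : Cyl → ℂ, SmoothOn G D → ContinuousOn (fderiv ℝ (G ∘ cover)) (cover ⁻¹' D) :=
      fun G hG => (ContDiffOn.fderiv_of_isOpen (m := ∞) hG (isOpen_preimage hD)
        (by simp)).continuousOn
    exact (((h1 F hF).clm_apply continuousOn_const).add
      ((h1 Q hQ).clm_apply continuousOn_const)).mono hmem
  -- Work on the fundamental rectangle `[a, b] × [0, 2π]` in the universal cover.
  have key := integral2_divergence_prod_of_hasFDerivAt (F ∘ cover) (Q ∘ cover)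
    (fderiv ℝ (F ∘ cover)) (fderiv ℝ (Q ∘ cover)) a 0 b (2 * Real.pi)
    (fun q hq => (hdF q hq).continuousAt.continuousWithinAt)
    (fun q hq => (hdQ q hq).continuousAt.continuousWithinAt)
    (fun q hq => (hdF q (hIoo hq)).hasFDerivAt) (fun q hq => (hdQ q (hIoo hq)).hasFDerivAt)
    (hcont.integrableOn_compact (isCompact_uIcc.prod isCompact_uIcc))
  -- Periodicity makes the fluxes through the two horizontal sides cancel.
  have hper : ∀ x : ℝ, (Q ∘ cover) (x, 2 * Real.pi) = (Q ∘ cover) (x, 0) := by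
    intro x
    simp [cover, AddCircle.coe_period]
  have hcirc : ∀ G : AddCircle (2 * Real.pi) → ℂ,
      ∫ θ, G θ = ∫ y in (0 : ℝ)..2 * Real.pi, G (y : AddCircle (2 * Real.pi)) := by
    intro G
    have := AddCircle.intervalIntegral_preimage (2 * Real.pi) 0 G
    rw [zero_add] at this
    exact this.symm
  simp only [hper, sub_self, zero_add] at key
  rw [hcirc, hcirc]
  refine Eq.trans ?_ key
  refine intervalIntegral.integral_congr fun x hx => ?_
  rw [hcirc]
  refine intervalIntegral.integral_congr fun y hy => ?_
  have e1 := pd_cover 0 (hdF (x, y) ⟨hx, hy⟩)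
  have e2 := pd_cover 1 (hdQ (x, y) ⟨hx, hy⟩)
  exact congrArg₂ (· + ·) e1 e2

/-- The integral over the cylinder of the divergence of a compactly supported field vanishes. -/
theorem integral_pd_eq_zero {F Q : Cyl → ℂ} {K : Set Cyl} (hK : IsCompact K)
    (hF : SmoothOn F Set.univ) (hQ : SmoothOn Q Set.univ) (hF0 : ∀ p ∉ K, F p = 0)
    (hQ0 : ∀ p ∉ K, Q p = 0) : ∫ p, pd 0 F p + pd 1 Q p = 0 := by
  have hpd : ∀ (i : Fin 2) (G : Cyl → ℂ), (∀ p ∉ K, G p = 0) → ∀ p ∉ K, pd i G p = 0 := by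
    intro i G hG p hp
    rw [pd_congr hK.isClosed.isOpen_compl (v := fun _ => 0) (fun q hq => hG q hq) i hp]
    simp [pd]
  obtain ⟨R, hR⟩ := (hK.image continuous_fst).isBounded.exists_norm_le
  have hR' : ∀ x θ, R < |x| → ((x, θ) : Cyl) ∉ K := by
    intro x θ hx hK'
    exact absurd (hR x ⟨_, hK', rfl⟩) (not_le.2 hx)
  have hc : Continuous fun p => pd 0 F p + pd 1 Q p := by
    have h1 := fun i (G : Cyl → ℂ) (hG : SmoothOn G Set.univ) =>
      continuousOn_univ.1 ((hG.pd isOpen_univ i).continuousOn isOpen_univ)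
    exact (h1 0 F hF).add (h1 1 Q hQ)
  have hint : Integrable (fun p => pd 0 F p + pd 1 Q p) (volume : Measure Cyl) := by
    refine hc.integrable_of_hasCompactSupport (HasCompactSupport.intro hK fun p hp => ?_)
    rw [hpd 0 F hF0 p hp, hpd 1 Q hQ0 p hp, add_zero]
  set B := |R| + 1 with hB
  have hBpos : 0 < B := by positivity
  have hRB : R < B := by rw [hB]; linarith [le_abs_self R]
  have h0 : ∀ x θ, B ≤ |x| → F (x, θ) = 0 := fun x θ hx => hF0 _ (hR' x θ (hRB.trans_le hx))
  have hz : ∀ x θ, B < |x| → pd 0 F (x, θ) + pd 1 Q (x, θ) = 0 := fun x θ hx => by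
    rw [hpd 0 F hF0 _ (hR' x θ (hRB.trans hx)), hpd 1 Q hQ0 _ (hR' x θ (hRB.trans hx)), add_zero]
  have key := integral_pd_strip isOpen_univ hF hQ (neg_le_self hBpos.le)
    (fun x _ θ => Set.mem_univ _)
  have e1 : ∀ θ, F (B, θ) = 0 := fun θ => h0 _ _ (le_abs_self B)
  have e2 : ∀ θ, F (-B, θ) = 0 := fun θ => h0 _ _ (by rw [abs_neg]; exact le_abs_self B)
  simp only [e1, e2, sub_self] at key
  rw [Measure.volume_eq_prod] at hint ⊢
  rw [integral_prod _ hint, ← key, intervalIntegral.integral_of_le (neg_le_self hBpos.le)]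
  symm
  refine setIntegral_eq_integral_of_forall_compl_eq_zero fun x hx => ?_
  by_cases hx' : B < |x|
  · simp [hz x _ hx']
  -- The half-open interval `(-B, B]` omits `-B`, but the compact set lies inside `|x| ≤ R < B`, so
  -- the integrand vanishes there too.
  · have : x = -B := by
      rw [not_lt, abs_le] at hx'
      by_contra hne
      exact hx ⟨lt_of_le_of_ne hx'.1 (Ne.symm hne), hx'.2⟩
    subst this
    have : ∀ θ, ((-B, θ) : Cyl) ∉ K := fun θ => hR' _ θ (by rwa [abs_neg, abs_of_pos hBpos])
    simp [hpd 0 F hF0 _ (this _), hpd 1 Q hQ0 _ (this _)]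

end Calculus

/-! ### Green's formula, symmetry, elements of the adjoint domain, and conjugation. -/

section Green

variable {D : TopologicalSpace.Opens Cyl} (g : RiemMetric D)

/-- The vector density `√(det g) (v̄ grad u - u grad v̄)`. -/
def flux (u v : Cyl → ℂ) (i : Fin 2) (p : Cyl) : ℂ :=
  (areaDensity g.coeff p • grad g.coeff u i p) * conj (v p) -
    u p * conj (areaDensity g.coeff p • grad g.coeff v i p)

theorem smooth_flux {u v : Cyl → ℂ} {D' : Set Cyl} (hD' : IsOpen D') (h : D' ⊆ D)
    (hu : SmoothOn u D') (hv : SmoothOn v D') (i : Fin 2) : SmoothOn (flux g u v i) D' := by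
  have hgr : ∀ w : Cyl → ℂ, SmoothOn w D' →
      SmoothOn (fun p => areaDensity g.coeff p • grad g.coeff w i p) D' := fun w hw =>
    ((smooth_areaDensity g).mono h).smul
      (SmoothOn.sum fun j _ => ((smooth_inv g i j).mono h).smul (hw.pd hD' j))
  exact ((hgr u hu).cmul hv.conj).sub (hu.cmul (hgr v hv).conj)

/-- Green's formula in divergence form. -/
theorem divergence_flux (c : ℝ) {u v : Cyl → ℂ} (hu : SmoothOn u D) (hv : SmoothOn v D) :
    Set.EqOn (fun p => areaDensity g.coeff p •
        (u p * conj (curvatureLaplaceExpr g.coeff c v p) -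
          curvatureLaplaceExpr g.coeff c u p * conj (v p)))
      (fun p => pd 0 (flux g u v 0) p + pd 1 (flux g u v 1) p) D := by
  have hX : ∀ (w : Cyl → ℂ), SmoothOn w D → ∀ i,
      SmoothOn (fun p => areaDensity g.coeff p • grad g.coeff w i p) D := fun w hw i =>
    (smooth_areaDensity g).smul (smooth_grad g hw i)
  have hpd : ∀ i, ∀ p ∈ D, pd i (flux g u v i) p =
      (pd i (fun p => areaDensity g.coeff p • grad g.coeff u i p) p * conj (v p) +
        (areaDensity g.coeff p • grad g.coeff u i p) * conj (pd i v p)) -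
      (pd i u p * conj (areaDensity g.coeff p • grad g.coeff v i p) +
        u p * conj (pd i (fun p => areaDensity g.coeff p • grad g.coeff v i p) p)) := by
    intro i p hp
    have h1 := pd_sub D.isOpen ((hX u hu i).cmul hv.conj) (hu.cmul (hX v hv i).conj) i hp
    have h2 := pd_cmul D.isOpen (hX u hu i) hv.conj i hp
    have h3 := pd_cmul D.isOpen hu (hX v hv i).conj i hp
    simp only [pd_conj] at h2 h3
    rw [← h2, ← h3]
    exact h1
  intro p hp
  have hne : (areaDensity g.coeff p : ℂ) ≠ 0 :=
    Complex.ofReal_ne_zero.2 (areaDensity_pos g hp).ne'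
  have hlap : ∀ w : Cyl → ℂ, (areaDensity g.coeff p : ℂ) * laplaceBeltrami g.coeff w p =
      pd 0 (fun q => areaDensity g.coeff q • grad g.coeff w 0 q) p +
        pd 1 (fun q => areaDensity g.coeff q • grad g.coeff w 1 q) p := by
    intro w
    simp only [laplaceBeltrami, divergence, Fin.sum_univ_two, Complex.real_smul,
      Complex.ofReal_inv]
    rw [mul_inv_cancel_left₀ hne]
  -- Symmetry of the inverse metric cancels the products of first derivatives; the curvature term
  -- cancels because `cK` is real.
  have hsymm : (g.coeff p)⁻¹ 0 1 = (g.coeff p)⁻¹ 1 0 := by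
    have := (g.posDef p hp).isHermitian.inv.apply 1 0
    simpa using this
  have hu' := hlap u
  have hv' := congrArg conj (hlap v)
  simp only [map_add, map_mul, Complex.conj_ofReal] at hv'
  simp only [hpd _ p hp]
  simp only [curvatureLaplaceExpr, grad, Fin.sum_univ_two, Complex.real_smul, map_add, map_mul,
    map_neg, Complex.conj_ofReal, hsymm]
  simp only [grad, Fin.sum_univ_two, Complex.real_smul] at hu' hv'
  linear_combination (conj (v p)) * hu' - u p * hv'

theorem integral_area (f : Cyl → ℂ) :
    ∫ p, f p ∂(area g.coeff D) = ∫ p in (D : Set Cyl), areaDensity g.coeff p • f p := by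
  rw [area, restrict_withDensity D.isOpen.measurableSet,
    integral_withDensity_eq_integral_toReal_smul₀]
  · refine integral_congr_ae (.of_forall fun p => ?_)
    simp [ENNReal.toReal_ofReal (Real.sqrt_nonneg _), areaDensity]
  · exact (((smooth_areaDensity g).continuousOn D.isOpen).aemeasurable
      D.isOpen.measurableSet).ennreal_ofReal
  · exact .of_forall fun _ => ENNReal.ofReal_lt_top

theorem inner_toLp {f h : Cyl → ℂ} (hf : MemLp f 2 (area g.coeff D))
    (hh : MemLp h 2 (area g.coeff D)) :
    inner ℂ (hf.toLp f) (hh.toLp h) = ∫ p, h p * conj (f p) ∂(area g.coeff D) := by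
  rw [L2.inner_def]
  refine integral_congr_ae ?_
  filter_upwards [hf.coeFn_toLp, hh.coeFn_toLp] with p h1 h2
  rw [h1, h2, RCLike.inner_apply]

theorem integrable_inner {f h : Cyl → ℂ} (hf : MemLp f 2 (area g.coeff D))
    (hh : MemLp h 2 (area g.coeff D)) :
    Integrable (fun p => h p * conj (f p)) (area g.coeff D) := by
  have := L2.integrable_inner (𝕜 := ℂ) (hf.toLp f) (hh.toLp h)
  refine this.congr ?_
  filter_upwards [hf.coeFn_toLp, hh.coeFn_toLp] with p h1 h2
  rw [h1, h2, RCLike.inner_apply]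

/-- The boundary form of smooth functions as the integral of a divergence. -/
theorem inner_expr_sub_inner (c : ℝ) {u v : Cyl → ℂ} (hu : SmoothOn u D) (hv : SmoothOn v D)
    (hu2 : MemLp u 2 (area g.coeff D)) (hv2 : MemLp v 2 (area g.coeff D))
    (hAu : MemLp (curvatureLaplaceExpr g.coeff c u) 2 (area g.coeff D))
    (hAv : MemLp (curvatureLaplaceExpr g.coeff c v) 2 (area g.coeff D)) :
    inner ℂ (hAv.toLp _) (hu2.toLp u) - inner ℂ (hv2.toLp v) (hAu.toLp _) =
      ∫ p in (D : Set Cyl), pd 0 (flux g u v 0) p + pd 1 (flux g u v 1) p := by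
  rw [inner_toLp, inner_toLp, ← integral_sub (integrable_inner g hAv hu2)
    (integrable_inner g hv2 hAu), integral_area]
  exact setIntegral_congr_fun D.isOpen.measurableSet (divergence_flux g c hu hv)

/-- The flux against a test function has compact support in `D`, so no boundary term arises however
`v` behaves near the boundary. With `v` a test function this is the symmetry of `A`; for general `v`
it gives membership in `D(A*)`. -/
theorem inner_expr_test (c : ℝ) {v : Cyl → ℂ} (hv : SmoothOn v D)
    (hv2 : MemLp v 2 (area g.coeff D))
    (hAv : MemLp (curvatureLaplaceExpr g.coeff c v) 2 (area g.coeff D)) (u : testFunctions D) :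
    inner ℂ (hAv.toLp _) (testToL2 g u) = inner ℂ (hv2.toLp v) (exprToL2 g c u) := by
  have hu : SmoothOn (u : Cyl → ℂ) D := u.2.1.mono (Set.subset_univ _)
  have h0 : ∀ p ∉ tsupport (u : Cyl → ℂ), (u : Cyl → ℂ) p = 0 := fun p hp =>
    image_eq_zero_of_notMem_tsupport hp
  have hop : IsOpen (tsupport (u : Cyl → ℂ))ᶜ := (isClosed_tsupport _).isOpen_compl
  have hpd0 : ∀ i, ∀ p ∉ tsupport (u : Cyl → ℂ), pd i (u : Cyl → ℂ) p = 0 := by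
    intro i p hp
    rw [pd_congr hop (v := fun _ => 0) (fun q hq => h0 q hq) i hp]
    simp [pd]
  have hfl0 : ∀ i, ∀ p ∉ tsupport (u : Cyl → ℂ), flux g u v i p = 0 := by
    intro i p hp
    simp [flux, grad, hpd0 _ p hp, h0 p hp]
  have hfl : ∀ i, SmoothOn (flux g u v i) Set.univ := by
    intro i
    have h1 := smooth_flux g D.isOpen subset_rfl hu hv i
    have h2 : SmoothOn (flux g u v i) (tsupport (u : Cyl → ℂ))ᶜ :=
      (SmoothOn.const 0).congr fun p hp => hfl0 i p hp
    -- The flux is smooth on `D` and zero off the support of `u`; these two open sets cover the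
    -- cylinder.
    refine (h1.union D.isOpen hop h2).mono fun p _ => ?_
    by_cases hp : p ∈ tsupport (u : Cyl → ℂ)
    · exact Or.inl (u.2.2.2 hp)
    · exact Or.inr hp
  have key := inner_expr_sub_inner g c hu hv (memLp_test g u) hv2 (memLp_expr g c u) hAv
  rw [← sub_eq_zero]
  refine key.trans ?_
  rw [setIntegral_eq_integral_of_forall_compl_eq_zero]
  · exact integral_pd_eq_zero u.2.2.1 (hfl 0) (hfl 1) (hfl0 0) (hfl0 1)
  · intro p hp
    have hp' : p ∈ (tsupport (u : Cyl → ℂ))ᶜ := fun h => hp (u.2.2.2 h)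
    have h1 : ∀ i, pd i (flux g u v i) p = 0 := fun i => by
      rw [pd_congr hop (v := fun _ => 0) (fun q hq => hfl0 i q hq) i hp']
      simp [pd]
    rw [h1, h1, add_zero]

theorem curvatureLaplacian_apply (c : ℝ) (u : testFunctions D)
    (h : testToL2 g u ∈ (curvatureLaplacian g c).domain) :
    curvatureLaplacian g c ⟨testToL2 g u, h⟩ = exprToL2 g c u := by
  have : (LinearEquiv.ofInjective (testToL2 g) (testToL2_injective g)).symm ⟨testToL2 g u, h⟩ = u :=
    (LinearEquiv.symm_apply_eq _).2 rfl
  exact congrArg (exprToL2 g c) this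

theorem exists_test {c : ℝ} (x : (curvatureLaplacian g c).domain) :
    ∃ (u : testFunctions D) (h : testToL2 g u ∈ (curvatureLaplacian g c).domain),
      x = ⟨testToL2 g u, h⟩ := by
  obtain ⟨u, hu⟩ := x.2
  exact ⟨u, hu ▸ x.2, Subtype.ext hu.symm⟩

theorem curvatureLaplacian_isFormalAdjoint (c : ℝ) :
    (curvatureLaplacian g c).IsFormalAdjoint (curvatureLaplacian g c) := by
  intro x y
  obtain ⟨v, hv, rfl⟩ := exists_test g x
  obtain ⟨u, hu, rfl⟩ := exists_test g y
  rw [curvatureLaplacian_apply, curvatureLaplacian_apply]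
  exact inner_expr_test g c (v.2.1.mono (Set.subset_univ _)) (memLp_test g v) (memLp_expr g c v) u

theorem inner_expr_eq (c : ℝ) {v : Cyl → ℂ} (hv : SmoothOn v D)
    (hv2 : MemLp v 2 (area g.coeff D))
    (hAv : MemLp (curvatureLaplaceExpr g.coeff c v) 2 (area g.coeff D))
    (x : (curvatureLaplacian g c).domain) :
    inner ℂ (hAv.toLp _) (x : L2 g) = inner ℂ (hv2.toLp v) (curvatureLaplacian g c x) := by
  obtain ⟨u, hu, rfl⟩ := exists_test g x
  rw [curvatureLaplacian_apply]
  exact inner_expr_test g c hv hv2 hAv u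

theorem mem_adjoint_domain (c : ℝ) {v : Cyl → ℂ} (hv : SmoothOn v D)
    (hv2 : MemLp v 2 (area g.coeff D))
    (hAv : MemLp (curvatureLaplaceExpr g.coeff c v) 2 (area g.coeff D)) :
    hv2.toLp v ∈ (curvatureLaplacian g c).adjoint.domain :=
  LinearPMap.mem_adjoint_domain_of_exists _ ⟨_, inner_expr_eq g c hv hv2 hAv⟩

theorem adjoint_apply (c : ℝ) (hd : Dense ((curvatureLaplacian g c).domain : Set (L2 g)))
    {v : Cyl → ℂ} (hv : SmoothOn v D) (hv2 : MemLp v 2 (area g.coeff D))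
    (hAv : MemLp (curvatureLaplaceExpr g.coeff c v) 2 (area g.coeff D)) :
    (curvatureLaplacian g c).adjoint ⟨_, mem_adjoint_domain g c hv hv2 hAv⟩ = hAv.toLp _ :=
  LinearPMap.adjoint_apply_eq hd _ (inner_expr_eq g c hv hv2 hAv)

/-- The coefficients of the operator are real; this is what relates the deficiency spaces at `i` and
`-i`. -/
theorem expr_conj (c : ℝ) (u : Cyl → ℂ) (p : Cyl) :
    curvatureLaplaceExpr g.coeff c (fun q => conj (u q)) p =
      conj (curvatureLaplaceExpr g.coeff c u p) := by
  have h : ∀ i, (fun q => areaDensity g.coeff q • grad g.coeff (fun q => conj (u q)) i q) =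
      fun q => conj (areaDensity g.coeff q • grad g.coeff u i q) := by
    intro i
    ext q
    simp [grad, pd_conj]
  simp only [curvatureLaplaceExpr, laplaceBeltrami, divergence, h, pd_conj]
  simp

/-- Complex conjugation on `L²(D, ω)`. -/
def conjL2 : L2 g →ₗ⋆[ℂ] L2 g where
  toFun u := star u
  map_add' u v := by
    refine Lp.ext ?_
    filter_upwards [Lp.coeFn_star (u + v), Lp.coeFn_add u v,
      Lp.coeFn_add (star u) (star v), Lp.coeFn_star u, Lp.coeFn_star v] with p h1 h2 h3 h4 h5
    rw [h1, Pi.star_apply, h2, h3, Pi.add_apply, Pi.add_apply, h4, h5, star_add]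
    rfl
  map_smul' z u := by
    refine Lp.ext ?_
    filter_upwards [Lp.coeFn_star (z • u), Lp.coeFn_smul z u,
      Lp.coeFn_smul (starRingEnd ℂ z) (star u), Lp.coeFn_star u] with p h1 h2 h3 h4
    rw [h1, Pi.star_apply, h2, h3, Pi.smul_apply, Pi.smul_apply, h4, Pi.star_apply, star_smul]
    rfl

theorem conjL2_toLp {f : Cyl → ℂ} (hf : MemLp f 2 (area g.coeff D))
    (hf' : MemLp (fun p => conj (f p)) 2 (area g.coeff D)) :
    conjL2 g (hf.toLp f) = hf'.toLp _ := by
  refine Lp.ext ?_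
  filter_upwards [Lp.coeFn_star (hf.toLp f), hf.coeFn_toLp, hf'.coeFn_toLp] with p h1 h2 h3
  rw [h3]
  refine h1.trans ?_
  rw [Pi.star_apply, h2]
  rfl

theorem inner_conjL2 (u v : L2 g) : inner ℂ (conjL2 g u) (conjL2 g v) = inner ℂ v u := by
  rw [L2.inner_def, L2.inner_def]
  refine integral_congr_ae ?_
  filter_upwards [Lp.coeFn_star u, Lp.coeFn_star v] with p h1 h2
  have h1' : (conjL2 g u : Cyl → ℂ) p = conj ((u : Cyl → ℂ) p) := h1
  have h2' : (conjL2 g v : Cyl → ℂ) p = conj ((v : Cyl → ℂ) p) := h2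
  rw [h1', h2', RCLike.inner_apply, RCLike.inner_apply, Complex.conj_conj, mul_comm]

theorem conjL2_curvatureLaplacian (c : ℝ) (x : (curvatureLaplacian g c).domain) :
    ∃ x' : (curvatureLaplacian g c).domain, (x' : L2 g) = conjL2 g x ∧
      curvatureLaplacian g c x' = conjL2 g (curvatureLaplacian g c x) := by
  obtain ⟨u, hu, rfl⟩ := exists_test g x
  have hsupp : Function.support (fun p => conj ((u : Cyl → ℂ) p)) =
      Function.support (u : Cyl → ℂ) := by
    ext p
    simp
  let u' : testFunctions D := ⟨fun p => conj ((u : Cyl → ℂ) p), u.2.1.conj,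
    by simpa only [HasCompactSupport, tsupport, hsupp] using u.2.2.1,
    by simpa only [tsupport, hsupp] using u.2.2.2⟩
  have hu' : testToL2 g u' ∈ (curvatureLaplacian g c).domain := ⟨u', rfl⟩
  refine ⟨⟨testToL2 g u', hu'⟩,
    (conjL2_toLp g (memLp_test g u) (memLp_test g u')).symm, ?_⟩
  rw [curvatureLaplacian_apply, curvatureLaplacian_apply]
  have h : (fun p => conj (curvatureLaplaceExpr g.coeff c (u : Cyl → ℂ) p)) =
      curvatureLaplaceExpr g.coeff c (u' : Cyl → ℂ) := by
    ext p
    exact (expr_conj g c u p).symm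
  have h' := memLp_expr g c u'
  rw [← h] at h'
  refine Eq.trans ?_ (conjL2_toLp g (memLp_expr g c u) h').symm
  exact MemLp.toLp_congr (memLp_expr g c u') h' (.of_forall fun p => expr_conj g c u p)

end Green

end Grushin

end


/-! ### Density of the test functions in `L²`. -/

noncomputable section

namespace Grushin

open scoped ContDiff ComplexConjugate
open MeasureTheory

/-- Completeness of the Fourier basis, transferred from normalized Haar measure to the volume of
total mass `2π`. -/
theorem ae_eq_zero_of_fourier {v : AddCircle (2 * Real.pi) → ℂ} (hv : MemLp v 2)
    (h : ∀ k : ℤ, ∫ θ, fourier k θ * v θ = 0) : v =ᵐ[volume] 0 := by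
  have hT : ENNReal.ofReal (2 * Real.pi) ≠ 0 := by simp [Real.pi_pos]
  have hvol := AddCircle.volume_eq_smul_haarAddCircle (T := 2 * Real.pi)
  have hv' : MemLp v 2 (AddCircle.haarAddCircle (T := 2 * Real.pi)) := by
    rw [hvol] at hv
    have := hv.smul_measure (c := (ENNReal.ofReal (2 * Real.pi))⁻¹) (ENNReal.inv_ne_top.2 hT)
    rwa [smul_smul, ENNReal.inv_mul_cancel hT ENNReal.ofReal_ne_top, one_smul] at this
  have h0 : hv'.toLp v = 0 := by
    refine (fourierBasis (T := 2 * Real.pi)).repr.injective ?_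
    rw [map_zero]
    ext k
    rw [fourierBasis_repr]
    simp only [fourierCoeff]
    have h1 : ∫ t, fourier (-k) t • (hv'.toLp v : AddCircle (2 * Real.pi) → ℂ) t
        ∂AddCircle.haarAddCircle = ∫ t, fourier (-k) t * v t ∂AddCircle.haarAddCircle := by
      refine integral_congr_ae ?_
      filter_upwards [hv'.coeFn_toLp] with t ht
      rw [ht, smul_eq_mul]
    have h2 := h (-k)
    rw [hvol, integral_smul_measure] at h2
    rw [h1]
    refine (smul_eq_zero.1 h2).resolve_left ?_
    rw [ENNReal.toReal_ofReal Real.two_pi_pos.le]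
    exact Real.two_pi_pos.ne'
  have h1 : v =ᵐ[AddCircle.haarAddCircle] 0 := by
    have := hv'.coeFn_toLp
    rw [h0] at this
    exact this.symm.trans (Lp.coeFn_zero _ _ _)
  rw [hvol]
  exact Measure.ae_smul_measure h1 _

theorem smoothOn_fourier (k : ℤ) (D : Set Cyl) : SmoothOn (fun p => (fourier k p.2 : ℂ)) D := by
  have h : (fun p : Cyl => (fourier k p.2 : ℂ)) ∘ cover =
      fun q : ℝ × ℝ => Complex.exp (2 * Real.pi * Complex.I * k * q.2 / (2 * Real.pi : ℝ)) := by
    ext q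
    exact fourier_coe_apply
  have h2 : ContDiff ℝ ∞ (fun q : ℝ × ℝ => (q.2 : ℂ)) := Complex.ofRealCLM.contDiff.comp contDiff_snd
  unfold SmoothOn
  rw [h]
  refine ContDiff.contDiffOn ?_
  refine ContDiff.cexp ?_
  exact (contDiff_const.mul h2).div_const _

theorem smoothOn_fst {E : Type*} [NormedAddCommGroup E] [NormedSpace ℝ E] {η : ℝ → E} {I : Set ℝ}
    (hη : ContDiffOn ℝ ∞ η I) {D : Set Cyl} (h : ∀ p ∈ D, p.1 ∈ I) :
    SmoothOn (fun p : Cyl => η p.1) D :=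
  hη.comp contDiffOn_fst fun _ hq => h _ hq

section Density

variable {D : TopologicalSpace.Opens Cyl} (g : RiemMetric D)

/-- The test function `η(x) e^{iky}`. -/
def productTest {η : ℝ → ℝ} (hη : ContDiff ℝ ∞ η) (hc : HasCompactSupport η)
    (h : tsupport η ×ˢ Set.univ ⊆ (D : Set Cyl)) (k : ℤ) : testFunctions D := by
  have hsub : tsupport (fun p : Cyl => (η p.1 : ℂ) * fourier k p.2) ⊆ tsupport η ×ˢ Set.univ := by
    refine closure_minimal ?_ ((isClosed_tsupport η).prod isClosed_univ)
    intro p hp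
    refine ⟨subset_tsupport η fun h0 => hp ?_, Set.mem_univ _⟩
    simp [h0]
  exact ⟨fun p => (η p.1 : ℂ) * fourier k p.2,
    (smoothOn_fst hη.contDiffOn (fun _ _ => Set.mem_univ _)).ofReal.cmul (smoothOn_fourier k _),
    HasCompactSupport.of_support_subset_isCompact (hc.prod isCompact_univ)
      ((subset_tsupport _).trans hsub), hsub.trans h⟩

theorem integrableOn_area_iff {f : Cyl → ℂ} {s : Set Cyl} (hs : MeasurableSet s)
    (hsD : s ⊆ D) : IntegrableOn f s (area g.coeff D) ↔
      IntegrableOn (fun p => areaDensity g.coeff p • f p) s := by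
  have hm : AEMeasurable (fun p => ENNReal.ofReal (areaDensity g.coeff p)) (volume.restrict s) :=
    ((((smooth_areaDensity g).continuousOn D.isOpen).mono hsD).aemeasurable hs).ennreal_ofReal
  have hm' : AEMeasurable (fun p => Real.toNNReal (areaDensity g.coeff p)) (volume.restrict s) :=
    ((((smooth_areaDensity g).continuousOn D.isOpen).mono hsD).aemeasurable hs).real_toNNReal
  rw [IntegrableOn, area, Measure.restrict_restrict hs, Set.inter_eq_left.2 hsD,
    restrict_withDensity hs]
  refine (integrable_withDensity_iff_integrable_smul₀ hm').trans ?_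
  refine integrable_congr (.of_forall fun p => ?_)
  simp only [NNReal.smul_def, Real.coe_toNNReal _ (Real.sqrt_nonneg _), areaDensity]

theorem area_lt_top_of_isCompact {K : Set Cyl} (hK : IsCompact K) (hKD : K ⊆ D) :
    area g.coeff D K < ⊤ := by
  have h : IntegrableOn (fun p => areaDensity g.coeff p • (1 : ℂ)) K :=
    ((((smooth_areaDensity g).continuousOn D.isOpen).mono hKD).smul
      continuousOn_const).integrableOn_compact hK
  rw [← integrableOn_area_iff g hK.measurableSet hKD] at h
  have := (integrableOn_const_iff (C := (1 : ℂ))).1 h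
  simpa using this

variable {g} in
-- Test functions `η(x) e^{iky}` suffice: the fundamental lemma in `x` kills each Fourier
-- coefficient on almost every circle, and there are only countably many `k`.
theorem ae_eq_zero_of_inner_test {I : Set ℝ} (hI : IsOpen I) (hD : (D : Set Cyl) = I ×ˢ Set.univ)
    {f : L2 g} (hf : ∀ u : testFunctions D, inner ℂ f (testToL2 g u) = 0) : f = 0 := by
  -- Conjugate and area density are absorbed into `w`, so that the inner product with `u` is the
  -- plain integral of `w u` over `D`.
  set w : Cyl → ℂ := fun p => areaDensity g.coeff p • conj ((f : Cyl → ℂ) p) with hw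
  have hfm : Measurable (f : Cyl → ℂ) := (Lp.stronglyMeasurable f).measurable
  have hmemD : ∀ x ∈ I, ∀ θ, ((x, θ) : Cyl) ∈ D := fun x hx θ => by
    have : ((x, θ) : Cyl) ∈ (D : Set Cyl) := by rw [hD]; exact ⟨hx, Set.mem_univ _⟩
    exact this
  have hint : ∀ C ⊆ I, IsCompact C → IntegrableOn w (C ×ˢ Set.univ) := by
    intro C hC hCc
    have hsub : C ×ˢ Set.univ ⊆ (D : Set Cyl) := by rw [hD]; exact Set.prod_mono hC subset_rfl
    have hK := hCc.prod (isCompact_univ (X := AddCircle (2 * Real.pi)))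
    refine (integrableOn_area_iff g hK.measurableSet hsub).1 ?_
    have : IsFiniteMeasure ((area g.coeff D).restrict (C ×ˢ Set.univ)) :=
      ⟨by rw [Measure.restrict_apply_univ]; exact area_lt_top_of_isCompact g hK hsub⟩
    have h1 := ((Lp.memLp f).restrict (C ×ˢ Set.univ)).integrable (by norm_num)
    exact Complex.conjCLE.toContinuousLinearMap.integrable_comp h1
  have hintk : ∀ C ⊆ I, IsCompact C → ∀ k : ℤ,
      IntegrableOn (fun p => fourier k p.2 * w p) (C ×ˢ Set.univ) := by
    intro C hC hCc k
    refine (hint C hC hCc).bdd_mul (c := 1) (by fun_prop) (.of_forall fun p => ?_)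
    rw [fourier_apply, Circle.norm_coe]
  have hvol : ∀ C : Set ℝ, (volume : Measure Cyl).restrict (C ×ˢ Set.univ) =
      (volume.restrict C).prod volume := fun C => by
    rw [Measure.volume_eq_prod, ← Measure.prod_restrict, Measure.restrict_univ]
  have hV : ∀ k : ℤ, ∀ᵐ x : ℝ, x ∈ I → ∫ θ, fourier k θ * w (x, θ) = 0 := by
    intro k
    refine hI.ae_eq_zero_of_integral_contDiff_smul_eq_zero ?_ ?_
    · rw [locallyIntegrableOn_iff hI.isLocallyClosed]
      intro C hC hCc
      have h1 := hintk C hC hCc k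
      rw [IntegrableOn, hvol] at h1
      exact h1.integral_prod_left
    · intro η hη hηc hηI
      have hsub : tsupport η ×ˢ Set.univ ⊆ (D : Set Cyl) := by
        rw [hD]; exact Set.prod_mono hηI subset_rfl
      have h1 := hf (productTest hη hηc hsub k)
      have h2 : inner ℂ f (testToL2 g (productTest hη hηc hsub k)) =
          ∫ p in (D : Set Cyl), η p.1 • (fourier k p.2 * w p) := by
        have h3 : (Lp.memLp f).toLp (f : Cyl → ℂ) = f := Lp.toLp_coeFn _ _
        conv_lhs => rw [← h3]
        refine (inner_toLp g (Lp.memLp f) (memLp_test g _)).trans ?_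
        rw [integral_area]
        refine integral_congr_ae (.of_forall fun p => ?_)
        simp only [productTest, hw, Complex.real_smul]
        ring
      rw [h1] at h2
      rw [← setIntegral_eq_integral_of_forall_compl_eq_zero (s := tsupport η)
        fun x hx => by rw [image_eq_zero_of_notMem_tsupport hx, zero_smul]]
      have h4 : ∫ p in (D : Set Cyl), η p.1 • (fourier k p.2 * w p) =
          ∫ p in tsupport η ×ˢ Set.univ, η p.1 • (fourier k p.2 * w p) := by
        refine setIntegral_eq_of_subset_of_forall_sdiff_eq_zero D.isOpen.measurableSet hsub ?_
        rintro p ⟨-, hp⟩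
        rw [image_eq_zero_of_notMem_tsupport fun h => hp ⟨h, Set.mem_univ _⟩, zero_smul]
      obtain ⟨B, hB⟩ := hη.continuous.bounded_above_of_compact_support hηc
      have h5 : IntegrableOn (fun p : Cyl => η p.1 • (fourier k p.2 * w p))
          (tsupport η ×ˢ Set.univ) := by
        refine (hintk _ hηI hηc k).bdd_smul (C := B) (φ := fun p : Cyl => η p.1) ?_
          (.of_forall fun p => hB _)
        exact (hη.continuous.comp continuous_fst).aestronglyMeasurable
      rw [h4, hvol, integral_prod _ (by rwa [IntegrableOn, hvol] at h5)] at h2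
      rw [h2]
      refine integral_congr_ae (.of_forall fun x => ?_)
      exact (integral_smul _ _).symm
  -- By Fubini the density times `|f|²` is integrable on almost every circle. The density is bounded
  -- on each circle, so `w` restricted to that circle is in `L²`.
  have hG : Integrable (fun p : Cyl => (D : Set Cyl).indicator
      (fun p => areaDensity g.coeff p • (‖(f : Cyl → ℂ) p‖ ^ 2 : ℂ)) p) := by
    rw [integrable_indicator_iff D.isOpen.measurableSet,
      ← integrableOn_area_iff g D.isOpen.measurableSet subset_rfl]
    have h1 := (Lp.memLp f).integrable_norm_pow (p := 2) (by norm_num)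
    have h2 := h1.ofReal (𝕜 := ℂ)
    refine Integrable.integrableOn ?_
    simpa using h2
  rw [Measure.volume_eq_prod] at hG
  have hL2 : ∀ᵐ x : ℝ, x ∈ I → MemLp (fun θ => w (x, θ)) 2 := by
    filter_upwards [hG.prod_right_ae] with x hx hxI
    have hcont : Continuous fun θ => areaDensity g.coeff (x, θ) := by
      rw [← continuousOn_univ]
      exact ((smooth_areaDensity g).continuousOn D.isOpen).comp (by fun_prop)
        fun θ _ => hmemD x hxI θ
    obtain ⟨M, hM⟩ := (isCompact_univ (X := AddCircle (2 * Real.pi))).exists_bound_of_continuousOn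
      hcont.continuousOn
    have hmeas : AEStronglyMeasurable (fun θ => w (x, θ)) := by
      refine (hcont.measurable.smul ?_).aestronglyMeasurable
      exact Complex.continuous_conj.measurable.comp (hfm.comp measurable_prodMk_left)
    rw [memLp_two_iff_integrable_sq_norm hmeas]
    refine (hx.norm.const_mul M).mono' (hmeas.norm.pow 2) (.of_forall fun θ => ?_)
    have hpos := areaDensity_pos g (hmemD x hxI θ)
    have hMθ := hM θ (Set.mem_univ _)
    have hin : ((x, θ) : Cyl) ∈ (D : Set Cyl) := hmemD x hxI θ
    simp only [hw, Set.indicator_of_mem hin, norm_smul, norm_pow, Complex.norm_real, norm_norm,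
      RCLike.norm_conj]
    -- The inequality needed is `(ρ|f|)² ≤ M ρ|f|²` for a density `ρ ≤ M`.
    rw [norm_mul, norm_norm, norm_norm, mul_pow, pow_two ‖areaDensity g.coeff (x, θ)‖]
    have : 0 ≤ ‖areaDensity g.coeff (x, θ)‖ * ‖(f : Cyl → ℂ) (x, θ)‖ ^ 2 := by positivity
    nlinarith
  have hzero : ∀ᵐ x : ℝ, x ∈ I → ∀ᵐ θ : AddCircle (2 * Real.pi), (f : Cyl → ℂ) (x, θ) = 0 := by
    filter_upwards [ae_all_iff.2 hV, hL2] with x h1 h2 hxI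
    filter_upwards [ae_eq_zero_of_fourier (h2 hxI) fun k => h1 k hxI] with θ hθ
    have hpos := areaDensity_pos g (hmemD x hxI θ)
    simpa [hw, hpos.ne'] using hθ
  have hS : MeasurableSet {p : Cyl | p ∈ D ∧ (f : Cyl → ℂ) p ≠ 0} :=
    D.isOpen.measurableSet.inter (hfm (measurableSet_singleton 0).compl)
  have hnull : (volume : Measure Cyl) {p : Cyl | p ∈ D ∧ (f : Cyl → ℂ) p ≠ 0} = 0 := by
    rw [Measure.volume_eq_prod, Measure.measure_prod_null hS]
    filter_upwards [hzero] with x hx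
    by_cases hxI : x ∈ I
    · refine measure_mono_null ?_ (hx hxI)
      exact fun θ hθ => hθ.2
    · have : Prod.mk x ⁻¹' {p : Cyl | p ∈ D ∧ (f : Cyl → ℂ) p ≠ 0} = ∅ := by
        ext θ
        simp only [Set.mem_preimage, Set.mem_ofPred_eq, Set.mem_empty_iff_false, iff_false]
        rintro ⟨h1, -⟩
        have : ((x, θ) : Cyl) ∈ (D : Set Cyl) := h1
        rw [hD] at this
        exact hxI this.1
      rw [this]
      simp
  refine (Lp.eq_zero_iff_ae_eq_zero).2 ?_
  have h1 : ∀ᵐ p ∂(volume : Measure Cyl), p ∈ (D : Set Cyl) → (f : Cyl → ℂ) p = 0 := by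
    refine measure_mono_null ?_ hnull
    intro p hp
    simpa using hp
  exact (ae_restrict_iff' D.isOpen.measurableSet).2
    ((withDensity_absolutelyContinuous _ _).ae_le h1)

theorem dense_domain {I : Set ℝ} (hI : IsOpen I) (hD : (D : Set Cyl) = I ×ˢ Set.univ) (c : ℝ) :
    Dense ((curvatureLaplacian g c).domain : Set (L2 g)) := by
  rw [Submodule.dense_iff_topologicalClosure_eq_top, Submodule.topologicalClosure_eq_top_iff,
    Submodule.eq_bot_iff]
  intro f hf
  exact ae_eq_zero_of_inner_test hI hD fun u =>
    (Submodule.mem_orthogonal' _ _).1 hf _ ⟨u, rfl⟩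

end Density

end Grushin

end


noncomputable section

namespace Grushin

open scoped ContDiff ComplexConjugate
open MeasureTheory

/-! ### The metric, its curvature and its Laplacian in coordinates. -/

section CoordinateDerivatives

variable {E : Type*} [NormedAddCommGroup E] [NormedSpace ℝ E]

theorem hasDerivAt_fst {u : Cyl → E} {D : Set Cyl} (hD : IsOpen D) (hu : SmoothOn u D)
    {x : ℝ} {θ : AddCircle (2 * Real.pi)} (h : (x, θ) ∈ D) :
    HasDerivAt (fun s => u (s, θ)) (pd 0 u (x, θ)) x := by
  rw [pd_zero_apply]
  refine DifferentiableAt.hasDerivAt ?_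
  obtain ⟨y, rfl⟩ := QuotientAddGroup.mk_surjective θ
  have h1 := hu.differentiableAt hD (q := (x, y)) h
  exact DifferentiableAt.comp (g := u ∘ cover) (f := fun s : ℝ => (s, y)) x h1 (by fun_prop)

theorem hasDerivAt_snd {u : Cyl → E} {D : Set Cyl} (hD : IsOpen D) (hu : SmoothOn u D)
    {x y : ℝ} (h : ((x, (y : AddCircle (2 * Real.pi))) : Cyl) ∈ D) :
    HasDerivAt (fun s : ℝ => u (x, (s : AddCircle (2 * Real.pi))))
      (pd 1 u (x, (y : AddCircle (2 * Real.pi)))) y := by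
  rw [pd_one_apply]
  refine DifferentiableAt.hasDerivAt ?_
  have h1 := hu.differentiableAt hD (q := (x, y)) h
  exact DifferentiableAt.comp (g := u ∘ cover) (f := fun s : ℝ => (x, s)) y h1 (by fun_prop)

theorem pd_zero_eq {u : Cyl → E} {x : ℝ} {θ : AddCircle (2 * Real.pi)} {e : E}
    (h : HasDerivAt (fun s => u (s, θ)) e x) : pd 0 u (x, θ) = e := by
  rw [pd_zero_apply, h.deriv]

theorem pd_one_eq {u : Cyl → E} {x y : ℝ} {e : E}
    (h : HasDerivAt (fun s : ℝ => u (x, (s : AddCircle (2 * Real.pi)))) e y) :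
    pd 1 u (x, (y : AddCircle (2 * Real.pi))) = e := by
  rw [pd_one_apply, h.deriv]

theorem pd_const (i : Fin 2) (e : E) (p : Cyl) : pd i (fun _ => e) p = 0 := by
  simp [pd]

end CoordinateDerivatives

section GrushinFormula

variable {φ : Cyl → ℝ} (hφ : SmoothOn φ Set.univ) (s : Zone)

theorem isOpen_fst_ne_zero : IsOpen {p : Cyl | p.1 ≠ 0} :=
  isOpen_ne_fun continuous_fst continuous_const

theorem grushin_coeff (p : Cyl) : (grushinMetric φ hφ s).coeff p =
    Matrix.diagonal ![1, (p.1 ^ 2)⁻¹ * Real.exp (-2 * φ p)] := rfl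

theorem grushin_inv {p : Cyl} (hp : p.1 ≠ 0) : ((grushinMetric φ hφ s).coeff p)⁻¹ =
    Matrix.diagonal ![1, p.1 ^ 2 * Real.exp (2 * φ p)] := by
  refine Matrix.inv_eq_left_inv ?_
  rw [grushin_coeff, Matrix.diagonal_mul_diagonal, ← Matrix.diagonal_one]
  congr 1
  ext i
  fin_cases i
  · simp
  · have : Real.exp (2 * φ p) * Real.exp (-2 * φ p) = 1 := by
      rw [← Real.exp_add]; simp
    simp only [Fin.mk_one, Matrix.cons_val_one, Matrix.cons_val_fin_one]
    generalize Real.exp (2 * φ p) = a at *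
    generalize Real.exp (-2 * φ p) = b at *
    field_simp
    linear_combination this

theorem grushin_areaDensity (p : Cyl) :
    areaDensity (grushinMetric φ hφ s).coeff p = |p.1|⁻¹ * Real.exp (-φ p) := by
  have h : ((grushinMetric φ hφ s).coeff p).det = (|p.1|⁻¹ * Real.exp (-φ p)) ^ 2 := by
    rw [grushin_coeff, Matrix.det_diagonal, mul_pow, inv_pow, sq_abs, ← Real.exp_nat_mul]
    simp
  rw [areaDensity, h, Real.sqrt_sq (by positivity)]

include hφ in
theorem hasDerivAt_coeff {x : ℝ} (hx : x ≠ 0) (θ : AddCircle (2 * Real.pi)) :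
    HasDerivAt (fun s => (s ^ 2)⁻¹ * Real.exp (-2 * φ (s, θ)))
      ((-2 / x - 2 * pd 0 φ (x, θ)) * ((x ^ 2)⁻¹ * Real.exp (-2 * φ (x, θ)))) x := by
  have h1 := hasDerivAt_fst isOpen_univ hφ (Set.mem_univ (x, θ))
  have h2 := ((hasDerivAt_pow 2 x).inv (pow_ne_zero 2 hx)).mul ((h1.const_mul (-2)).exp)
  refine h2.congr_deriv ?_
  simp only [Pi.inv_apply]
  field_simp
  ring

/-- For `dx² + G dy²` one has `K = -G_xx/(2G) + (G_x/(2G))²`, and here `G_x/G = -2/x - 2φ_x`. -/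
theorem grushin_gaussCurvature {p : Cyl} (hp : p.1 ≠ 0) :
    gaussCurvature (grushinMetric φ hφ s).coeff p =
      -2 / p.1 ^ 2 - 2 * pd 0 φ p / p.1 - pd 0 φ p ^ 2 + pd 0 (pd 0 φ) p := by
  obtain ⟨x, θ⟩ := p
  replace hp : x ≠ 0 := hp
  have hp' : ((x, θ) : Cyl).1 ≠ 0 := hp
  set G : Cyl → ℝ := fun q => (q.1 ^ 2)⁻¹ * Real.exp (-2 * φ q) with hG
  have hN : ∀ q : Cyl, q.1 ≠ 0 → pd 0 G q = (-2 / q.1 - 2 * pd 0 φ q) * G q := fun q hq =>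
    pd_zero_eq (hasDerivAt_coeff hφ hq q.2)
  have hG0 : G (x, θ) ≠ 0 := by simp only [hG]; positivity
  have hNN : pd 0 (pd 0 G) (x, θ) = ((2 / x ^ 2 - 2 * pd 0 (pd 0 φ) (x, θ)) +
      (-2 / x - 2 * pd 0 φ (x, θ)) ^ 2) * G (x, θ) := by
    rw [pd_congr isOpen_fst_ne_zero (v := fun q => (-2 / q.1 - 2 * pd 0 φ q) * G q)
      (fun q hq => hN q hq) 0 hp]
    refine pd_zero_eq ?_
    have h1 := hasDerivAt_fst isOpen_univ (hφ.pd isOpen_univ 0) (Set.mem_univ (x, θ))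
    have h2 := (((hasDerivAt_inv hp).const_mul (-2)).sub (h1.const_mul 2)).mul
      (hasDerivAt_coeff hφ hp θ)
    refine h2.congr_deriv ?_
    simp only [hG, Pi.sub_apply]
    field_simp
  have c00 : ∀ q, (grushinMetric φ hφ s).coeff q 0 0 = 1 := fun q => by simp [grushin_coeff]
  have c01 : ∀ q, (grushinMetric φ hφ s).coeff q 0 1 = 0 := fun q => by simp [grushin_coeff]
  have c10 : ∀ q, (grushinMetric φ hφ s).coeff q 1 0 = 0 := fun q => by simp [grushin_coeff]
  have c11 : ∀ q, (grushinMetric φ hφ s).coeff q 1 1 = G q := fun q => by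
    simp [grushin_coeff, hG]
  have hdet : ((grushinMetric φ hφ s).coeff (x, θ)).det = G (x, θ) := by
    rw [Matrix.det_fin_two, c00, c01, c10, c11]; ring
  have i00 : ∀ q : Cyl, q.1 ≠ 0 → ((grushinMetric φ hφ s).coeff q)⁻¹ 0 0 = 1 := fun q hq => by
    simp [grushin_inv hφ s hq]
  have i01 : ∀ q : Cyl, q.1 ≠ 0 → ((grushinMetric φ hφ s).coeff q)⁻¹ 0 1 = 0 := fun q hq => by
    simp [grushin_inv hφ s hq]
  have i10 : ∀ q : Cyl, q.1 ≠ 0 → ((grushinMetric φ hφ s).coeff q)⁻¹ 1 0 = 0 := fun q hq => by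
    simp [grushin_inv hφ s hq]
  have i11 : ((grushinMetric φ hφ s).coeff (x, θ))⁻¹ 1 1 = (G (x, θ))⁻¹ := by
    rw [grushin_inv hφ s hp]
    simp only [hG, Matrix.diagonal_apply_eq, Matrix.cons_val_one, Matrix.cons_val_fin_one,
      mul_inv, inv_inv, ← Real.exp_neg]
    simp
  -- In the end only `Γ⁰₁₁` and `Γ¹₀₁` contribute. Symbols that get differentiated must be known on
  -- the open set `x ≠ 0`, not just at the point.
  have g000 : ∀ q : Cyl, q.1 ≠ 0 → christoffel (grushinMetric φ hφ s).coeff 0 0 0 q = 0 :=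
    fun q hq => by
      simp only [christoffel, Fin.sum_univ_two, i00 q hq, i01 q hq, c00, pd_const]; ring
  have g001 : ∀ q : Cyl, q.1 ≠ 0 → christoffel (grushinMetric φ hφ s).coeff 0 0 1 q = 0 :=
    fun q hq => by
      simp only [christoffel, Fin.sum_univ_two, i00 q hq, i01 q hq, c00, c01, c10, pd_const]; ring
  have g010 : ∀ q : Cyl, q.1 ≠ 0 → christoffel (grushinMetric φ hφ s).coeff 0 1 0 q = 0 :=
    fun q hq => by
      simp only [christoffel, Fin.sum_univ_two, i00 q hq, i01 q hq, c00, c01, c10, pd_const]; ring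
  have g011 : ∀ q : Cyl, q.1 ≠ 0 → christoffel (grushinMetric φ hφ s).coeff 0 1 1 q =
      -(1 / 2) * pd 0 G q :=
    fun q hq => by
      simp only [christoffel, Fin.sum_univ_two, i00 q hq, i01 q hq, c10, c11, pd_const]; ring
  have g101 : christoffel (grushinMetric φ hφ s).coeff 1 0 1 (x, θ) =
      (1 / 2) * (G (x, θ))⁻¹ * pd 0 G (x, θ) := by
    simp only [christoffel, Fin.sum_univ_two, i10 _ hp', i11, c01, c11, pd_const]; ring
  have d011 : pd 0 (christoffel (grushinMetric φ hφ s).coeff 0 1 1) (x, θ) =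
      -(1 / 2) * pd 0 (pd 0 G) (x, θ) := by
    rw [pd_congr isOpen_fst_ne_zero (fun q hq => g011 q hq) 0 hp, pd_zero_apply, pd_zero_apply,
      deriv_const_mul_field]
  have d001 : pd 1 (christoffel (grushinMetric φ hφ s).coeff 0 0 1) (x, θ) = 0 := by
    rw [pd_congr isOpen_fst_ne_zero (fun q hq => g001 q hq) 1 hp, pd_const]
  simp only [gaussCurvature, riemann, Fin.sum_univ_two, hdet, c00, c01, d011, d001, g000 _ hp',
    g001 _ hp', g010 _ hp', g011 _ hp', g101, hNN, hN _ hp']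
  field_simp
  ring

/-- The operator `-Δ + c K` in the coordinates `(x, y)`. -/
theorem grushin_expr (c : ℝ) {u : Cyl → ℂ} {D : Set Cyl} (hD : IsOpen D)
    (hD0 : ∀ p ∈ D, p.1 ≠ 0) (hu : SmoothOn u D) {p : Cyl} (hp : p ∈ D) :
    curvatureLaplaceExpr (grushinMetric φ hφ s).coeff c u p =
      -pd 0 (pd 0 u) p + ((p.1⁻¹ + pd 0 φ p : ℝ) : ℂ) * pd 0 u p -
        ((p.1 ^ 2 * Real.exp (2 * φ p) : ℝ) : ℂ) * (pd 1 (pd 1 u) p + ((pd 1 φ p : ℝ) : ℂ) * pd 1 u p) +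
      ((c * (-2 / p.1 ^ 2 - 2 * pd 0 φ p / p.1 - pd 0 φ p ^ 2 + pd 0 (pd 0 φ) p) : ℝ) : ℂ) *
        u p := by
  have hx := hD0 p hp
  have h0 : Set.EqOn (fun q => areaDensity (grushinMetric φ hφ s).coeff q •
      grad (grushinMetric φ hφ s).coeff u 0 q)
      (fun q => ((|q.1|⁻¹ * Real.exp (-φ q) : ℝ) : ℂ) * pd 0 u q) D := by
    intro q hq
    simp [grad, grushin_inv hφ s (hD0 q hq), grushin_areaDensity]
  have h1 : Set.EqOn (fun q => areaDensity (grushinMetric φ hφ s).coeff q •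
      grad (grushinMetric φ hφ s).coeff u 1 q)
      (fun q => ((|q.1| * Real.exp (φ q) : ℝ) : ℂ) * pd 1 u q) D := by
    intro q hq
    -- The density times `g^{yy}` is `|x| e^φ`.
    have e : |q.1|⁻¹ * Real.exp (-φ q) * (q.1 ^ 2 * Real.exp (2 * φ q)) =
        |q.1| * Real.exp (φ q) := by
      have h2 : |q.1| ≠ 0 := abs_ne_zero.2 (hD0 q hq)
      have h3 : Real.exp (-φ q) * Real.exp (2 * φ q) = Real.exp (φ q) := by
        rw [← Real.exp_add]; ring_nf
      rw [← sq_abs q.1, ← h3]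
      generalize Real.exp (2 * φ q) = a at *
      generalize Real.exp (-φ q) = b at *
      field_simp
    simp only [grad, grushin_inv hφ s (hD0 q hq), grushin_areaDensity, Fin.sum_univ_two,
      Complex.real_smul, Matrix.diagonal_apply_eq, Matrix.cons_val_one, Matrix.cons_val_fin_one]
    rw [Matrix.diagonal_apply_ne _ (by decide), ← e]
    push_cast
    ring
  obtain ⟨x, θ⟩ := p
  obtain ⟨y, rfl⟩ := QuotientAddGroup.mk_surjective θ
  replace hx : x ≠ 0 := hx
  set f : ℝ := |x|⁻¹ * Real.exp (-φ (x, (y : AddCircle (2 * Real.pi)))) with hf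
  have hfne : (f : ℂ) ≠ 0 := by
    have := abs_ne_zero.2 hx
    exact Complex.ofReal_ne_zero.2 (by positivity)
  have d0 : pd 0 (fun q => ((|q.1|⁻¹ * Real.exp (-φ q) : ℝ) : ℂ) * pd 0 u q)
      (x, (y : AddCircle (2 * Real.pi))) =
      (f : ℂ) * (pd 0 (pd 0 u) (x, (y : AddCircle (2 * Real.pi))) -
        ((x⁻¹ + pd 0 φ (x, (y : AddCircle (2 * Real.pi))) : ℝ) : ℂ) *
          pd 0 u (x, (y : AddCircle (2 * Real.pi)))) := by
    refine pd_zero_eq ?_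
    have e1 := hasDerivAt_fst isOpen_univ hφ (Set.mem_univ (x, (y : AddCircle (2 * Real.pi))))
    have e2 := (((hasDerivAt_abs hx).inv (abs_ne_zero.2 hx)).mul e1.neg.exp).ofReal_comp.mul
      (hasDerivAt_fst hD (hu.pd hD 0) hp)
    refine e2.congr_deriv ?_
    -- Writing the sign as `|x|/x` gives the logarithmic derivative `-1/x` of `|x|⁻¹` on both
    -- half-cylinders at once.
    have e3 : (SignType.sign x : ℝ) = |x| / x := by
      rw [eq_div_iff hx, sign_mul_self]
    have e4 : |x| ^ 2 = x ^ 2 := sq_abs x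
    have e5 : |x| ≠ 0 := abs_ne_zero.2 hx
    have e6 : -(SignType.sign x : ℝ) / |x| ^ 2 = -(|x|⁻¹ * x⁻¹) := by
      rw [e3]; field_simp
    simp only [e6, hf, Pi.mul_apply, Pi.inv_apply, Pi.neg_apply]
    push_cast
    ring
  have d1 : pd 1 (fun q => ((|q.1| * Real.exp (φ q) : ℝ) : ℂ) * pd 1 u q)
      (x, (y : AddCircle (2 * Real.pi))) =
      (f : ℂ) * (((x ^ 2 * Real.exp (2 * φ (x, (y : AddCircle (2 * Real.pi)))) : ℝ) : ℂ) *
        (pd 1 (pd 1 u) (x, (y : AddCircle (2 * Real.pi))) +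
          ((pd 1 φ (x, (y : AddCircle (2 * Real.pi))) : ℝ) : ℂ) *
            pd 1 u (x, (y : AddCircle (2 * Real.pi))))) := by
    refine pd_one_eq ?_
    have e1 := hasDerivAt_snd isOpen_univ hφ
      (Set.mem_univ ((x, (y : AddCircle (2 * Real.pi))) : Cyl))
    have e2 := (e1.exp.const_mul |x|).ofReal_comp.mul (hasDerivAt_snd hD (hu.pd hD 1) hp)
    refine e2.congr_deriv ?_
    have e3 : f * (x ^ 2 * Real.exp (2 * φ (x, (y : AddCircle (2 * Real.pi))))) =
        |x| * Real.exp (φ (x, (y : AddCircle (2 * Real.pi)))) := by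
      have h2 : |x| ≠ 0 := abs_ne_zero.2 hx
      have h3 : Real.exp (-φ (x, (y : AddCircle (2 * Real.pi)))) *
          Real.exp (2 * φ (x, (y : AddCircle (2 * Real.pi)))) =
          Real.exp (φ (x, (y : AddCircle (2 * Real.pi)))) := by
        rw [← Real.exp_add]; ring_nf
      rw [hf, ← sq_abs x, ← h3]
      field_simp
    rw [← mul_assoc (f : ℂ), ← Complex.ofReal_mul f, e3]
    push_cast
    ring
  simp only [curvatureLaplaceExpr, laplaceBeltrami, divergence, Fin.sum_univ_two,
    pd_congr hD h0 0 hp, pd_congr hD h1 1 hp]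
  have ef : areaDensity (grushinMetric φ hφ s).coeff (x, (y : AddCircle (2 * Real.pi))) = f :=
    grushin_areaDensity hφ s _
  rw [ef, grushin_gaussCurvature hφ s hx, Complex.real_smul, Complex.real_smul, Complex.ofReal_inv]
  change -((f : ℂ)⁻¹ * (pd 0 (fun q => ((|q.1|⁻¹ * Real.exp (-φ q) : ℝ) : ℂ) * pd 0 u q)
      (x, (y : AddCircle (2 * Real.pi))) +
      pd 1 (fun q => ((|q.1| * Real.exp (φ q) : ℝ) : ℂ) * pd 1 u q)
      (x, (y : AddCircle (2 * Real.pi))))) + _ = _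
  rw [d0, d1, ← mul_add, inv_mul_cancel_left₀ hfne]
  ring

end GrushinFormula

end Grushin

end


/-! ### The corrector for the model equation. -/

noncomputable section

namespace Grushin

open scoped ContDiff ComplexConjugate
open MeasureTheory

/-- A solution `q` of `-q'' + q' / t - 2 c q / t² = -(a - 2 c) t ^ (a - 1)` that is small compared
with `t ^ a` at `t = 0`. -/
structure Corrector (a c : ℝ) where
  q : ℝ → ℝ
  q' : ℝ → ℝ
  q'' : ℝ → ℝ
  C : ℝ
  smooth : ContDiffOn ℝ ∞ q (Set.Ioi 0)
  hasDerivAt : ∀ t, 0 < t → HasDerivAt q (q' t) t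
  hasDerivAt' : ∀ t, 0 < t → HasDerivAt q' (q'' t) t
  ode : ∀ t, 0 < t → -q'' t + q' t / t - 2 * c * q t / t ^ 2 = -(a - 2 * c) * t ^ (a - 1)
  bound : ∀ t, 0 < t → t ≤ 1 → |q t| ≤ C * t ^ (1 + a / 2)
  bound' : ∀ t, 0 < t → t ≤ 1 → |q' t| ≤ C * t ^ (a / 2)

theorem contDiffOn_rpow (a : ℝ) : ContDiffOn ℝ ∞ (fun t : ℝ => t ^ a) (Set.Ioi 0) :=
  contDiffOn_id.rpow_const_of_ne fun _ ht => ne_of_gt ht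

/-- A corrector exists for each root `a` of the indicial equation; the value `a = 1 / 2` is
resonant and leads to a logarithm. -/
theorem nonempty_corrector {a c : ℝ} (ha : 0 < a) (h : a ^ 2 - 2 * a + 2 * c = 0) :
    Nonempty (Corrector a c) := by
  -- The model operator maps `t^{a+1}` to `(1 - 2a) t^{a-1}`. This fails to help when `a + 1` is
  -- itself the other root, i.e. `a = 1/2`, `c = 3/8`. There it maps `t^{3/2} log t` to `-t^{-1/2}`,
  -- while the right-hand side is `t^{-1/2}/4`; hence the coefficient `-1/4`.
  by_cases h2 : a = 1 / 2
  · have hc : c = 3 / 8 := by subst h2; linarith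
    subst h2 hc
    have hd : ∀ (e : ℝ) (t : ℝ), 0 < t → HasDerivAt (fun t : ℝ => t ^ e) (e * t ^ (e - 1)) t :=
      fun e t ht => Real.hasDerivAt_rpow_const (Or.inl ht.ne')
    -- The logarithm is paid for with `t^{1/4}`. This is why the bounds of a corrector have
    -- exponents `1 + a/2` and `a/2` instead of `1 + a` and `a`.
    have hlog : ∀ t : ℝ, 0 < t → t ≤ 1 → |t ^ (1 / 4 : ℝ) * Real.log t| ≤ 4 := by
      intro t ht ht1
      have := Real.abs_log_mul_self_rpow_lt t (1 / 4) ht ht1 (by norm_num)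
      rw [mul_comm]
      linarith
    refine ⟨⟨fun t => -(1 / 4) * (t ^ (3 / 2 : ℝ) * Real.log t),
      fun t => -(1 / 4) * (3 / 2 * (t ^ (1 / 2 : ℝ) * Real.log t) + t ^ (1 / 2 : ℝ)),
      fun t => -(1 / 4) * (3 / 4 * (t ^ (-1 / 2 : ℝ) * Real.log t) + 2 * t ^ (-1 / 2 : ℝ)), 2,
      ?_, ?_, ?_, ?_, ?_, ?_⟩⟩
    · exact contDiffOn_const.mul ((contDiffOn_rpow _).mul
        (contDiffOn_id.log fun t ht => ne_of_gt ht))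
    · intro t ht
      refine (((hd (3 / 2) t ht).mul (Real.hasDerivAt_log ht.ne')).const_mul (-(1 / 4))).congr_deriv
        ?_
      have e1 : t ^ (3 / 2 : ℝ) = t ^ (1 / 2 : ℝ) * t := by
        rw [← Real.rpow_add_one ht.ne']; norm_num
      norm_num
      rw [e1]
      field_simp
    · intro t ht
      have e1 : t ^ (1 / 2 : ℝ) = t ^ (-1 / 2 : ℝ) * t := by
        rw [← Real.rpow_add_one ht.ne']; norm_num
      refine (((((hd (1 / 2) t ht).mul (Real.hasDerivAt_log ht.ne')).const_mul (3 / 2)).add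
        (hd (1 / 2) t ht)).const_mul (-(1 / 4))).congr_deriv ?_
      have e2 : (1 / 2 - 1 : ℝ) = -1 / 2 := by norm_num
      rw [e2, e1]
      field_simp
      ring
    · intro t ht
      have e1 : t ^ (1 / 2 : ℝ) = t ^ (-1 / 2 : ℝ) * t := by
        rw [← Real.rpow_add_one ht.ne']; norm_num
      have e2 : t ^ (3 / 2 : ℝ) = t ^ (-1 / 2 : ℝ) * t ^ 2 := by
        rw [← Real.rpow_add_natCast ht.ne']; norm_num
      have e3 : (1 / 2 - 1 : ℝ) = -1 / 2 := by norm_num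
      rw [e3, e1, e2]
      field_simp
      ring
    · intro t ht ht1
      have e1 : t ^ (3 / 2 : ℝ) = t ^ (1 + 1 / 2 / 2 : ℝ) * t ^ (1 / 4 : ℝ) := by
        rw [← Real.rpow_add ht]; norm_num
      rw [e1, mul_assoc, abs_mul, abs_mul]
      have hp : 0 ≤ t ^ (1 + 1 / 2 / 2 : ℝ) := by positivity
      rw [abs_of_nonneg hp, abs_neg, abs_of_pos (by norm_num : (0 : ℝ) < 1 / 4)]
      nlinarith [hlog t ht ht1]
    · intro t ht ht1
      have e1 : t ^ (1 / 2 : ℝ) = t ^ (1 / 2 / 2 : ℝ) * t ^ (1 / 4 : ℝ) := by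
        rw [← Real.rpow_add ht]; norm_num
      have hp : 0 ≤ t ^ (1 / 2 / 2 : ℝ) := by positivity
      have hp' : t ^ (1 / 4 : ℝ) ≤ 1 := Real.rpow_le_one ht.le ht1 (by norm_num)
      have hp'' : 0 ≤ t ^ (1 / 4 : ℝ) := by positivity
      have e2 : -(1 / 4) * (3 / 2 * (t ^ (1 / 2 : ℝ) * Real.log t) + t ^ (1 / 2 : ℝ)) =
          t ^ (1 / 2 / 2 : ℝ) * (-(1 / 4) * (3 / 2 * (t ^ (1 / 4 : ℝ) * Real.log t) +
            t ^ (1 / 4 : ℝ))) := by rw [e1]; ring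
      rw [e2, abs_mul, abs_of_nonneg hp, mul_comm]
      refine mul_le_mul_of_nonneg_right ?_ hp
      have := abs_le.1 (hlog t ht ht1)
      rw [abs_le]
      constructor <;> linarith
  · have h2' : 1 - 2 * a ≠ 0 := fun h0 => h2 (by linarith)
    -- Away from resonance a multiple of `t^{a+1}` solves the equation.
    set b := -(a - 2 * c) / (1 - 2 * a) with hb
    have hb' : b * (1 - 2 * a) = -(a - 2 * c) := div_mul_cancel₀ _ h2'
    have hd : ∀ (e : ℝ) (t : ℝ), 0 < t → HasDerivAt (fun t : ℝ => t ^ e) (e * t ^ (e - 1)) t :=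
      fun e t ht => Real.hasDerivAt_rpow_const (Or.inl ht.ne')
    refine ⟨⟨fun t => b * t ^ (a + 1), fun t => b * ((a + 1) * t ^ a),
      fun t => b * ((a + 1) * (a * t ^ (a - 1))), |b| * (a + 1), ?_, ?_, ?_, ?_, ?_, ?_⟩⟩
    · exact contDiffOn_const.mul (contDiffOn_rpow _)
    · intro t ht
      have := (hd (a + 1) t ht).const_mul b
      rwa [add_sub_cancel_right] at this
    · intro t ht
      exact ((hd a t ht).const_mul (a + 1)).const_mul b
    · intro t ht
      have e1 : t ^ a = t ^ (a - 1) * t := by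
        rw [← Real.rpow_add_one ht.ne', sub_add_cancel]
      have e2 : t ^ (a + 1) = t ^ (a - 1) * t ^ 2 := by
        rw [← Real.rpow_add_natCast ht.ne']; norm_num; ring_nf
      rw [e2, e1]
      field_simp
      linear_combination hb' - b * h
    · intro t ht ht1
      rw [abs_mul, abs_of_pos (Real.rpow_pos_of_pos ht _)]
      have h3 : t ^ (a + 1) ≤ t ^ (1 + a / 2) :=
        Real.rpow_le_rpow_of_exponent_ge ht ht1 (by linarith)
      have h4 : |b| ≤ |b| * (a + 1) := by nlinarith [abs_nonneg b]
      exact mul_le_mul h4 h3 (Real.rpow_nonneg ht.le _) (by positivity)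
    · intro t ht ht1
      have h5 : 0 < a + 1 := by linarith
      rw [abs_mul, abs_mul, abs_of_pos (Real.rpow_pos_of_pos ht _), abs_of_pos h5, ← mul_assoc]
      have h3 : t ^ a ≤ t ^ (a / 2) := Real.rpow_le_rpow_of_exponent_ge ht ht1 (by linarith)
      exact mul_le_mul_of_nonneg_left h3 (by positivity)

/-! ### The operator on separated functions of one half-cylinder. -/

section Separated

variable {φ : Cyl → ℝ} (hφ : SmoothOn φ Set.univ) (s : Zone) {σ : ℝ}

/-- The function `Q(σx) b(y)` on the half-cylinder `σx > 0`, extended by zero. -/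
def halfProduct (σ : ℝ) (Q : ℝ → ℝ) (b : AddCircle (2 * Real.pi) → ℂ) (p : Cyl) : ℂ :=
  if 0 < σ * p.1 then (Q (σ * p.1) : ℂ) * b p.2 else 0

theorem isOpen_half (σ : ℝ) : IsOpen {p : Cyl | 0 < σ * p.1} :=
  isOpen_lt continuous_const (continuous_const.mul continuous_fst)

theorem isOpen_half_neg (σ : ℝ) : IsOpen {p : Cyl | σ * p.1 < 0} :=
  isOpen_lt (continuous_const.mul continuous_fst) continuous_const

theorem halfProduct_eqOn (σ : ℝ) (Q : ℝ → ℝ) (b : AddCircle (2 * Real.pi) → ℂ) :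
    Set.EqOn (halfProduct σ Q b) (fun p => (Q (σ * p.1) : ℂ) * b p.2) {p : Cyl | 0 < σ * p.1} :=
  fun _ hp => if_pos hp

theorem smoothOn_halfProduct (hσ : σ ≠ 0) {Q : ℝ → ℝ} (hQ : ContDiffOn ℝ ∞ Q (Set.Ioi 0))
    {b : AddCircle (2 * Real.pi) → ℂ} (hb : SmoothOn (fun p => b p.2) Set.univ) :
    SmoothOn (halfProduct σ Q b) {p : Cyl | p.1 ≠ 0} := by
  have h1 : SmoothOn (halfProduct σ Q b) {p : Cyl | 0 < σ * p.1} := by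
    refine SmoothOn.congr ?_ (halfProduct_eqOn σ Q b)
    refine SmoothOn.cmul ?_ (hb.mono (Set.subset_univ _))
    refine SmoothOn.ofReal ?_
    exact smoothOn_fst (η := fun x => Q (σ * x)) (I := {x | 0 < σ * x})
      (hQ.comp (contDiff_const.mul contDiff_id).contDiffOn fun x hx => hx) fun p hp => hp
  have h2 : SmoothOn (halfProduct σ Q b) {p : Cyl | σ * p.1 < 0} :=
    (SmoothOn.const 0).congr fun p hp => if_neg (not_lt.2 (le_of_lt hp))
  refine (h1.union (isOpen_half σ) (isOpen_half_neg σ) h2).mono fun p hp => ?_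
  rcases lt_trichotomy (σ * p.1) 0 with h | h | h
  · exact Or.inr h
  · exact absurd h (mul_ne_zero hσ hp)
  · exact Or.inl h

theorem pd_zero_halfProduct {Q Q' : ℝ → ℝ} (hQ : ∀ t, 0 < t → HasDerivAt Q (Q' t) t)
    (b : AddCircle (2 * Real.pi) → ℂ) :
    Set.EqOn (pd 0 (halfProduct σ Q b)) (fun p => σ * halfProduct σ Q' b p)
      {p : Cyl | 0 < σ * p.1} := by
  rintro ⟨x, θ⟩ hp
  rw [pd_congr (isOpen_half σ) (halfProduct_eqOn σ Q b) 0 hp]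
  simp only [halfProduct_eqOn σ Q' b hp]
  refine pd_zero_eq ?_
  have h1 : HasDerivAt (fun x => Q (σ * x)) (Q' (σ * x) * σ) x := by
    have h2 : HasDerivAt (fun x => σ * x) σ x := by simpa using (hasDerivAt_id x).const_mul σ
    exact (hQ _ hp).comp x h2
  refine (h1.ofReal_comp.mul_const (b θ)).congr_deriv ?_
  push_cast
  ring

theorem pd_one_halfProduct (Q : ℝ → ℝ) {b : AddCircle (2 * Real.pi) → ℂ}
    (hb : SmoothOn (fun p => b p.2) Set.univ) :
    Set.EqOn (pd 1 (halfProduct σ Q b))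
      (fun p => (Q (σ * p.1) : ℂ) * pd 1 (fun p : Cyl => b p.2) p) {p : Cyl | 0 < σ * p.1} := by
  rintro ⟨x, θ⟩ hp
  obtain ⟨y, rfl⟩ := QuotientAddGroup.mk_surjective θ
  rw [pd_congr (isOpen_half σ) (halfProduct_eqOn σ Q b) 1 hp]
  refine pd_one_eq ?_
  exact (hasDerivAt_snd isOpen_univ hb (Set.mem_univ (x, (y : AddCircle (2 * Real.pi))))).const_mul
    (Q (σ * x) : ℂ)

/-- The bounded part of the coefficients of the operator `-Δ + c K`, applied to `b(y)`. -/
def boundedPart (φ : Cyl → ℝ) (c : ℝ) (b : AddCircle (2 * Real.pi) → ℂ) (p : Cyl) : ℂ :=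
  ((c * (-pd 0 φ p ^ 2 + pd 0 (pd 0 φ) p) : ℝ) : ℂ) * b p.2 -
    ((p.1 ^ 2 * Real.exp (2 * φ p) : ℝ) : ℂ) * (pd 1 (pd 1 fun p : Cyl => b p.2) p +
      ((pd 1 φ p : ℝ) : ℂ) * pd 1 (fun p : Cyl => b p.2) p)

include hφ in
theorem continuous_boundedPart (c : ℝ) {b : AddCircle (2 * Real.pi) → ℂ}
    (hb : SmoothOn (fun p => b p.2) Set.univ) : Continuous (boundedPart φ c b) := by
  have hc : ∀ {E : Type} [NormedAddCommGroup E] [NormedSpace ℝ E] {u : Cyl → E},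
      SmoothOn u Set.univ → Continuous u := fun h =>
    continuousOn_univ.1 (h.continuousOn isOpen_univ)
  have h1 := hc hφ
  have h2 := hc (hφ.pd isOpen_univ 0)
  have h3 := hc ((hφ.pd isOpen_univ 0).pd isOpen_univ 0)
  have h4 := hc (hφ.pd isOpen_univ 1)
  have h5 := hc hb
  have h6 := hc (hb.pd isOpen_univ 1)
  have h7 := hc ((hb.pd isOpen_univ 1).pd isOpen_univ 1)
  exact ((Complex.continuous_ofReal.comp (by fun_prop)).mul h5).sub
    ((Complex.continuous_ofReal.comp (by fun_prop)).mul
      (h7.add ((Complex.continuous_ofReal.comp h4).mul h6)))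

/-- The terms are sorted by their singularity in `t = σx`: the model operator, then the terms with
one factor `φ_x`, one order milder, then a bounded remainder. The sign enters through `1/x = σ/t`,
and `σ² = 1` removes it from second derivatives. -/
theorem expr_halfProduct (hσ : σ ^ 2 = 1) (c : ℝ) {Q Q' Q'' : ℝ → ℝ}
    (hQs : ContDiffOn ℝ ∞ Q (Set.Ioi 0))
    (hQ : ∀ t, 0 < t → HasDerivAt Q (Q' t) t) (hQ' : ∀ t, 0 < t → HasDerivAt Q' (Q'' t) t)
    {b : AddCircle (2 * Real.pi) → ℂ} (hb : SmoothOn (fun p => b p.2) Set.univ) {p : Cyl}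
    (hp : 0 < σ * p.1) :
    curvatureLaplaceExpr (grushinMetric φ hφ s).coeff c (halfProduct σ Q b) p =
      ((-Q'' (σ * p.1) + Q' (σ * p.1) / (σ * p.1) - 2 * c * Q (σ * p.1) / (σ * p.1) ^ 2 +
        σ * pd 0 φ p * (Q' (σ * p.1) - 2 * c * Q (σ * p.1) / (σ * p.1)) : ℝ) : ℂ) * b p.2 +
      (Q (σ * p.1) : ℂ) * boundedPart φ c b p := by
  have hσ0 : σ ≠ 0 := by rintro rfl; norm_num at hσ
  have hne : ∀ q ∈ {p : Cyl | 0 < σ * p.1}, q.1 ≠ 0 := by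
    rintro q hq h0
    rw [Set.mem_ofPred_eq, h0, mul_zero] at hq
    exact lt_irrefl _ hq
  have hsm := (smoothOn_halfProduct hσ0 hQs hb).mono hne
  have e0 := pd_zero_halfProduct (σ := σ) hQ b hp
  have e00 : pd 0 (pd 0 (halfProduct σ Q b)) p = halfProduct σ Q'' b p := by
    rw [pd_congr (isOpen_half σ) (pd_zero_halfProduct hQ b) 0 hp]
    have h1 : pd 0 (fun p => (σ : ℂ) * halfProduct σ Q' b p) p =
        σ * pd 0 (halfProduct σ Q' b) p := by
      obtain ⟨x, θ⟩ := p
      rw [pd_zero_apply, pd_zero_apply, deriv_const_mul_field]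
    rw [h1, pd_zero_halfProduct hQ' b hp, ← mul_assoc, ← Complex.ofReal_mul, ← pow_two, hσ]
    simp
  have e1 := pd_one_halfProduct (σ := σ) Q hb hp
  have e11 : pd 1 (pd 1 (halfProduct σ Q b)) p =
      (Q (σ * p.1) : ℂ) * pd 1 (pd 1 fun p : Cyl => b p.2) p := by
    rw [pd_congr (isOpen_half σ) (pd_one_halfProduct Q hb) 1 hp]
    obtain ⟨x, θ⟩ := p
    obtain ⟨y, rfl⟩ := QuotientAddGroup.mk_surjective θ
    refine pd_one_eq ?_
    exact (hasDerivAt_snd isOpen_univ (hb.pd isOpen_univ 1)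
      (Set.mem_univ (x, (y : AddCircle (2 * Real.pi))))).const_mul (Q (σ * x) : ℂ)
  rw [grushin_expr hφ s c (isOpen_half σ) hne hsm hp, e00, e11, e1, e0,
    halfProduct_eqOn σ Q b hp]
  beta_reduce
  rw [halfProduct_eqOn σ Q' b hp, halfProduct_eqOn σ Q'' b hp]
  have hx : p.1 ≠ 0 := hne p hp
  have hinv : p.1⁻¹ = σ / (σ * p.1) := by field_simp
  have hsq : p.1 ^ 2 = (σ * p.1) ^ 2 := by rw [mul_pow, hσ, one_mul]
  have k1 : (p.1⁻¹ + pd 0 φ p) * σ = 1 / (σ * p.1) + σ * pd 0 φ p := by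
    rw [hinv, add_mul, div_mul_eq_mul_div, ← pow_two, hσ]; ring
  have k2 : c * (-2 / p.1 ^ 2 - 2 * pd 0 φ p / p.1 - pd 0 φ p ^ 2 + pd 0 (pd 0 φ) p) =
      -2 * c / (σ * p.1) ^ 2 - σ * pd 0 φ p * (2 * c / (σ * p.1)) +
        c * (-pd 0 φ p ^ 2 + pd 0 (pd 0 φ) p) := by
    rw [← hsq]
    field_simp
    ring
  have k1' := congrArg (fun r : ℝ => (r : ℂ)) k1
  push_cast at k1'
  rw [k2]
  simp only [boundedPart]
  push_cast
  linear_combination (Q' (σ * p.1) : ℂ) * b p.2 * k1'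

theorem expr_congr {u v : Cyl → ℂ} {g : Cyl → Matrix (Fin 2) (Fin 2) ℝ} (c : ℝ) {O : Set Cyl}
    (hO : IsOpen O) (h : Set.EqOn u v O) :
    Set.EqOn (curvatureLaplaceExpr g c u) (curvatureLaplaceExpr g c v) O := by
  have hgr : ∀ i, Set.EqOn (fun q => areaDensity g q • grad g u i q)
      (fun q => areaDensity g q • grad g v i q) O := by
    intro i q hq
    simp only [grad, pd_congr hO h _ hq]
  intro p hp
  simp only [curvatureLaplaceExpr, laplaceBeltrami, divergence, h hp,
    fun i => pd_congr hO (hgr i) i hp]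

end Separated

/-! ### Square integrability near the singular circle. -/

section SquareIntegrability

variable {φ : Cyl → ℝ} (hφ : SmoothOn φ Set.univ) (s : Zone) {σ : ℝ}

theorem isCompact_strip (hσ : σ ^ 2 = 1) (δ : ℝ) :
    IsCompact {p : Cyl | δ ≤ σ * p.1 ∧ σ * p.1 ≤ 1} := by
  have h : {p : Cyl | δ ≤ σ * p.1 ∧ σ * p.1 ≤ 1} =
      ((fun t => σ * t) '' Set.Icc δ 1) ×ˢ (Set.univ : Set (AddCircle (2 * Real.pi))) := by
    ext ⟨x, θ⟩
    simp only [Set.mem_ofPred_eq, Set.mem_prod, Set.mem_image, Set.mem_Icc, Set.mem_univ, and_true]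
    constructor
    · intro hx
      exact ⟨σ * x, hx, by rw [← mul_assoc, ← pow_two, hσ, one_mul]⟩
    · rintro ⟨t, ht, rfl⟩
      rwa [← mul_assoc, ← pow_two, hσ, one_mul]
  rw [h]
  exact (isCompact_Icc.image (by fun_prop)).prod isCompact_univ

/-- The loss of one power is the factor `1/|x|` of the area; `γ > 0` is the exact threshold. -/
theorem integrable_half_rpow (hσ : σ ≠ 0) {γ : ℝ} (hγ : 0 < γ) :
    Integrable (fun p : Cyl =>
      (Set.Ioc (0 : ℝ) 1).indicator (fun t : ℝ => t ^ (γ - 1)) (σ * p.1)) := by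
  have h1 : IntegrableOn (fun t : ℝ => t ^ (γ - 1)) (Set.Ioc 0 1) :=
    (intervalIntegrable_iff_integrableOn_Ioc_of_le zero_le_one).1
      (intervalIntegral.intervalIntegrable_rpow' (by linarith))
  have h2 := ((integrable_indicator_iff measurableSet_Ioc).2 h1).comp_mul_left' hσ
  rw [Measure.volume_eq_prod]
  exact h2.comp_fst volume

/-- A function of size `|x| ^ γ` near `x = 0`, for some `γ > 0`, is square integrable. -/
theorem memLp_of_half_bound (hσ : σ ^ 2 = 1) (hs : ∀ p : Cyl, 0 < σ * p.1 → p ∈ s.region)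
    {v : Cyl → ℂ} (hv : ContinuousOn v s.region)
    (h0 : ∀ p ∈ s.region, ¬ (0 < σ * p.1 ∧ σ * p.1 ≤ 1) → v p = 0) {γ δ C : ℝ} (hγ : 0 < γ)
    (hδ : 0 < δ) (hC : ∀ p : Cyl, 0 < σ * p.1 → σ * p.1 < δ → ‖v p‖ ≤ C * (σ * p.1) ^ γ) :
    MemLp v 2 (area (grushinMetric φ hφ s).coeff s.region) := by
  have hσ0 : σ ≠ 0 := by rintro rfl; norm_num at hσ
  have hm : AEStronglyMeasurable v (area (grushinMetric φ hφ s).coeff s.region) :=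
    hv.aestronglyMeasurable s.region.isOpen.measurableSet
  obtain ⟨B, hB⟩ := (isCompact_strip hσ δ).exists_bound_of_continuousOn
    (hv.mono fun p hp => hs p (hδ.trans_le hp.1))
  have hφc : Continuous φ := continuousOn_univ.1 (hφ.continuousOn isOpen_univ)
  obtain ⟨M, hM⟩ := (isCompact_strip hσ 0).exists_bound_of_continuousOn
    (f := fun p => Real.exp (-φ p)) (by fun_prop)
  -- Beyond `δ` the function is bounded by `B` on a compact strip, and `B ≤ (B/δ^γ) t^γ` there, so
  -- one constant serves for all `0 < t ≤ 1`.
  set C' := max C (B / δ ^ γ) with hC'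
  have hbound : ∀ p : Cyl, 0 < σ * p.1 → σ * p.1 ≤ 1 → ‖v p‖ ≤ |C'| * (σ * p.1) ^ γ := by
    intro p hp hp1
    have hpow : 0 < (σ * p.1) ^ γ := Real.rpow_pos_of_pos hp _
    rcases lt_or_ge (σ * p.1) δ with h | h
    · exact (hC p hp h).trans (mul_le_mul_of_nonneg_right ((le_max_left _ _).trans (le_abs_self _))
        hpow.le)
    · have h1 := hB p ⟨h, hp1⟩
      have hδγ : 0 < δ ^ γ := Real.rpow_pos_of_pos hδ _
      have h2 : δ ^ γ ≤ (σ * p.1) ^ γ := Real.rpow_le_rpow hδ.le h hγ.le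
      have h3 : 0 ≤ B := (norm_nonneg _).trans h1
      calc ‖v p‖ ≤ B / δ ^ γ * δ ^ γ := by rwa [div_mul_cancel₀ _ hδγ.ne']
        _ ≤ B / δ ^ γ * (σ * p.1) ^ γ := by gcongr
        _ ≤ |C'| * (σ * p.1) ^ γ := mul_le_mul_of_nonneg_right
          ((le_max_right _ _).trans (le_abs_self _)) hpow.le
  rw [memLp_two_iff_integrable_sq_norm hm]
  have key : IntegrableOn (fun p => areaDensity (grushinMetric φ hφ s).coeff p •
      ((‖v p‖ ^ 2 : ℝ) : ℂ)) s.region := by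
    -- Squaring the bound and multiplying by the density gives a multiple of `t^{2γ-1}`.
    refine Integrable.mono' ((integrable_half_rpow hσ0 (mul_pos two_pos hγ)).const_mul
      (M * |C'| ^ 2)).integrableOn ?_ ?_
    · have h1 : ContinuousOn (fun p => areaDensity (grushinMetric φ hφ s).coeff p •
          ((‖v p‖ ^ 2 : ℝ) : ℂ)) s.region :=
        ((smooth_areaDensity _).continuousOn s.region.isOpen).smul
          (Complex.continuous_ofReal.comp_continuousOn (hv.norm.pow 2))
      exact h1.aestronglyMeasurable s.region.isOpen.measurableSet
    · refine (ae_restrict_iff' s.region.isOpen.measurableSet).2 (.of_forall fun p hp => ?_)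
      by_cases h : 0 < σ * p.1 ∧ σ * p.1 ≤ 1
      · rw [Set.indicator_of_mem (show σ * p.1 ∈ Set.Ioc 0 1 from h), grushin_areaDensity]
        have hb := hbound p h.1 h.2
        have hM' := hM p ⟨h.1.le, h.2⟩
        rw [Real.norm_of_nonneg (Real.exp_pos _).le] at hM'
        have habs : |p.1| = σ * p.1 := by
          rw [← abs_of_pos h.1, abs_mul]
          have : |σ| = 1 := by
            rw [← sq_eq_sq₀ (abs_nonneg _) zero_le_one, sq_abs, hσ, one_pow]
          rw [this, one_mul]
        rw [norm_smul, Real.norm_of_nonneg (by positivity), Complex.norm_real,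
          Real.norm_of_nonneg (by positivity), habs]
        have hpow : (σ * p.1) ^ (2 * γ - 1) = ((σ * p.1) ^ γ) ^ 2 * (σ * p.1)⁻¹ := by
          rw [← Real.rpow_natCast, ← Real.rpow_mul h.1.le, ← Real.rpow_neg_one,
            ← Real.rpow_add h.1]
          congr 1
          push_cast
          ring
        rw [hpow]
        have hM0 : 0 ≤ M := (Real.exp_pos _).le.trans hM'
        have hi : 0 < (σ * p.1)⁻¹ := inv_pos.2 h.1
        have hsq : ‖v p‖ ^ 2 ≤ (|C'| * (σ * p.1) ^ γ) ^ 2 := by gcongr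
        calc (σ * p.1)⁻¹ * Real.exp (-φ p) * ‖v p‖ ^ 2
            ≤ (σ * p.1)⁻¹ * M * (|C'| * (σ * p.1) ^ γ) ^ 2 := by gcongr
          _ = _ := by ring
      · rw [h0 p hp h, Set.indicator_of_notMem (show σ * p.1 ∉ Set.Ioc 0 1 from h)]
        simp
  rw [← integrableOn_area_iff _ s.region.isOpen.measurableSet subset_rfl] at key
  have h2 := key.re
  have h3 : (area (grushinMetric φ hφ s).coeff s.region).restrict s.region =
      area (grushinMetric φ hφ s).coeff s.region := by
    rw [area, Measure.restrict_restrict s.region.isOpen.measurableSet, Set.inter_self]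
  rw [h3] at h2
  exact h2

end SquareIntegrability

end Grushin

end


noncomputable section

namespace Grushin

open scoped ContDiff ComplexConjugate
open MeasureTheory

/-! ### The corrected modes and their square integrability. -/

section Modes

variable {φ : Cyl → ℝ} (hφ : SmoothOn φ Set.univ) (s : Zone) {σ : ℝ} {a c : ℝ}

theorem SmoothOn.continuous {E : Type*} [NormedAddCommGroup E] [NormedSpace ℝ E] {u : Cyl → E}
    (hu : SmoothOn u Set.univ) : Continuous u :=
  continuousOn_univ.1 (hu.continuousOn isOpen_univ)

theorem SmoothOn.restrict_zero {E : Type*} [NormedAddCommGroup E] [NormedSpace ℝ E] {u : Cyl → E}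
    (hu : SmoothOn u Set.univ) : SmoothOn (fun p => u (0, p.2)) Set.univ := by
  have h : ContDiff ℝ ∞ (u ∘ cover) := contDiffOn_univ.1 hu
  exact (h.comp (f := fun q : ℝ × ℝ => ((0 : ℝ), q.2))
    (contDiff_const.prodMk contDiff_snd)).contDiffOn

theorem continuous_snd_of_smoothOn {b : AddCircle (2 * Real.pi) → ℂ}
    (hb : SmoothOn (fun p => b p.2) Set.univ) : Continuous b :=
  hb.continuous.comp (f := fun θ => ((0 : ℝ), θ)) (by fun_prop)

/-- The derivative of `φ` at `x = 0` in the direction of the half-cylinder `σx > 0`. -/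
def slope (φ : Cyl → ℝ) (σ : ℝ) (θ : AddCircle (2 * Real.pi)) : ℝ := σ * pd 0 φ (0, θ)

/-- The leading amplitude `e^{φ(0,y)/2} e^{iky}`. -/
def amplitude (φ : Cyl → ℝ) (k : ℤ) (θ : AddCircle (2 * Real.pi)) : ℂ :=
  (Real.exp (φ (0, θ) / 2) : ℂ) * fourier k θ

/-- The amplitude of the first order correction. -/
def amplitude' (φ : Cyl → ℝ) (σ : ℝ) (k : ℤ) (θ : AddCircle (2 * Real.pi)) : ℂ :=
  (slope φ σ θ : ℂ) * amplitude φ k θ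

include hφ in
theorem smoothOn_slope : SmoothOn (fun p => slope φ σ p.2) Set.univ :=
  (SmoothOn.const σ).mul (hφ.pd isOpen_univ 0).restrict_zero

include hφ in
theorem smoothOn_amplitude (k : ℤ) : SmoothOn (fun p => amplitude φ k p.2) Set.univ := by
  have h1 : SmoothOn (fun p => φ (0, p.2) / 2) Set.univ := ContDiffOn.div_const hφ.restrict_zero 2
  have h2 : SmoothOn (fun p => Real.exp (φ (0, p.2) / 2)) Set.univ := ContDiffOn.exp h1
  exact h2.ofReal.cmul (smoothOn_fourier k _)

include hφ in
theorem smoothOn_amplitude' (k : ℤ) : SmoothOn (fun p => amplitude' φ σ k p.2) Set.univ :=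
  (smoothOn_slope hφ).ofReal.cmul (smoothOn_amplitude hφ k)

/-- The approximate solution `(t ^ a + φ₁(y) q(t)) e^{φ(0,y)/2} e^{iky}`, where `t = σx > 0`. -/
def freeMode (κ : Corrector a c) (φ : Cyl → ℝ) (σ : ℝ) (k : ℤ) : Cyl → ℂ :=
  halfProduct σ (fun t => t ^ a) (amplitude φ k) + halfProduct σ κ.q (amplitude' φ σ k)

/-- The approximate solution, cut off in `x`. -/
def mode (κ : Corrector a c) (χ : ContDiffBump (0 : ℝ)) (φ : Cyl → ℝ) (σ : ℝ) (k : ℤ) (p : Cyl) :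
    ℂ := (χ p.1 : ℂ) * freeMode κ φ σ k p

variable (κ : Corrector a c) (χ : ContDiffBump (0 : ℝ))

include hφ in
theorem smoothOn_freeMode (hσ : σ ≠ 0) (k : ℤ) : SmoothOn (freeMode κ φ σ k) {p | p.1 ≠ 0} :=
  (smoothOn_halfProduct hσ (contDiffOn_rpow a) (smoothOn_amplitude hφ k)).add
    (smoothOn_halfProduct hσ κ.smooth (smoothOn_amplitude' hφ k))

include hφ in
theorem smoothOn_mode (hσ : σ ≠ 0) (k : ℤ) : SmoothOn (mode κ χ φ σ k) {p | p.1 ≠ 0} := by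
  refine SmoothOn.cmul (SmoothOn.ofReal ?_) (smoothOn_freeMode hφ κ hσ k)
  exact smoothOn_fst (χ.contDiff.contDiffOn (s := Set.univ)) fun _ _ => Set.mem_univ _

/-- The amplitudes depend on `k` only through `e^{iky}`, so the modes with `k = 0` can serve as
`h_±`. -/
theorem mode_eq_mul_fourier (k : ℤ) (p : Cyl) :
    mode κ χ φ σ k p = mode κ χ φ σ 0 p * fourier k p.2 := by
  simp only [mode, freeMode, Pi.add_apply, halfProduct, amplitude', amplitude, fourier_zero]
  split_ifs <;> ring

theorem mode_of_not_half (k : ℤ) {p : Cyl} (hp : ¬ 0 < σ * p.1) : mode κ χ φ σ k p = 0 := by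
  simp [mode, freeMode, halfProduct, hp]

theorem mode_of_rOut_le (k : ℤ) {p : Cyl} (hp : χ.rOut ≤ |p.1|) : mode κ χ φ σ k p = 0 := by
  have : χ p.1 = 0 := χ.zero_of_le_dist (by simpa using hp)
  simp [mode, this]

theorem abs_fst_eq (hσ : σ ^ 2 = 1) {p : Cyl} (hp : 0 < σ * p.1) : |p.1| = σ * p.1 := by
  rw [← abs_of_pos hp, abs_mul, ← Real.sqrt_sq_eq_abs σ, hσ, Real.sqrt_one, one_mul]

theorem mode_eq_freeMode (hσ : σ ^ 2 = 1) (k : ℤ) {p : Cyl} (hp : 0 < σ * p.1)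
    (hp' : σ * p.1 < χ.rIn) : mode κ χ φ σ k p = freeMode κ φ σ k p := by
  have : χ p.1 = 1 := χ.one_of_mem_closedBall (by simp [abs_fst_eq hσ hp, hp'.le])
  simp [mode, this]

include hφ in
theorem exists_freeMode_bound (ha : 0 < a) (k : ℤ) :
    ∃ B, ∀ p : Cyl, 0 < σ * p.1 → σ * p.1 ≤ 1 →
      ‖freeMode κ φ σ k p‖ ≤ B * (σ * p.1) ^ (a / 2) := by
  obtain ⟨N0, hN0⟩ := (isCompact_univ (X := AddCircle (2 * Real.pi))).exists_bound_of_continuousOn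
    (continuous_snd_of_smoothOn (smoothOn_amplitude hφ k)).continuousOn
  obtain ⟨N1, hN1⟩ := (isCompact_univ (X := AddCircle (2 * Real.pi))).exists_bound_of_continuousOn
    (continuous_snd_of_smoothOn (smoothOn_amplitude' (σ := σ) hφ k)).continuousOn
  refine ⟨N0 + |κ.C| * N1, fun p hp hp1 => ?_⟩
  have h0 := hN0 p.2 (Set.mem_univ _)
  have h1 := hN1 p.2 (Set.mem_univ _)
  have hq := κ.bound _ hp hp1
  have e0 := Real.rpow_le_rpow_of_exponent_ge hp hp1 (by linarith : a / 2 ≤ a)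
  have e1 := Real.rpow_le_rpow_of_exponent_ge hp hp1 (by linarith : a / 2 ≤ 1 + a / 2)
  have hpos := Real.rpow_pos_of_pos hp a
  have hpos' := Real.rpow_pos_of_pos hp (1 + a / 2)
  simp only [freeMode, Pi.add_apply, halfProduct, if_pos hp]
  refine (norm_add_le _ _).trans ?_
  rw [norm_mul, norm_mul, Complex.norm_real, Complex.norm_real, Real.norm_of_nonneg hpos.le,
    Real.norm_eq_abs]
  have hq' : |κ.q (σ * p.1)| ≤ |κ.C| * (σ * p.1) ^ (a / 2) :=
    hq.trans (mul_le_mul (le_abs_self _) e1 hpos'.le (abs_nonneg _))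
  calc _ ≤ (σ * p.1) ^ (a / 2) * N0 + |κ.C| * (σ * p.1) ^ (a / 2) * N1 := by gcongr
    _ = _ := by ring

include hφ in
-- The corrector only sees `φ_x` frozen at `x = 0`. By the mean value inequality, freezing costs a
-- factor `t`, which turns `t^{a-1}` into `t^a`.
theorem exists_pd_sub_bound (hσ : σ ^ 2 = 1) :
    ∃ B, ∀ p : Cyl, 0 < σ * p.1 → σ * p.1 ≤ 1 →
      |σ * pd 0 φ p - slope φ σ p.2| ≤ B * (σ * p.1) := by
  have hd := hφ.pd isOpen_univ 0
  obtain ⟨B, hB⟩ := (isCompact_Icc.prod isCompact_univ :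
    IsCompact (Set.Icc (-1 : ℝ) 1 ×ˢ (Set.univ : Set (AddCircle (2 * Real.pi))))
    ).exists_bound_of_continuousOn (hd.pd isOpen_univ 0).continuous.continuousOn
  refine ⟨B, fun p hp hp1 => ?_⟩
  obtain ⟨x, θ⟩ := p
  have hx : |x| = σ * x := abs_fst_eq (p := (x, θ)) hσ hp
  have hx1 : x ∈ Set.Icc (-1 : ℝ) 1 := abs_le.1 (hx.trans_le hp1)
  have h1 := (convex_Icc (-1 : ℝ) 1).norm_image_sub_le_of_norm_hasDerivWithin_le
    (f := fun t => pd 0 φ (t, θ)) (f' := fun t => pd 0 (pd 0 φ) (t, θ)) (C := B)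
    (fun t _ => (hasDerivAt_fst isOpen_univ hd (Set.mem_univ _)).hasDerivWithinAt)
    (fun t ht => hB (t, θ) ⟨ht, Set.mem_univ _⟩) (x := 0) (y := x) (by norm_num) hx1
  have h2 : |σ| = 1 := by rw [← Real.sqrt_sq_eq_abs σ, hσ, Real.sqrt_one]
  rw [slope, ← mul_sub, abs_mul, h2, one_mul]
  simpa [hx] using h1

theorem memLp_mode (hσ : σ ^ 2 = 1) (hs : ∀ p : Cyl, 0 < σ * p.1 → p ∈ s.region) (ha : 0 < a)
    (hχ : χ.rOut ≤ 1) (k : ℤ) :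
    MemLp (mode κ χ φ σ k) 2 (area (grushinMetric φ hφ s).coeff s.region) := by
  have hσ0 : σ ≠ 0 := by rintro rfl; norm_num at hσ
  obtain ⟨B, hB⟩ := exists_freeMode_bound (σ := σ) hφ κ ha k
  refine memLp_of_half_bound hφ s hσ hs (γ := a / 2) (δ := χ.rIn) (C := B) ?_ ?_ (by linarith)
    χ.rIn_pos ?_
  · exact ((smoothOn_mode hφ κ χ hσ0 k).mono fun p hp => s.fst_ne_zero hp).continuousOn
      s.region.isOpen
  · intro p _ hp
    by_cases h : 0 < σ * p.1
    · refine mode_of_rOut_le κ χ k ?_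
      rw [abs_fst_eq hσ h]
      exact hχ.trans (not_le.1 fun h' => hp ⟨h, h'⟩).le
    · exact mode_of_not_half κ χ k h
  · intro p hp hp'
    rw [mode_eq_freeMode κ χ hσ k hp hp']
    exact hB p hp (hp'.le.trans (χ.rIn_lt_rOut.le.trans hχ))

/-- The indicial equation kills order `t^{a-2}`, and the corrector replaces `φ_x` by `φ_x - φ_x(0,
y)` in the term of order `t^{a-1}`. Everything left is `O(t^{a/2})`, which is square integrable. -/
theorem exists_expr_freeMode_bound (hσ : σ ^ 2 = 1)
    (hs : ∀ p : Cyl, 0 < σ * p.1 → p ∈ s.region) (ha : 0 < a)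
    (hac : a ^ 2 - 2 * a + 2 * c = 0) (k : ℤ) :
    ∃ B, ∀ p : Cyl, 0 < σ * p.1 → σ * p.1 ≤ 1 →
      ‖curvatureLaplaceExpr (grushinMetric φ hφ s).coeff c (freeMode κ φ σ k) p‖ ≤
        B * (σ * p.1) ^ (a / 2) := by
  have hσ0 : σ ≠ 0 := by rintro rfl; norm_num at hσ
  have hA := smoothOn_amplitude hφ k
  have hA' := smoothOn_amplitude' (σ := σ) hφ k
  have hK := isCompact_strip hσ 0
  obtain ⟨N0, hN0⟩ := hK.exists_bound_of_continuousOn hA.continuous.continuousOn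
  obtain ⟨N1, hN1⟩ := hK.exists_bound_of_continuousOn hA'.continuous.continuousOn
  obtain ⟨R0, hR0⟩ := hK.exists_bound_of_continuousOn (continuous_boundedPart hφ c hA).continuousOn
  obtain ⟨R1, hR1⟩ := hK.exists_bound_of_continuousOn
    (continuous_boundedPart hφ c hA').continuousOn
  obtain ⟨P, hP⟩ := hK.exists_bound_of_continuousOn
    ((SmoothOn.const σ).mul (hφ.pd isOpen_univ 0)).continuous.continuousOn
  obtain ⟨M, hM⟩ := exists_pd_sub_bound hφ hσ
  refine ⟨|a - 2 * c| * M * N0 + R0 + P * (|κ.C| + 2 * |c| * |κ.C|) * N1 + |κ.C| * R1,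
    fun p hp hp1 => ?_⟩
  have hadd := expr_add (grushinMetric φ hφ s) c
    ((smoothOn_halfProduct hσ0 (contDiffOn_rpow a) hA).mono fun p hp => s.fst_ne_zero hp)
    ((smoothOn_halfProduct hσ0 κ.smooth hA').mono fun p hp => s.fst_ne_zero hp) (hs p hp)
  have hd : ∀ (e : ℝ) (t : ℝ), 0 < t → HasDerivAt (fun t : ℝ => t ^ e) (e * t ^ (e - 1)) t :=
    fun e t ht => Real.hasDerivAt_rpow_const (Or.inl ht.ne')
  rw [freeMode, hadd, Pi.add_apply,
    expr_halfProduct hφ s hσ c (contDiffOn_rpow a) (hd a)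
      (fun t ht => (hd (a - 1) t ht).const_mul a) hA hp,
    expr_halfProduct hφ s hσ c κ.smooth κ.hasDerivAt κ.hasDerivAt' hA' hp, κ.ode _ hp]
  have hmem : p ∈ {p : Cyl | 0 ≤ σ * p.1 ∧ σ * p.1 ≤ 1} := ⟨hp.le, hp1⟩
  have n0 := hN0 p hmem
  have n1 := hN1 p hmem
  have r0 := hR0 p hmem
  have r1 := hR1 p hmem
  have pp := hP p hmem
  have mm := hM p hp hp1
  have q0 := κ.bound _ hp hp1
  have q1 := κ.bound' _ hp hp1
  have hamp : amplitude' φ σ k p.2 = (slope φ σ p.2 : ℂ) * amplitude φ k p.2 := rfl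
  simp only [Real.norm_eq_abs] at pp
  generalize σ * p.1 = t at *
  have e1 : t ^ a = t ^ (a - 1) * t := by
    rw [← Real.rpow_add_one hp.ne', sub_add_cancel]
  have e2 : t ^ (a - 1) = t ^ (a - 1 - 1) * t := by
    rw [← Real.rpow_add_one hp.ne', sub_add_cancel]
  -- The indicial equation.
  have l0 : -(a * ((a - 1) * t ^ (a - 1 - 1))) + a * t ^ (a - 1) / t - 2 * c * t ^ a / t ^ 2 = 0 := by
    rw [e1, e2]
    field_simp
    linear_combination (-t ^ (a - 1 - 1)) * hac
  have m0 : a * t ^ (a - 1) - 2 * c * t ^ a / t = (a - 2 * c) * t ^ (a - 1) := by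
    rw [e1]
    field_simp
  -- The right-hand side of the corrector equation, times the slope, merges with the first-order
  -- error of `t^a`.
  have hsplit : ((-(a * ((a - 1) * t ^ (a - 1 - 1))) + a * t ^ (a - 1) / t -
      2 * c * t ^ a / t ^ 2 + σ * pd 0 φ p * (a * t ^ (a - 1) - 2 * c * t ^ a / t) : ℝ) : ℂ) *
        amplitude φ k p.2 + ((t ^ a : ℝ) : ℂ) * boundedPart φ c (amplitude φ k) p +
      (((-(a - 2 * c) * t ^ (a - 1) + σ * pd 0 φ p * (κ.q' t - 2 * c * κ.q t / t) : ℝ) : ℂ) *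
        amplitude' φ σ k p.2 + (κ.q t : ℂ) * boundedPart φ c (amplitude' φ σ k) p) =
      (((a - 2 * c) * (t ^ (a - 1) * (σ * pd 0 φ p - slope φ σ p.2)) : ℝ) : ℂ) *
          amplitude φ k p.2 + ((t ^ a : ℝ) : ℂ) * boundedPart φ c (amplitude φ k) p +
        ((σ * pd 0 φ p * (κ.q' t - 2 * c * κ.q t / t) : ℝ) : ℂ) * amplitude' φ σ k p.2 +
        (κ.q t : ℂ) * boundedPart φ c (amplitude' φ σ k) p := by
    rw [l0, m0, hamp]
    push_cast
    ring
  refine (congrArg norm hsplit).trans_le ?_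
  have ta : t ^ a ≤ t ^ (a / 2) := Real.rpow_le_rpow_of_exponent_ge hp hp1 (by linarith)
  have t1 : t ^ (1 + a / 2) ≤ t ^ (a / 2) :=
    Real.rpow_le_rpow_of_exponent_ge hp hp1 (by linarith)
  have t2 : t ^ (1 + a / 2) = t * t ^ (a / 2) := by rw [Real.rpow_add hp, Real.rpow_one]
  have pa1 : 0 < t ^ (a - 1) := Real.rpow_pos_of_pos hp _
  have pa2 : 0 < t ^ (a / 2) := Real.rpow_pos_of_pos hp _
  have pa3 : 0 < t ^ a := Real.rpow_pos_of_pos hp _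
  have hM0 : 0 ≤ M := by
    have := (abs_nonneg _).trans mm
    exact nonneg_of_mul_nonneg_left this hp
  have hP0 : 0 ≤ P := (abs_nonneg _).trans pp
  have hN00 : 0 ≤ N0 := (norm_nonneg _).trans n0
  have q0' : |κ.q t| ≤ |κ.C| * t ^ (a / 2) :=
    q0.trans (mul_le_mul (le_abs_self _) t1 (Real.rpow_nonneg hp.le _) (abs_nonneg _))
  have q1' : |κ.q' t| ≤ |κ.C| * t ^ (a / 2) :=
    q1.trans (mul_le_mul_of_nonneg_right (le_abs_self _) pa2.le)
  have q2' : |2 * c * κ.q t / t| ≤ 2 * |c| * |κ.C| * t ^ (a / 2) := by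
    rw [abs_div, abs_of_pos hp, div_le_iff₀ hp, abs_mul, abs_mul, abs_two]
    have : |κ.q t| ≤ |κ.C| * (t * t ^ (a / 2)) := by
      rw [← t2]
      exact q0.trans (mul_le_mul_of_nonneg_right (le_abs_self _) (Real.rpow_nonneg hp.le _))
    calc 2 * |c| * |κ.q t| ≤ 2 * |c| * (|κ.C| * (t * t ^ (a / 2))) := by gcongr
      _ = _ := by ring
  have b1 : ‖(((a - 2 * c) * (t ^ (a - 1) * (σ * pd 0 φ p - slope φ σ p.2)) : ℝ) : ℂ) *
      amplitude φ k p.2‖ ≤ |a - 2 * c| * M * N0 * t ^ (a / 2) := by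
    rw [norm_mul, Complex.norm_real, Real.norm_eq_abs, abs_mul, abs_mul, abs_of_pos pa1]
    calc _ ≤ |a - 2 * c| * (t ^ (a - 1) * (M * t)) * N0 := by gcongr
      _ = |a - 2 * c| * M * N0 * t ^ a := by rw [e1]; ring
      _ ≤ _ := by gcongr
  have b2 : ‖((t ^ a : ℝ) : ℂ) * boundedPart φ c (amplitude φ k) p‖ ≤ R0 * t ^ (a / 2) := by
    rw [norm_mul, Complex.norm_real, Real.norm_of_nonneg pa3.le, mul_comm]
    gcongr
    exact (norm_nonneg _).trans r0
  have b3 : ‖((σ * pd 0 φ p * (κ.q' t - 2 * c * κ.q t / t) : ℝ) : ℂ) * amplitude' φ σ k p.2‖ ≤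
      P * (|κ.C| + 2 * |c| * |κ.C|) * N1 * t ^ (a / 2) := by
    rw [norm_mul, Complex.norm_real, Real.norm_eq_abs, abs_mul]
    have := (abs_sub _ _).trans (add_le_add q1' q2')
    calc _ ≤ P * (|κ.C| * t ^ (a / 2) + 2 * |c| * |κ.C| * t ^ (a / 2)) * N1 := by gcongr
      _ = _ := by ring
  have b4 : ‖(κ.q t : ℂ) * boundedPart φ c (amplitude' φ σ k) p‖ ≤
      |κ.C| * R1 * t ^ (a / 2) := by
    rw [norm_mul, Complex.norm_real, Real.norm_eq_abs]
    calc _ ≤ |κ.C| * t ^ (a / 2) * R1 := by gcongr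
      _ = _ := by ring
  refine (norm_add_le _ _).trans ((add_le_add ((norm_add_le _ _).trans (add_le_add
    ((norm_add_le _ _).trans (add_le_add b1 b2)) b3)) b4).trans (le_of_eq ?_))
  ring

theorem mode_eqOn_zero (k : ℤ) :
    Set.EqOn (mode κ χ φ σ k) 0 {p | σ * p.1 < 0 ∨ χ.rOut < |p.1|} := by
  rintro p (hp | hp)
  · exact mode_of_not_half κ χ k (not_lt.2 hp.le)
  · exact mode_of_rOut_le κ χ k hp.le

theorem isOpen_outside (σ r : ℝ) : IsOpen {p : Cyl | σ * p.1 < 0 ∨ r < |p.1|} :=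
  (isOpen_half_neg σ).union (isOpen_lt continuous_const (continuous_abs.comp continuous_fst))

theorem mem_outside (hσ : σ ^ 2 = 1) {r : ℝ} (hr : r < 1) {p : Cyl} (hp0 : p.1 ≠ 0)
    (hp : ¬ (0 < σ * p.1 ∧ σ * p.1 ≤ 1)) : p ∈ {p : Cyl | σ * p.1 < 0 ∨ r < |p.1|} := by
  have hσ0 : σ ≠ 0 := by rintro rfl; norm_num at hσ
  rcases lt_trichotomy (σ * p.1) 0 with h | h | h
  · exact Or.inl h
  · exact absurd h (mul_ne_zero hσ0 hp0)
  · right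
    rw [abs_fst_eq hσ h]
    exact hr.trans (not_le.1 fun h' => hp ⟨h, h'⟩)

theorem memLp_expr_mode (hσ : σ ^ 2 = 1) (hs : ∀ p : Cyl, 0 < σ * p.1 → p ∈ s.region)
    (ha : 0 < a) (hac : a ^ 2 - 2 * a + 2 * c = 0) (hχ : χ.rOut < 1) (k : ℤ) :
    MemLp (curvatureLaplaceExpr (grushinMetric φ hφ s).coeff c (mode κ χ φ σ k)) 2
      (area (grushinMetric φ hφ s).coeff s.region) := by
  have hσ0 : σ ≠ 0 := by rintro rfl; norm_num at hσ
  obtain ⟨B, hB⟩ := exists_expr_freeMode_bound hφ s κ hσ hs ha hac k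
  have hsm : SmoothOn (mode κ χ φ σ k) s.region :=
    (smoothOn_mode hφ κ χ hσ0 k).mono fun p hp => s.fst_ne_zero hp
  refine memLp_of_half_bound hφ s hσ hs (γ := a / 2) (δ := χ.rIn) (C := B) ?_ ?_ (by linarith)
    χ.rIn_pos ?_
  · exact (smooth_expr _ c hsm).continuousOn s.region.isOpen
  · intro p hp h
    exact expr_zero (grushinMetric φ hφ s) c (isOpen_outside σ χ.rOut) (mode_eqOn_zero κ χ k)
      (mem_outside hσ hχ (s.fst_ne_zero hp) h)
  · intro p hp hp'
    have hO : IsOpen {p : Cyl | 0 < σ * p.1 ∧ σ * p.1 < χ.rIn} :=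
      (isOpen_half σ).inter (isOpen_lt (continuous_const.mul continuous_fst) continuous_const)
    rw [expr_congr c hO (v := freeMode κ φ σ k)
      (fun q hq => mode_eq_freeMode κ χ hσ k hq.1 hq.2) ⟨hp, hp'⟩]
    exact hB p hp (hp'.le.trans (χ.rIn_lt_rOut.le.trans hχ.le))

end Modes

end Grushin

end


noncomputable section

namespace Grushin

open scoped ContDiff ComplexConjugate Topology
open MeasureTheory Filter

/-! ### The boundary form as a limit of fluxes. -/

section BoundaryLimit

variable {φ : Cyl → ℝ} (hφ : SmoothOn φ Set.univ) (s : Zone) {σ : ℝ}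

/-- The divergence theorem on `{0 < σx}` for fields that vanish for large `σx`: only the limit of
the flux through the circles `σx = δ` contributes. -/
theorem integral_pd_eq_of_tendsto (hσ : σ ^ 2 = 1) (hs : ∀ p : Cyl, 0 < σ * p.1 → p ∈ s.region)
    {F Q : Cyl → ℂ} (hF : SmoothOn F {p | p.1 ≠ 0}) (hQ : SmoothOn Q {p | p.1 ≠ 0}) {r : ℝ}
    (hr : r < 1) (hF0 : Set.EqOn F 0 {p | σ * p.1 < 0 ∨ r < |p.1|})
    (hQ0 : Set.EqOn Q 0 {p | σ * p.1 < 0 ∨ r < |p.1|})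
    (hint : IntegrableOn (fun p => pd 0 F p + pd 1 Q p) s.region) {L : ℂ}
    (hL : Tendsto (fun δ => ∫ θ : AddCircle (2 * Real.pi), F (σ * δ, θ)) (𝓝[>] 0) (𝓝 L)) :
    ∫ p in (s.region : Set Cyl), pd 0 F p + pd 1 Q p = -σ * L := by
  have hσ0 : σ ≠ 0 := by rintro rfl; norm_num at hσ
  have hσσ : ∀ t, σ * (σ * t) = t := fun t => by rw [← mul_assoc, ← pow_two, hσ, one_mul]
  have habs : |σ| = 1 := by rw [← Real.sqrt_sq_eq_abs σ, hσ, Real.sqrt_one]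
  set G : Cyl → ℂ := fun p => pd 0 F p + pd 1 Q p with hG
  have hG0 : ∀ p ∈ s.region, ¬ (0 < σ * p.1 ∧ σ * p.1 ≤ 1) → G p = 0 := by
    intro p hp h
    have hm := mem_outside hσ hr (s.fst_ne_zero hp) h
    have hO := isOpen_outside σ r
    simp only [hG]
    rw [pd_congr hO hF0 0 hm, pd_congr hO hQ0 1 hm]
    simp [pd]
  -- With `t = σx` the integral over either half-cylinder becomes one over `(0, 1]`; for the zone `x
  -- ≠ 0` the field vanishes on the other half.
  set Φ : ℝ → ℂ := fun t => ∫ θ : AddCircle (2 * Real.pi), G (σ * t, θ) with hΦ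
  set H : ℝ → ℂ := fun x => ∫ θ : AddCircle (2 * Real.pi),
    (s.region : Set Cyl).indicator G (x, θ) with hH
  have hind := (integrable_indicator_iff s.region.isOpen.measurableSet).2 hint
  rw [Measure.volume_eq_prod] at hind
  have hHΦ : (fun t => H (σ * t)) = (Set.Ioc (0 : ℝ) 1).indicator Φ := by
    ext t
    by_cases ht : t ∈ Set.Ioc (0 : ℝ) 1
    · rw [Set.indicator_of_mem ht]
      refine integral_congr_ae (.of_forall fun θ => ?_)
      have : ((σ * t, θ) : Cyl) ∈ (s.region : Set Cyl) := hs _ (by rw [hσσ]; exact ht.1)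
      exact Set.indicator_of_mem this G
    · rw [Set.indicator_of_notMem ht]
      refine (integral_congr_ae (.of_forall fun θ => ?_)).trans (integral_zero _ _)
      by_cases hm : ((σ * t, θ) : Cyl) ∈ (s.region : Set Cyl)
      · rw [Set.indicator_of_mem hm]
        exact hG0 _ hm (by rw [hσσ]; exact ht)
      · exact Set.indicator_of_notMem hm G
  have e1 : ∫ p in (s.region : Set Cyl), G p = ∫ t in (0 : ℝ)..1, Φ t := by
    rw [intervalIntegral.integral_of_le zero_le_one, ← integral_indicator measurableSet_Ioc,
      ← hHΦ, Measure.integral_comp_mul_left, abs_inv, habs, inv_one, one_smul,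
      ← integral_indicator s.region.isOpen.measurableSet, Measure.volume_eq_prod,
      integral_prod _ hind]
  have hΦint : IntegrableOn Φ (Set.uIcc 0 1) := by
    rw [Set.uIcc_of_le zero_le_one, integrableOn_Icc_iff_integrableOn_Ioc,
      ← integrable_indicator_iff measurableSet_Ioc, ← hHΦ]
    exact hind.integral_prod_left.comp_mul_left' hσ0
  -- `Φ` is integrable up to `0`, so its primitive is continuous in the lower limit.
  have hlim : Tendsto (fun δ => ∫ t in δ..1, Φ t) (𝓝[>] 0) (𝓝 (∫ t in (0 : ℝ)..1, Φ t)) := by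
    have h1 := intervalIntegral.continuousOn_primitive_interval_left hΦint 0 (by simp)
    rw [Set.uIcc_of_le zero_le_one] at h1
    have h2 := h1.mono Set.Ioo_subset_Icc_self
    rwa [ContinuousWithinAt, nhdsWithin_Ioo_eq_nhdsGT zero_lt_one] at h2
  have hFσ : ∀ θ, F (σ, θ) = 0 := fun θ => hF0 (Or.inr (by rwa [habs]))
  have hstrip : ∀ δ ∈ Set.Ioo (0 : ℝ) 1, ∫ t in δ..1, Φ t =
      -σ * ∫ θ : AddCircle (2 * Real.pi), F (σ * δ, θ) := by
    intro δ hδ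
    -- The circle `σx = δ` is the left end of the strip if `σ = 1` and the right end if `σ = -1`;
    -- this is the sign `-σ`.
    have hσ1 : (σ - 1) * (σ + 1) = 0 := by linear_combination hσ
    rcases mul_eq_zero.1 hσ1 with h1 | h1
    on_goal 1 => obtain rfl : σ = 1 := by linarith
    on_goal 2 => obtain rfl : σ = -1 := by linarith
    · have := integral_pd_strip isOpen_fst_ne_zero hF hQ hδ.2.le
        (fun x hx θ => (hδ.1.trans_le hx.1).ne')
      simp only [hΦ, hG, one_mul]
      rw [this]
      simp [hFσ]
    · have := integral_pd_strip isOpen_fst_ne_zero hF hQ (neg_le_neg hδ.2.le)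
        (fun x hx θ => (hx.2.trans_lt (neg_lt_zero.2 hδ.1)).ne)
      simp only [hΦ, hG, neg_one_mul]
      rw [intervalIntegral.integral_comp_neg
        (fun x => ∫ θ : AddCircle (2 * Real.pi), pd 0 F (x, θ) + pd 1 Q (x, θ)), this]
      simp [hFσ]
  rw [e1]
  refine tendsto_nhds_unique hlim ((hL.const_mul (-σ : ℂ)).congr' ?_)
  filter_upwards [Ioo_mem_nhdsGT (zero_lt_one (α := ℝ))] with δ hδ
  exact (hstrip δ hδ).symm

theorem integral_fourier (n : ℤ) :
    ∫ θ : AddCircle (2 * Real.pi), (fourier n θ : ℂ) = if n = 0 then 2 * Real.pi else 0 := by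
  split_ifs with h
  · subst h
    simp only [fourier_zero]
    rw [integral_const]
    simp [Measure.real, Real.pi_pos.le]
  · exact integral_eq_zero_of_add_right_eq_neg (fourier_add_half_inv_index h Real.two_pi_pos)

/-- The Wronskian with respect to the weight `1 / t`. -/
def weightedWronskian (f f' h h' : ℝ → ℝ) (t : ℝ) : ℝ := t⁻¹ * (f' t * h t - f t * h' t)

variable {a a' c : ℝ} (κ : Corrector a c) (κ' : Corrector a' c) (χ : ContDiffBump (0 : ℝ))

theorem pd_zero_freeMode (k : ℤ) {p : Cyl} (hp : 0 < σ * p.1) :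
    pd 0 (freeMode κ φ σ k) p = σ * (((a * (σ * p.1) ^ (a - 1) : ℝ) : ℂ) * amplitude φ k p.2 +
      (κ.q' (σ * p.1) : ℂ) * amplitude' φ σ k p.2) := by
  have hsplit : freeMode κ φ σ k = fun p => halfProduct σ (fun t => t ^ a) (amplitude φ k) p +
    halfProduct σ κ.q (amplitude' φ σ k) p := rfl
  obtain ⟨x, θ⟩ := p
  have hadd : pd 0 (freeMode κ φ σ k) (x, θ) =
      pd 0 (halfProduct σ (fun t => t ^ a) (amplitude φ k)) (x, θ) +
        pd 0 (halfProduct σ κ.q (amplitude' φ σ k)) (x, θ) := by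
    have hd : ∀ {Q Q' : ℝ → ℝ} (b : AddCircle (2 * Real.pi) → ℂ),
        (∀ t, 0 < t → HasDerivAt Q (Q' t) t) →
        DifferentiableAt ℝ (fun x => halfProduct σ Q b (x, θ)) x := by
      intro Q Q' b hQ
      have h2 : HasDerivAt (fun x => σ * x) σ x := by simpa using (hasDerivAt_id x).const_mul σ
      have h1 : DifferentiableAt ℝ (fun x => ((Q (σ * x) : ℝ) : ℂ) * b θ) x :=
        (((hQ _ hp).comp x h2).ofReal_comp.mul_const (b θ)).differentiableAt
      refine h1.congr_of_eventuallyEq ?_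
      have : {x : ℝ | 0 < σ * x} ∈ 𝓝 x :=
        (isOpen_lt continuous_const (continuous_const.mul continuous_id)).mem_nhds hp
      filter_upwards [this] with y hy
      exact halfProduct_eqOn σ Q b (show ((y, θ) : Cyl) ∈ {p : Cyl | 0 < σ * p.1} from hy)
    rw [hsplit, pd_zero_apply, pd_zero_apply, pd_zero_apply]
    exact deriv_fun_add (hd _ fun t ht => Real.hasDerivAt_rpow_const (Or.inl ht.ne'))
      (hd _ κ.hasDerivAt)
  rw [hadd, pd_zero_halfProduct (fun t ht => Real.hasDerivAt_rpow_const (Or.inl ht.ne')) _ hp,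
    pd_zero_halfProduct κ.hasDerivAt _ hp]
  simp only [halfProduct, if_pos hp]
  ring

/-- Two corrected profiles give three kinds of Wronskian, attached to the powers `0`, `1`, `2` of
the slope. Their weight `1/t` is the singular factor of the area; its other factor `e^{-φ}` combines
with the amplitudes to `e^{φ(0,y)-φ}`. -/
theorem flux_mode (hσ : σ ^ 2 = 1) (k k' : ℤ) {t : ℝ} (ht : 0 < t) (ht' : t < χ.rIn)
    (θ : AddCircle (2 * Real.pi)) :
    flux (grushinMetric φ hφ s) (mode κ χ φ σ k) (mode κ' χ φ σ k') 0 (σ * t, θ) =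
      σ * (((weightedWronskian (fun t => t ^ a) (fun t => a * t ^ (a - 1)) (fun t => t ^ a')
          (fun t => a' * t ^ (a' - 1)) t : ℝ) : ℂ) *
            ((Real.exp (φ (0, θ) - φ (σ * t, θ)) : ℂ) * fourier (k - k') θ) +
        ((weightedWronskian (fun t => t ^ a) (fun t => a * t ^ (a - 1)) κ'.q κ'.q' t +
          weightedWronskian κ.q κ.q' (fun t => t ^ a') (fun t => a' * t ^ (a' - 1)) t : ℝ) : ℂ) *
            ((Real.exp (φ (0, θ) - φ (σ * t, θ)) * slope φ σ θ : ℝ) * fourier (k - k') θ) +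
        ((weightedWronskian κ.q κ.q' κ'.q κ'.q' t : ℝ) : ℂ) *
            ((Real.exp (φ (0, θ) - φ (σ * t, θ)) * slope φ σ θ ^ 2 : ℝ) *
              fourier (k - k') θ)) := by
  have hσ0 : σ ≠ 0 := by rintro rfl; norm_num at hσ
  have hσσ : σ * (σ * t) = t := by rw [← mul_assoc, ← pow_two, hσ, one_mul]
  set p : Cyl := (σ * t, θ) with hp
  have hpt : σ * p.1 = t := hσσ
  have hp0 : 0 < σ * p.1 := by rwa [hpt]
  have hp1 : σ * p.1 < χ.rIn := by rwa [hpt]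
  have hO : IsOpen {p : Cyl | 0 < σ * p.1 ∧ σ * p.1 < χ.rIn} :=
    (isOpen_half σ).inter (isOpen_lt (continuous_const.mul continuous_fst) continuous_const)
  have habs : |p.1| = t := by rw [abs_fst_eq hσ hp0, hpt]
  have hpd : ∀ {a : ℝ} (κ : Corrector a c) (k : ℤ), pd 0 (mode κ χ φ σ k) p =
      σ * (((a * t ^ (a - 1) : ℝ) : ℂ) * amplitude φ k θ +
        (κ.q' t : ℂ) * amplitude' φ σ k θ) := by
    intro a κ k
    rw [pd_congr hO (fun q hq => mode_eq_freeMode κ χ hσ k hq.1 hq.2) 0 ⟨hp0, hp1⟩,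
      pd_zero_freeMode κ k hp0, hpt]
  have hval : ∀ {a : ℝ} (κ : Corrector a c) (k : ℤ), mode κ χ φ σ k p =
      ((t ^ a : ℝ) : ℂ) * amplitude φ k θ + (κ.q t : ℂ) * amplitude' φ σ k θ := by
    intro a κ k
    rw [mode_eq_freeMode κ χ hσ k hp0 hp1]
    simp only [freeMode, Pi.add_apply, halfProduct, hpt, if_pos ht]
    rfl
  have hne : p.1 ≠ 0 := fun h => by rw [h, abs_zero] at habs; exact ht.ne habs
  have hgrad : ∀ u : Cyl → ℂ, grad (grushinMetric φ hφ s).coeff u 0 p = pd 0 u p := by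
    intro u
    simp [grad, grushin_inv hφ s hne]
  simp only [flux, hgrad, grushin_areaDensity, habs, hpd, hval, Complex.real_smul]
  have hF : (fourier (k - k') θ : ℂ) = fourier k θ * conj (fourier k' θ : ℂ) := by
    rw [sub_eq_add_neg, fourier_add, fourier_neg]
  have hE : Real.exp (φ (0, θ) - φ p) =
      Real.exp (-φ p) * (Real.exp (φ (0, θ) / 2) * Real.exp (φ (0, θ) / 2)) := by
    rw [← Real.exp_add, ← Real.exp_add]; ring_nf
  rw [hF, hE]
  simp only [amplitude', amplitude, weightedWronskian, map_mul, map_add, Complex.conj_ofReal]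
  push_cast
  ring

include hφ in
theorem continuous_integral_amplitude (n : ℤ) (j : ℕ) :
    Continuous fun t : ℝ => ∫ θ : AddCircle (2 * Real.pi),
      ((Real.exp (φ (0, θ) - φ (σ * t, θ)) * slope φ σ θ ^ j : ℝ) : ℂ) * fourier n θ := by
  have hφc := hφ.continuous
  have hsl : Continuous (slope φ σ) :=
    (smoothOn_slope hφ).continuous.comp (f := fun θ => ((0 : ℝ), θ)) (by fun_prop)
  have h := continuous_parametric_integral_of_continuous (μ := volume)
    (f := fun (t : ℝ) (θ : AddCircle (2 * Real.pi)) =>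
      ((Real.exp (φ (0, θ) - φ (σ * t, θ)) * slope φ σ θ ^ j : ℝ) : ℂ) * fourier n θ)
    (by
      refine Continuous.mul (Complex.continuous_ofReal.comp ?_)
        ((fourier n).continuous.comp continuous_snd)
      refine Continuous.mul (Real.continuous_exp.comp (Continuous.sub ?_ ?_)) ?_
      · exact hφc.comp (f := fun q : ℝ × AddCircle (2 * Real.pi) => ((0 : ℝ), q.2)) (by fun_prop)
      · exact hφc.comp (f := fun q : ℝ × AddCircle (2 * Real.pi) => (σ * q.1, q.2)) (by fun_prop)
      · exact (hsl.comp continuous_snd).pow j) isCompact_univ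
  simpa only [Measure.restrict_univ] using h

theorem integral_linear_combination {X : Type*} [MeasurableSpace X] {μ : Measure X}
    {f₀ f₁ f₂ : X → ℂ} (h₀ : Integrable f₀ μ) (h₁ : Integrable f₁ μ) (h₂ : Integrable f₂ μ)
    (z z₀ z₁ z₂ : ℂ) : ∫ x, z * (z₀ * f₀ x + z₁ * f₁ x + z₂ * f₂ x) ∂μ =
      z * (z₀ * ∫ x, f₀ x ∂μ + z₁ * ∫ x, f₁ x ∂μ + z₂ * ∫ x, f₂ x ∂μ) := by
  have h₀' := h₀.const_mul z₀
  have h₁' := h₁.const_mul z₁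
  have h₂' := h₂.const_mul z₂
  have h₀₁ : Integrable (fun x => z₀ * f₀ x + z₁ * f₁ x) μ := h₀'.add h₁'
  rw [integral_const_mul, integral_add h₀₁ h₂', integral_add h₀' h₁', integral_const_mul,
    integral_const_mul, integral_const_mul]

/-- Only the Wronskian of the leading powers may survive. Its angular factor `e^{φ(0,y)-φ}` tends to
`1`, leaving an integral of a pure exponential that no longer depends on `φ`. -/
theorem tendsto_flux_mode (hσ : σ ^ 2 = 1) (k k' : ℤ) {w : ℝ}
    (h0 : Tendsto (weightedWronskian (fun t => t ^ a) (fun t => a * t ^ (a - 1)) (fun t => t ^ a')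
      (fun t => a' * t ^ (a' - 1))) (𝓝[>] 0) (𝓝 w))
    (h1 : Tendsto (fun t => weightedWronskian (fun t => t ^ a) (fun t => a * t ^ (a - 1)) κ'.q κ'.q' t +
      weightedWronskian κ.q κ.q' (fun t => t ^ a') (fun t => a' * t ^ (a' - 1)) t) (𝓝[>] 0) (𝓝 0))
    (h2 : Tendsto (weightedWronskian κ.q κ.q' κ'.q κ'.q') (𝓝[>] 0) (𝓝 0)) :
    Tendsto (fun δ => ∫ θ : AddCircle (2 * Real.pi),
      flux (grushinMetric φ hφ s) (mode κ χ φ σ k) (mode κ' χ φ σ k') 0 (σ * δ, θ)) (𝓝[>] 0)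
      (𝓝 (σ * (w * ∫ θ : AddCircle (2 * Real.pi), (fourier (k - k') θ : ℂ)))) := by
  have hM := fun j => ((continuous_integral_amplitude (σ := σ) hφ (k - k') j).tendsto 0).mono_left
    (nhdsWithin_le_nhds (s := Set.Ioi 0))
  have hc : ∀ {f : ℝ → ℝ} {l : ℝ}, Tendsto f (𝓝[>] 0) (𝓝 l) →
      Tendsto (fun t => (f t : ℂ)) (𝓝[>] 0) (𝓝 (l : ℂ)) := fun h =>
    (Complex.continuous_ofReal.tendsto _).comp h
  have key := ((((hc h0).mul (hM 0)).add ((hc h1).mul (hM 1))).add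
    ((hc h2).mul (hM 2))).const_mul (σ : ℂ)
  have hl : (σ : ℂ) * (w * ∫ θ : AddCircle (2 * Real.pi), (fourier (k - k') θ : ℂ)) =
      (σ : ℂ) * ((w : ℂ) * (∫ θ : AddCircle (2 * Real.pi),
        ((Real.exp (φ (0, θ) - φ (σ * 0, θ)) * slope φ σ θ ^ 0 : ℝ) : ℂ) * fourier (k - k') θ) +
      ((0 : ℝ) : ℂ) * (∫ θ : AddCircle (2 * Real.pi),
        ((Real.exp (φ (0, θ) - φ (σ * 0, θ)) * slope φ σ θ ^ 1 : ℝ) : ℂ) * fourier (k - k') θ) +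
      ((0 : ℝ) : ℂ) * (∫ θ : AddCircle (2 * Real.pi),
        ((Real.exp (φ (0, θ) - φ (σ * 0, θ)) * slope φ σ θ ^ 2 : ℝ) : ℂ) *
          fourier (k - k') θ)) := by
    simp
  rw [hl]
  refine key.congr' ?_
  filter_upwards [Ioo_mem_nhdsGT χ.rIn_pos] with t ht
  rw [integral_congr_ae (.of_forall fun θ => flux_mode hφ s κ κ' χ hσ k k' ht.1 ht.2 θ)]
  have hφc := hφ.continuous
  have hsl : Continuous (slope φ σ) :=
    (smoothOn_slope hφ).continuous.comp (f := fun θ => ((0 : ℝ), θ)) (by fun_prop)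
  have hint : ∀ j : ℕ, Integrable fun θ : AddCircle (2 * Real.pi) =>
      ((Real.exp (φ (0, θ) - φ (σ * t, θ)) * slope φ σ θ ^ j : ℝ) : ℂ) * fourier (k - k') θ := by
    intro j
    refine Continuous.integrable_of_hasCompactSupport ?_ (HasCompactSupport.of_compactSpace _)
    refine Continuous.mul (Complex.continuous_ofReal.comp ?_) (fourier (k - k')).continuous
    refine Continuous.mul (Real.continuous_exp.comp (Continuous.sub ?_ ?_)) (hsl.pow j)
    · exact hφc.comp (by fun_prop)
    · exact hφc.comp (by fun_prop)
  have i0 := hint 0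
  have i1 := hint 1
  simp only [pow_zero, mul_one] at i0
  simp only [pow_one] at i1
  simp only [pow_zero, mul_one, pow_one]
  exact (integral_linear_combination i0 i1 (hint 2) _ _ _ _).symm

/-- The boundary form of two modes. -/
theorem boundary_form_mode (hσ : σ ^ 2 = 1) (hs : ∀ p : Cyl, 0 < σ * p.1 → p ∈ s.region)
    (ha : 0 < a) (ha' : 0 < a') (hac : a ^ 2 - 2 * a + 2 * c = 0)
    (hac' : a' ^ 2 - 2 * a' + 2 * c = 0) (hχ : χ.rOut < 1) (k k' : ℤ) {w : ℝ}
    (h0 : Tendsto (weightedWronskian (fun t => t ^ a) (fun t => a * t ^ (a - 1)) (fun t => t ^ a')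
      (fun t => a' * t ^ (a' - 1))) (𝓝[>] 0) (𝓝 w))
    (h1 : Tendsto (fun t => weightedWronskian (fun t => t ^ a) (fun t => a * t ^ (a - 1)) κ'.q κ'.q' t +
      weightedWronskian κ.q κ.q' (fun t => t ^ a') (fun t => a' * t ^ (a' - 1)) t) (𝓝[>] 0) (𝓝 0))
    (h2 : Tendsto (weightedWronskian κ.q κ.q' κ'.q κ'.q') (𝓝[>] 0) (𝓝 0)) :
    inner ℂ ((memLp_expr_mode hφ s κ' χ hσ hs ha' hac' hχ k').toLp _)
        ((memLp_mode hφ s κ χ hσ hs ha hχ.le k).toLp _) -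
      inner ℂ ((memLp_mode hφ s κ' χ hσ hs ha' hχ.le k').toLp _)
        ((memLp_expr_mode hφ s κ χ hσ hs ha hac hχ k).toLp _) =
      -(w * if k = k' then 2 * Real.pi else 0 : ℂ) := by
  have hσ0 : σ ≠ 0 := by rintro rfl; norm_num at hσ
  have hsub : (s.region : Set Cyl) ⊆ {p | p.1 ≠ 0} := fun p hp => s.fst_ne_zero hp
  have hu := smoothOn_mode hφ κ χ hσ0 k
  have hv := smoothOn_mode hφ κ' χ hσ0 k'
  have hu' := hu.mono hsub
  have hv' := hv.mono hsub
  have m1 := memLp_mode hφ s κ χ hσ hs ha hχ.le k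
  have m2 := memLp_mode hφ s κ' χ hσ hs ha' hχ.le k'
  have m3 := memLp_expr_mode hφ s κ χ hσ hs ha hac hχ k
  have m4 := memLp_expr_mode hφ s κ' χ hσ hs ha' hac' hχ k'
  rw [inner_expr_sub_inner (grushinMetric φ hφ s) c hu' hv' m1 m2 m3 m4]
  have hflux : ∀ i, SmoothOn (flux (grushinMetric φ hφ s) (mode κ χ φ σ k)
      (mode κ' χ φ σ k') i) {p | p.1 ≠ 0} := fun i =>
    -- The metric coefficients are given by the same formula in every zone, so the zone `x ≠ 0`
    -- provides smoothness on both halves.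
    smooth_flux (grushinMetric φ hφ Zone.both) isOpen_fst_ne_zero subset_rfl hu hv i
  have hz : ∀ i, Set.EqOn (flux (grushinMetric φ hφ s) (mode κ χ φ σ k) (mode κ' χ φ σ k') i) 0
      {p | σ * p.1 < 0 ∨ χ.rOut < |p.1|} := by
    intro i p hp
    have hO := isOpen_outside σ χ.rOut
    have e1 : ∀ j, pd j (mode κ χ φ σ k) p = 0 := fun j => by
      rw [pd_congr hO (mode_eqOn_zero κ χ k) j hp]; simp [pd]
    simp [flux, grad, e1, mode_eqOn_zero κ χ k hp]
  have hint : IntegrableOn (fun p => pd 0 (flux (grushinMetric φ hφ s) (mode κ χ φ σ k)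
      (mode κ' χ φ σ k') 0) p + pd 1 (flux (grushinMetric φ hφ s) (mode κ χ φ σ k)
      (mode κ' χ φ σ k') 1) p) s.region := by
    refine IntegrableOn.congr_fun ?_ (divergence_flux (grushinMetric φ hφ s) c hu' hv')
      s.region.isOpen.measurableSet
    rw [← integrableOn_area_iff _ s.region.isOpen.measurableSet subset_rfl]
    exact ((integrable_inner _ m4 m1).sub (integrable_inner _ m2 m3)).integrableOn
  rw [integral_pd_eq_of_tendsto s hσ hs (hflux 0) (hflux 1) hχ (hz 0) (hz 1) hint
    (tendsto_flux_mode hφ s κ κ' χ hσ k k' h0 h1 h2), integral_fourier, ← mul_assoc]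
  have : (-σ : ℂ) * σ = -1 := by
    rw [neg_mul, ← Complex.ofReal_mul, ← pow_two, hσ, Complex.ofReal_one]
  rw [this]
  simp only [sub_eq_zero]
  ring

end BoundaryLimit

/-! ### Limits of the weighted Wronskians. -/

section Wronskians

variable {a a' c : ℝ} (κ : Corrector a c) (κ' : Corrector a' c)

theorem tendsto_rpow_nhdsGT {e : ℝ} (he : 0 < e) :
    Tendsto (fun t : ℝ => t ^ e) (𝓝[>] 0) (𝓝 0) := by
  have := (Real.continuousAt_rpow_const 0 e (Or.inr he.le)).tendsto
  rw [Real.zero_rpow he.ne'] at this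
  exact this.mono_left nhdsWithin_le_nhds

/-- The weighted Wronskian equals `(a - a') t^{a + a' - 2}`, which is constant as the roots add up
to `2`. -/
theorem tendsto_wronskian_rpow (h : a + a' = 2) :
    Tendsto (weightedWronskian (fun t => t ^ a) (fun t => a * t ^ (a - 1)) (fun t => t ^ a')
      (fun t => a' * t ^ (a' - 1))) (𝓝[>] 0) (𝓝 (a - a')) := by
  refine tendsto_const_nhds.congr' ?_
  filter_upwards [self_mem_nhdsWithin] with t ht
  have ht : 0 < t := ht
  have e1 : t ^ a = t ^ (a - 1) * t := by rw [← Real.rpow_add_one ht.ne', sub_add_cancel]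
  have e2 : t ^ a' = t ^ (a' - 1) * t := by rw [← Real.rpow_add_one ht.ne', sub_add_cancel]
  have e3 : t ^ (a - 1) * t ^ (a' - 1) = 1 := by
    rw [← Real.rpow_add ht, show a - 1 + (a' - 1) = 0 by linarith, Real.rpow_zero]
  simp only [weightedWronskian, e1, e2]
  field_simp
  linear_combination (a' - a) * e3

/-- The exponents combine to `a - 1 + a'/2 = a/2`. -/
theorem wronskian_rpow_corrector_bound (h : a + a' = 2) (ha : 0 < a) {t : ℝ} (ht : 0 < t)
    (ht1 : t ≤ 1) :
    |weightedWronskian (fun t => t ^ a) (fun t => a * t ^ (a - 1)) κ'.q κ'.q' t| ≤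
      (a + 1) * |κ'.C| * t ^ (a / 2) := by
  have b1 := κ'.bound t ht ht1
  have b2 := κ'.bound' t ht ht1
  have hp1 := Real.rpow_pos_of_pos ht (1 + a' / 2)
  have hp2 := Real.rpow_pos_of_pos ht (a' / 2)
  have hp3 := Real.rpow_pos_of_pos ht (a - 1)
  have hp4 := Real.rpow_pos_of_pos ht a
  have b1' : |κ'.q t| ≤ |κ'.C| * t ^ (1 + a' / 2) :=
    b1.trans (mul_le_mul_of_nonneg_right (le_abs_self _) hp1.le)
  have b2' : |κ'.q' t| ≤ |κ'.C| * t ^ (a' / 2) :=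
    b2.trans (mul_le_mul_of_nonneg_right (le_abs_self _) hp2.le)
  have e1 : t ^ (a - 1) * t ^ (1 + a' / 2) = t * t ^ (a / 2) := by
    rw [← Real.rpow_add ht, ← Real.rpow_one_add' ht.le (by positivity)]
    congr 1
    linarith
  have e2 : t ^ a * t ^ (a' / 2) = t * t ^ (a / 2) := by
    rw [← Real.rpow_add ht, ← Real.rpow_one_add' ht.le (by positivity)]
    congr 1
    linarith
  rw [weightedWronskian, abs_mul, abs_inv, abs_of_pos ht, inv_mul_le_iff₀ ht]
  refine (abs_sub _ _).trans ?_
  rw [abs_mul, abs_mul, abs_mul, abs_of_pos ha, abs_of_pos hp3, abs_of_pos hp4]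
  calc a * t ^ (a - 1) * |κ'.q t| + t ^ a * |κ'.q' t|
      ≤ a * t ^ (a - 1) * (|κ'.C| * t ^ (1 + a' / 2)) + t ^ a * (|κ'.C| * t ^ (a' / 2)) := by
        gcongr
    _ = t * ((a + 1) * |κ'.C| * t ^ (a / 2)) := by
        linear_combination (a * |κ'.C|) * e1 + |κ'.C| * e2

theorem weightedWronskian_swap (f f' h h' : ℝ → ℝ) (t : ℝ) :
    weightedWronskian f f' h h' t = -weightedWronskian h h' f f' t := by
  simp only [weightedWronskian]
  ring

theorem weightedWronskian_self (f f' : ℝ → ℝ) : weightedWronskian f f' f f' = fun _ => 0 := by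
  ext t
  simp only [weightedWronskian]
  ring

theorem tendsto_wronskian_mixed (h : a + a' = 2) (ha : 0 < a) (ha' : 0 < a') :
    Tendsto (fun t => weightedWronskian (fun t => t ^ a) (fun t => a * t ^ (a - 1)) κ'.q κ'.q' t +
      weightedWronskian κ.q κ.q' (fun t => t ^ a') (fun t => a' * t ^ (a' - 1)) t)
      (𝓝[>] 0) (𝓝 0) := by
  have hlim : Tendsto (fun t : ℝ => (a + 1) * |κ'.C| * t ^ (a / 2) +
      (a' + 1) * |κ.C| * t ^ (a' / 2)) (𝓝[>] 0) (𝓝 0) := by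
    have := ((tendsto_rpow_nhdsGT (half_pos ha)).const_mul ((a + 1) * |κ'.C|)).add
      ((tendsto_rpow_nhdsGT (half_pos ha')).const_mul ((a' + 1) * |κ.C|))
    simpa using this
  refine squeeze_zero_norm' ?_ hlim
  filter_upwards [Ioo_mem_nhdsGT (zero_lt_one (α := ℝ))] with t ht
  refine (norm_add_le _ _).trans (add_le_add
    (wronskian_rpow_corrector_bound κ' h ha ht.1 ht.2.le) ?_)
  rw [weightedWronskian_swap, norm_neg]
  exact wronskian_rpow_corrector_bound κ (by linarith) ha' ht.1 ht.2.le

/-- Both products have size `t^{1 + (a + a')/2} = t²`, so the Wronskian is `O(t)` after division by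
`t`. -/
theorem tendsto_wronskian_corrector (h : a + a' = 2) :
    Tendsto (weightedWronskian κ.q κ.q' κ'.q κ'.q') (𝓝[>] 0) (𝓝 0) := by
  have hlim : Tendsto (fun t : ℝ => 2 * |κ.C| * |κ'.C| * t) (𝓝[>] 0) (𝓝 0) := by
    have : Tendsto (fun t : ℝ => 2 * |κ.C| * |κ'.C| * t) (𝓝 0) (𝓝 (2 * |κ.C| * |κ'.C| * 0)) :=
      tendsto_id.const_mul _
    rw [mul_zero] at this
    exact this.mono_left nhdsWithin_le_nhds
  refine squeeze_zero_norm' ?_ hlim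
  filter_upwards [Ioo_mem_nhdsGT (zero_lt_one (α := ℝ))] with t ht
  have hpos : ∀ e : ℝ, 0 < t ^ e := fun e => Real.rpow_pos_of_pos ht.1 e
  have hb : ∀ {x C y : ℝ}, 0 < y → |x| ≤ C * y → |x| ≤ |C| * y := fun hy hx =>
    hx.trans (mul_le_mul_of_nonneg_right (le_abs_self _) hy.le)
  have b1 := hb (hpos _) (κ.bound t ht.1 ht.2.le)
  have b2 := hb (hpos _) (κ.bound' t ht.1 ht.2.le)
  have b1' := hb (hpos _) (κ'.bound t ht.1 ht.2.le)
  have b2' := hb (hpos _) (κ'.bound' t ht.1 ht.2.le)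
  have e1 : t ^ (a / 2) * t ^ (1 + a' / 2) = t * t := by
    rw [← Real.rpow_add ht.1, show a / 2 + (1 + a' / 2) = 2 by linarith, Real.rpow_two, pow_two]
  have e2 : t ^ (1 + a / 2) * t ^ (a' / 2) = t * t := by
    rw [← Real.rpow_add ht.1, show 1 + a / 2 + a' / 2 = 2 by linarith, Real.rpow_two, pow_two]
  rw [Real.norm_eq_abs, weightedWronskian, abs_mul, abs_inv, abs_of_pos ht.1,
    inv_mul_le_iff₀ ht.1]
  refine (abs_sub _ _).trans ?_
  rw [abs_mul, abs_mul]
  have := (hpos (a / 2)).le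
  have := (hpos (1 + a / 2)).le
  calc |κ.q' t| * |κ'.q t| + |κ.q t| * |κ'.q' t|
      ≤ |κ.C| * t ^ (a / 2) * (|κ'.C| * t ^ (1 + a' / 2)) +
        |κ.C| * t ^ (1 + a / 2) * (|κ'.C| * t ^ (a' / 2)) := by gcongr
    _ = t * (2 * |κ.C| * |κ'.C| * t) := by
        linear_combination (|κ.C| * |κ'.C|) * e1 + (|κ.C| * |κ'.C|) * e2

end Wronskians

end Grushin

end


/-! ### Pairing criterion, choice of a half-cylinder, and indicial roots. -/

noncomputable section

namespace Grushin

open scoped ContDiff ComplexConjugate Topology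
open MeasureTheory Filter

/-- Functionals that vanish on `N` descend to the quotient, where they form a dual system to the `F
j` up to nonzero factors. -/
theorem linearIndependent_of_pairing {V : Type*} [AddCommGroup V] [Module ℂ V]
    {N : Submodule ℂ V} {ι : Type*} {F : ι → V} (T : ι → V →ₗ⋆[ℂ] ℂ)
    (hN : ∀ i, ∀ x ∈ N, T i x = 0) (h0 : ∀ i j, j ≠ i → T i (F j) = 0)
    (h1 : ∀ i, T i (F i) ≠ 0) : LinearIndependent ℂ fun j => N.mkQ (F j) := by
  rw [linearIndependent_iff']
  intro t z hz i hi
  have hmem : ∑ j ∈ t, z j • F j ∈ N := by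
    rw [← Submodule.ker_mkQ N, LinearMap.mem_ker, map_sum]
    simpa using hz
  have h2 := hN i _ hmem
  rw [map_sum, Finset.sum_eq_single i] at h2
  · rw [map_smulₛₗ, smul_eq_mul] at h2
    simpa using (mul_eq_zero.1 h2).resolve_right (h1 i)
  · intro j _ hj
    rw [map_smulₛₗ, h0 i j hj, smul_zero]
  · exact fun h => absurd hi h

/-- The boundary form `⟪A* x, w⟫ - ⟪x, A* w⟫`, as a conjugate-linear function of `x`. -/
def boundaryForm {H : Type*} [NormedAddCommGroup H] [InnerProductSpace ℂ H] [CompleteSpace H]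
    (A : H →ₗ.[ℂ] H) (w : A.adjoint.domain) : A.adjoint.domain →ₗ⋆[ℂ] ℂ where
  toFun x := inner ℂ (A.adjoint x) (w : H) - inner ℂ (x : H) (A.adjoint w)
  map_add' x y := by
    rw [LinearPMap.map_add, Submodule.coe_add, inner_add_left, inner_add_left]
    ring
  map_smul' z x := by
    rw [LinearPMap.map_smul, Submodule.coe_smul, inner_smul_left, inner_smul_left, smul_eq_mul]
    ring

/-- All modes are placed on one half-cylinder; for `x ≠ 0` the half `x > 0` is enough. -/
theorem Zone.exists_sign (s : Zone) :
    ∃ σ : ℝ, σ ^ 2 = 1 ∧ ∀ p : Cyl, 0 < σ * p.1 → p ∈ s.region := by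
  cases s
  · exact ⟨1, by norm_num, fun p hp => by simpa [Zone.region] using hp⟩
  · exact ⟨-1, by norm_num, fun p hp => by simpa [Zone.region] using hp⟩
  · refine ⟨1, by norm_num, fun p hp => ?_⟩
    rw [one_mul] at hp
    exact hp.ne'

theorem Zone.exists_eq_prod (s : Zone) :
    ∃ I : Set ℝ, IsOpen I ∧ (s.region : Set Cyl) = I ×ˢ Set.univ := by
  cases s
  · exact ⟨Set.Ioi 0, isOpen_Ioi, by ext p; simp [Zone.region]⟩
  · exact ⟨Set.Iio 0, isOpen_Iio, by ext p; simp [Zone.region]⟩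
  · exact ⟨{0}ᶜ, isOpen_compl_singleton, by ext p; simp [Zone.region]⟩

/-- The roots `1 ± √(1 - 2c)` of the indicial equation `a² - 2a + 2c = 0`. -/
def indicialRoot (c : ℝ) (b : Bool) : ℝ := if b then 1 + √(1 - 2 * c) else 1 - √(1 - 2 * c)

section Roots

variable {c : ℝ} (hc : c ∈ Set.Ioo (0 : ℝ) (1 / 2))

include hc

/-- Here `c > 0` enters: it makes the smaller root positive, so that both model solutions are square
integrable. -/
theorem indicialRoot_pos (b : Bool) : 0 < indicialRoot c b := by
  have h1 : √(1 - 2 * c) < 1 := by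
    rw [Real.sqrt_lt' one_pos]
    linarith [hc.1]
  have h2 := Real.sqrt_nonneg (1 - 2 * c)
  cases b <;> simp only [indicialRoot] <;> norm_num <;> linarith

theorem indicialRoot_eq (b : Bool) :
    indicialRoot c b ^ 2 - 2 * indicialRoot c b + 2 * c = 0 := by
  have h := Real.sq_sqrt (show 0 ≤ 1 - 2 * c by linarith [hc.2])
  cases b
  · simp only [indicialRoot, Bool.false_eq_true, if_false]
    linear_combination h
  · simp only [indicialRoot, if_true]
    linear_combination h

omit hc in
theorem indicialRoot_add_not (b : Bool) : indicialRoot c b + indicialRoot c (!b) = 2 := by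
  cases b <;> simp [indicialRoot] <;> ring

/-- Here `c < 1/2` enters: the difference of the roots is the Wronskian of the two model solutions.
-/
theorem indicialRoot_ne_not (b : Bool) : indicialRoot c b - indicialRoot c (!b) ≠ 0 := by
  have h : 0 < √(1 - 2 * c) := Real.sqrt_pos.2 (by linarith [hc.2])
  cases b
  · simp only [indicialRoot, Bool.not_false, Bool.false_eq_true, if_false, if_true]
    exact ne_of_lt (by linarith)
  · simp only [indicialRoot, Bool.not_true, Bool.false_eq_true, if_false, if_true]
    exact ne_of_gt (by linarith)

end Roots

/-! ### The independent family and the theorem. -/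

section Main

variable {φ : Cyl → ℝ} (hφ : SmoothOn φ Set.univ) {c : ℝ} (hc : c ∈ Set.Ioo (0 : ℝ) (1 / 2))
  (s : Zone)

theorem dense_domain_grushin (c : ℝ) :
    Dense ((curvatureLaplacian (grushinMetric φ hφ s) c).domain :
      Set (L2 (grushinMetric φ hφ s))) := by
  obtain ⟨I, hI, h⟩ := s.exists_eq_prod
  exact dense_domain (grushinMetric φ hφ s) hI h c

include hc in
/-- The classes of the functions `h_± e^{iky}` are linearly independent. -/
theorem exists_independent_modes {ε : ℝ} (hε : 0 < ε) : ∃ h : Bool → Cyl → ℂ,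
    (∀ b, SmoothOn (h b) s.region ∧
      MemLp (h b) 2 (area (grushinMetric φ hφ s).coeff s.region) ∧
      Function.support (h b) ⊆ {p | p ∈ s.region ∧ |p.1| < ε}) ∧
    ∃ F : Bool × ℤ → (curvatureLaplacian (grushinMetric φ hφ s) c).adjoint.domain,
      (∀ b k, ((F (b, k) : L2 (grushinMetric φ hφ s)) : Cyl → ℂ)
        =ᵐ[area (grushinMetric φ hφ s).coeff s.region] fun p => h b p * fourier k p.2) ∧
      LinearIndependent ℂ fun j =>
        (closureDomain (curvatureLaplacian (grushinMetric φ hφ s) c)).mkQ (F j) := by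
  obtain ⟨σ, hσ, hs⟩ := s.exists_sign
  have hσ0 : σ ≠ 0 := by rintro rfl; norm_num at hσ
  have hm : 0 < min ε 1 := lt_min hε one_pos
  -- The outer radius must be below `ε` for the support and below `1` for the estimates.
  let χ : ContDiffBump (0 : ℝ) := ⟨min ε 1 / 4, min ε 1 / 2, by linarith, by linarith⟩
  have hχ : χ.rOut < 1 := by
    change min ε 1 / 2 < 1
    linarith [min_le_right ε 1]
  have hχε : χ.rOut < ε := by
    change min ε 1 / 2 < ε
    linarith [min_le_left ε 1]
  let κ : ∀ b, Corrector (indicialRoot c b) c := fun b =>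
    (nonempty_corrector (indicialRoot_pos hc b) (indicialRoot_eq hc b)).some
  have hsm : ∀ b k, SmoothOn (mode (κ b) χ φ σ k) s.region := fun b k =>
    (smoothOn_mode hφ (κ b) χ hσ0 k).mono fun p hp => s.fst_ne_zero hp
  have hL2 : ∀ b k, MemLp (mode (κ b) χ φ σ k) 2 (area (grushinMetric φ hφ s).coeff s.region) :=
    fun b k => memLp_mode hφ s (κ b) χ hσ hs (indicialRoot_pos hc b) hχ.le k
  have hA : ∀ b k, MemLp (curvatureLaplaceExpr (grushinMetric φ hφ s).coeff c
      (mode (κ b) χ φ σ k)) 2 (area (grushinMetric φ hφ s).coeff s.region) := fun b k =>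
    memLp_expr_mode hφ s (κ b) χ hσ hs (indicialRoot_pos hc b) (indicialRoot_eq hc b) hχ k
  have hd := dense_domain_grushin hφ s c
  have hsymm := curvatureLaplacian_isFormalAdjoint (grushinMetric φ hφ s) c
  let F : Bool × ℤ → (curvatureLaplacian (grushinMetric φ hφ s) c).adjoint.domain := fun j =>
    ⟨(hL2 j.1 j.2).toLp _, mem_adjoint_domain _ c (hsm j.1 j.2) (hL2 j.1 j.2) (hA j.1 j.2)⟩
  have hF : ∀ j, (curvatureLaplacian (grushinMetric φ hφ s) c).adjoint (F j) =
      (hA j.1 j.2).toLp _ := fun j =>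
    adjoint_apply _ c hd (hsm j.1 j.2) (hL2 j.1 j.2) (hA j.1 j.2)
  refine ⟨fun b => mode (κ b) χ φ σ 0, fun b => ⟨hsm b 0, hL2 b 0, fun p hp => ?_⟩, F,
    fun b k => ?_, ?_⟩
  · have h1 : 0 < σ * p.1 := by
      by_contra h
      exact hp (mode_of_not_half (κ b) χ 0 h)
    refine ⟨hs p h1, ?_⟩
    by_contra h
    exact hp (mode_of_rOut_le (κ b) χ 0 (hχε.le.trans (not_lt.1 h)))
  · filter_upwards [(hL2 b k).coeFn_toLp] with p hp
    exact hp.trans (mode_eq_mul_fourier (κ b) χ k p)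
  · refine linearIndependent_of_pairing
      -- The functional dual to `(b, k)` is the boundary form with the mode of the opposite root and
      -- the same frequency.
      (fun j => boundaryForm (curvatureLaplacian (grushinMetric φ hφ s) c) (F (!j.1, j.2)))
      (fun j x hx => ?_) ?_ ?_
    · exact sub_eq_zero.2 (inner_adjoint_of_mem_closureDomain hd hsymm hx _)
    · rintro ⟨b, k⟩ ⟨b', k'⟩ hne
      change inner ℂ ((curvatureLaplacian (grushinMetric φ hφ s) c).adjoint (F (b', k')))
          ((hL2 (!b) k).toLp _) - inner ℂ ((hL2 b' k').toLp _)
          ((curvatureLaplacian (grushinMetric φ hφ s) c).adjoint (F (!b, k))) = 0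
      rw [hF, hF]
      by_cases hb : b' = !b
      · subst hb
        -- Equal roots: the profiles coincide, so all Wronskians vanish, the two mixed ones by
        -- antisymmetry.
        have hzero : weightedWronskian (fun t => t ^ indicialRoot c (!b))
            (fun t => indicialRoot c (!b) * t ^ (indicialRoot c (!b) - 1)) (κ (!b)).q (κ (!b)).q' +
            weightedWronskian (κ (!b)).q (κ (!b)).q' (fun t => t ^ indicialRoot c (!b))
              (fun t => indicialRoot c (!b) * t ^ (indicialRoot c (!b) - 1)) = fun _ => 0 := by
          ext t
          rw [Pi.add_apply, weightedWronskian_swap, neg_add_cancel]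
        have := boundary_form_mode hφ s (κ (!b)) (κ (!b)) χ hσ hs (indicialRoot_pos hc _)
          (indicialRoot_pos hc _) (indicialRoot_eq hc _) (indicialRoot_eq hc _) hχ k k' (w := 0)
          (by rw [weightedWronskian_self]; exact tendsto_const_nhds)
          ((tendsto_const_nhds (x := (0 : ℝ))).congr fun t => (congrFun hzero t).symm)
          (by rw [weightedWronskian_self]; exact tendsto_const_nhds)
        refine this.trans ?_
        simp
      · have hb' : b' = b := by cases b <;> cases b' <;> simp_all
        subst hb'
        -- Opposite roots: the frequencies differ, and orthogonality of the exponentials gives zero.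
        have hk : k ≠ k' := fun h => hne (by rw [h])
        have hsum : indicialRoot c (!b') + indicialRoot c b' = 2 := by
          rw [add_comm]; exact indicialRoot_add_not b'
        have := boundary_form_mode hφ s (κ (!b')) (κ b') χ hσ hs (indicialRoot_pos hc _)
          (indicialRoot_pos hc _) (indicialRoot_eq hc _) (indicialRoot_eq hc _) hχ k k'
          (tendsto_wronskian_rpow hsum)
          (tendsto_wronskian_mixed _ _ hsum (indicialRoot_pos hc _) (indicialRoot_pos hc _))
          (tendsto_wronskian_corrector _ _ hsum)
        refine this.trans ?_
        simp [hk]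
    · rintro ⟨b, k⟩
      change inner ℂ ((curvatureLaplacian (grushinMetric φ hφ s) c).adjoint (F (b, k)))
          ((hL2 (!b) k).toLp _) - inner ℂ ((hL2 b k).toLp _)
          ((curvatureLaplacian (grushinMetric φ hφ s) c).adjoint (F (!b, k))) ≠ 0
      rw [hF, hF]
      have hsum : indicialRoot c (!b) + indicialRoot c b = 2 := by
        rw [add_comm]; exact indicialRoot_add_not b
      have := boundary_form_mode hφ s (κ (!b)) (κ b) χ hσ hs (indicialRoot_pos hc _)
        (indicialRoot_pos hc _) (indicialRoot_eq hc _) (indicialRoot_eq hc _) hχ k k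
        (tendsto_wronskian_rpow hsum)
        (tendsto_wronskian_mixed _ _ hsum (indicialRoot_pos hc _) (indicialRoot_pos hc _))
        (tendsto_wronskian_corrector _ _ hsum)
      refine this.trans_ne ?_
      rw [if_pos rfl]
      refine neg_ne_zero.2 (mul_ne_zero (Complex.ofReal_ne_zero.2 ?_) ?_)
      · have := indicialRoot_ne_not hc (!b)
        rwa [Bool.not_not] at this
      · exact_mod_cast Real.two_pi_pos.ne'

include hc in
theorem not_finiteDimensional_adjointModClosure : ¬ FiniteDimensional ℂ
    (AdjointModClosure (curvatureLaplacian (grushinMetric φ hφ s) c)) := by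
  intro h
  obtain ⟨-, -, F, -, hF⟩ := exists_independent_modes hφ hc s one_pos
  exact not_finite_iff_infinite.2 inferInstance hF.finite

end Main

end Grushin

end

theorem theorem4p2 (φ : Grushin.Cyl → ℝ) (hφ : Grushin.SmoothOn φ Set.univ)
    (hφ_const : ∃ R : ℝ, 0 < R ∧ ∀ (x : ℝ) (θ : AddCircle (2 * Real.pi)),
      (R ≤ x → φ (x, θ) = φ (R, θ)) ∧ (x ≤ -R → φ (x, θ) = φ (-R, θ)))
    (c : ℝ) (hc : c ∈ Set.Ioo (0 : ℝ) (1 / 2)) (s : Grushin.Zone) :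
    let g := Grushin.grushinMetric φ hφ s
    let A := Grushin.curvatureLaplacian g c
    -- `A` is densely defined and symmetric, and its closure is contained in its adjoint
    Dense (A.domain : Set (Grushin.L2 g)) ∧ A.IsFormalAdjoint A ∧ A.IsClosable ∧
      A.closure ≤ A.adjoint ∧
    -- `D(A*) / D(closure of A)` has infinite dimension
    ¬ FiniteDimensional ℂ (Grushin.AdjointModClosure A) ∧
    -- the deficiency indices are infinite
    ¬ FiniteDimensional ℂ (Grushin.deficiencySpace A Complex.I) ∧
    ¬ FiniteDimensional ℂ (Grushin.deficiencySpace A (-Complex.I)) ∧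
    -- the family `h_± e^{iky}`
    ∀ ε : ℝ, 0 < ε → ∃ h : Bool → Grushin.Cyl → ℂ,
      (∀ b, Grushin.SmoothOn (h b) s.region ∧
        MeasureTheory.MemLp (h b) 2 (Grushin.area g.coeff s.region) ∧
        Function.support (h b) ⊆ {p | p ∈ s.region ∧ |p.1| < ε}) ∧
      ∃ F : Bool × ℤ → A.adjoint.domain,
        (∀ b k, ((F (b, k) : Grushin.L2 g) : Grushin.Cyl → ℂ)
          =ᵐ[Grushin.area g.coeff s.region] fun p => h b p * fourier k p.2) ∧
        LinearIndependent ℂ fun j => (Grushin.closureDomain A).mkQ (F j) := by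
  intro g A
  have hd : Dense (A.domain : Set (Grushin.L2 g)) := Grushin.dense_domain_grushin hφ s c
  have hs : A.IsFormalAdjoint A := Grushin.curvatureLaplacian_isFormalAdjoint g c
  have hinf : ¬ FiniteDimensional ℂ (Grushin.AdjointModClosure A) :=
    Grushin.not_finiteDimensional_adjointModClosure hφ hc s
  have hconj : ∀ z, FiniteDimensional ℂ (Grushin.deficiencySpace A z) →
      FiniteDimensional ℂ (Grushin.deficiencySpace A (starRingEnd ℂ z)) :=
    Grushin.finiteDimensional_deficiencySpace_conj hd (Grushin.conjL2 g) (fun x => star_star x)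
      (Grushin.inner_conjL2 g) (Grushin.conjL2_curvatureLaplacian g c)
  refine ⟨hd, hs, Grushin.isClosable_of_isFormalAdjoint hd hs, Grushin.closure_le_adjoint hd hs,
    hinf, fun h => hinf ?_, fun h => hinf ?_, fun ε hε =>
    Grushin.exists_independent_modes hφ hc s hε⟩
  -- If one deficiency space were finite-dimensional, conjugation would make the other one so, and
  -- then the quotient as well.
  · refine Grushin.finiteDimensional_adjointModClosure hd hs h ?_
    have := hconj _ h
    rwa [Complex.conj_I] at this
  · refine Grushin.finiteDimensional_adjointModClosure hd hs ?_ h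
    have := hconj _ h
    rwa [map_neg, Complex.conj_I, neg_neg] at this
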